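/- A Hodge representation $(G,\rho,\varphi)$ of weight $w\in\mathbb{Z}$ on $(V,Q)$ consists of an algebraic group $G$ over $\mathbb{Q}$, a finite-dimensional $\mathbb{Q}$-vector space $V$ with a bilinear form $Q$, a representation $\rho:G\to\mathrm{Aut}(V,Q)$ defined over $\mathbb{Q}$, and a non-constant homomorphism $\varphi:S^1\to G_{\mathbb{R}}$ of real algebraic groups such that $\rho\circ\varphi$ is a Hodge structure of weight $w$ on $V$ polarized by $Q$; here $V^{p,q}\subset V_{\mathbb{C}}$ is the subspace on which $\rho(\varphi(z))$ is $z^{p-q}$ for all $z\in S^1$. Let $m\ge 0$ be the largest integer $p-q$ with $V^{p,q}\neq 0$. The Hodge representation is of Calabi--Yau type if $\dim_{\mathbb{C}}V^{p,q}=1$ for $p-q=m$, $p+q=w$. Let $G$ be semisimple (and connected), let $(G,\rho,\varphi)$ be a Hodge representation, and assume that $V_{\mathbb{R}}$ is an irreducible representation of $G(\mathbb{R})$. Let $U$ be an associated irreducible complex representation of $G_{\mathbb{C}}$, that is, $V_{\mathbb{C}}\simeq U$ (then $U$ is called real) or $V_{\mathbb{C}}\simeq U\oplus U^*$ (then $U$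 is called complex if $U\not\simeq U^*$, and quaternionic otherwise). Let $\mathtt{T}_\varphi\in\mathfrak{g}_{\mathbb{C}}$ be defined by $4\pi\mathbf{i}\,\mathtt{T}_\varphi=\frac{d}{dt}\big|_{t=0}\varphi(e^{2\pi\mathbf{i}t})$. Choose a Cartan subalgebra $\mathfrak{t}_{\mathbb{C}}$ of $\mathfrak{g}_{\mathbb{C}}$ containing $\mathtt{T}_\varphi$ and simple roots $\sigma_1,\dots,\sigma_r$ such that $\mathtt{T}_\varphi=\sum n_i\mathtt{T}_i$ with all $n_i\ge 0$, where $\mathtt{T}_1,\dots,\mathtt{T}_r$ is the basis of $\mathfrak{t}_{\mathbb{C}}$ dual to the simple roots. Let $\mu=\sum\mu^i\omega_i$ be the highest weight of $U$, with $\omega_i$ the fundamental weights (so $\mu^i=\mu(\sigma_i^\vee)$), and let $\mu^*=-w_0(\mu)$, where $w_0$ is the longest element of the Weyl group. Then: 1. Suppose that, interchanging $U$ and $U^*$ if necessary, $\mu(\mathtt{T}_\varphi)\ge\mu^*(\mathtt{T}_\varphi)$. The Hodge representation is of Calabi--Yau type if and only if $\{i : n_i=0\}\subset\{i : \mu^i=0\}$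 and one of the following holds: (a) $U$ is real; (b) $\mu(\mathtt{T}_\varphi)\neq\mu^*(\mathtt{T}_\varphi)$. 2. $U$ is real if and only if $\mu=\mu^*$ and $\sum_{n_i\in 2\mathbb{Z}}\mu(\mathtt{T}_i)$ is an integer. 3. If $\mu(\mathtt{T}_\varphi)\neq\mu^*(\mathtt{T}_\varphi)$, then $U$ is complex. -/

import Mathlib

open scoped TensorProduct

attribute [local instance 100] LieRing.ofAssociativeRing

namespace HodgeCY

noncomputable section

/-! ## Linear algebraic groups over `ℚ`

A linear algebraic group over `ℚ` is given by its group of complex points, a subgroup of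
`GL_N(ℂ)` which is the zero locus in `GL_N(ℂ)` of polynomials with rational coefficients. -/

/-- The matrix entries of an invertible matrix, as a point of affine `N²`-space. -/
def entries {N : ℕ} (g : Matrix.GeneralLinearGroup (Fin N) ℂ) : Fin N × Fin N → ℂ :=
  fun ij => (g : Matrix (Fin N) (Fin N) ℂ) ij.1 ij.2

/-- `G` is Zariski closed in `GL_N(ℂ)`, with equations over `ℚ`. -/
def IsClosedOverQ {N : ℕ} (G : Subgroup (Matrix.GeneralLinearGroup (Fin N) ℂ)) : Prop :=
  ∃ S : Set (MvPolynomial (Fin N × Fin N) ℚ),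
    ∀ g, g ∈ G ↔ ∀ p ∈ S, MvPolynomial.aeval (entries g) p = 0

/-- The ideal of the complex polynomials in the matrix entries that vanish on `G`. -/
def idealOf {N : ℕ} (G : Subgroup (Matrix.GeneralLinearGroup (Fin N) ℂ)) :
    Ideal (MvPolynomial (Fin N × Fin N) ℂ) :=
  MvPolynomial.vanishingIdeal ℂ (entries '' (G : Set (Matrix.GeneralLinearGroup (Fin N) ℂ)))

/-- The left-invariant derivation `D_X` of the polynomials on `N × N` matrices attached to the
matrix `X`, that is `(D_X p)(g) = d/dt p(g(1 + tX))` at `t = 0`. -/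
def leftInvariantDerivation {N : ℕ} (X : Matrix (Fin N) (Fin N) ℂ) :
    Derivation ℂ (MvPolynomial (Fin N × Fin N) ℂ) (MvPolynomial (Fin N × Fin N) ℂ) :=
  MvPolynomial.mkDerivation ℂ
    (fun ij => ∑ k, MvPolynomial.X (ij.1, k) * MvPolynomial.C (X k ij.2))

theorem leftInvariantDerivation_X {N : ℕ} (X : Matrix (Fin N) (Fin N) ℂ) (ij : Fin N × Fin N) :
    leftInvariantDerivation X (MvPolynomial.X ij) =
      ∑ k, MvPolynomial.X (ij.1, k) * MvPolynomial.C (X k ij.2) :=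
  MvPolynomial.mkDerivation_X ℂ _ _

theorem leftInvariantDerivation_zero {N : ℕ} :
    leftInvariantDerivation (0 : Matrix (Fin N) (Fin N) ℂ) = 0 := by
  apply MvPolynomial.derivation_ext
  intro ij
  simp [leftInvariantDerivation_X]

theorem leftInvariantDerivation_add {N : ℕ} (X Y : Matrix (Fin N) (Fin N) ℂ) :
    leftInvariantDerivation (X + Y) = leftInvariantDerivation X + leftInvariantDerivation Y := by
  apply MvPolynomial.derivation_ext
  intro ij
  simp [leftInvariantDerivation_X, mul_add, Finset.sum_add_distrib]

theorem leftInvariantDerivation_smul {N : ℕ} (c : ℂ) (X : Matrix (Fin N) (Fin N) ℂ) :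
    leftInvariantDerivation (c • X) = c • leftInvariantDerivation X := by
  apply MvPolynomial.derivation_ext
  intro ij
  simp only [leftInvariantDerivation_X, Derivation.smul_apply, Matrix.smul_apply, smul_eq_mul,
    MvPolynomial.C_mul, Finset.smul_sum, MvPolynomial.smul_eq_C_mul]
  exact Finset.sum_congr rfl fun k _ => by ring

theorem leftInvariantDerivation_lie {N : ℕ} (X Y : Matrix (Fin N) (Fin N) ℂ) :
    leftInvariantDerivation ⁅X, Y⁆ = ⁅leftInvariantDerivation X, leftInvariantDerivation Y⁆ := by
  have key : ∀ (A B : Matrix (Fin N) (Fin N) ℂ) (ij : Fin N × Fin N),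
      leftInvariantDerivation A (leftInvariantDerivation B (MvPolynomial.X ij)) =
        ∑ k, MvPolynomial.X (ij.1, k) * MvPolynomial.C ((A * B) k ij.2) := by
    intro A B ij
    simp only [leftInvariantDerivation_X, map_sum, Derivation.leibniz, smul_eq_mul,
      Matrix.mul_apply, Finset.mul_sum, MvPolynomial.C_mul]
    rw [Finset.sum_comm]
    refine Finset.sum_congr rfl fun k _ => ?_
    have hC : leftInvariantDerivation A (MvPolynomial.C (B k ij.2)) = 0 :=
      MvPolynomial.derivation_C _ _
    rw [hC, mul_zero, zero_add]
    exact Finset.sum_congr rfl fun l _ => by ring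
  apply MvPolynomial.derivation_ext
  intro ij
  rw [Derivation.commutator_apply, key, key, leftInvariantDerivation_X, ← Finset.sum_sub_distrib]
  refine Finset.sum_congr rfl fun k _ => ?_
  rw [Ring.lie_def, Matrix.sub_apply, MvPolynomial.C_sub, mul_sub]

/-- The Lie algebra of `G(ℂ)`: the matrices `X` whose left-invariant derivation preserves the ideal
of `G`. (This is the tangent space of `G` at the identity, with the commutator of matrices.) -/
def lieAlg {N : ℕ} (G : Subgroup (Matrix.GeneralLinearGroup (Fin N) ℂ)) :
    LieSubalgebra ℂ (Matrix (Fin N) (Fin N) ℂ) where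
  carrier := {X | ∀ p ∈ idealOf G, leftInvariantDerivation X p ∈ idealOf G}
  zero_mem' p _ := by
    rw [leftInvariantDerivation_zero]
    exact (idealOf G).zero_mem
  add_mem' {X Y} hX hY p hp := by
    rw [leftInvariantDerivation_add, Derivation.add_apply]
    exact (idealOf G).add_mem (hX p hp) (hY p hp)
  smul_mem' c X hX p hp := by
    rw [leftInvariantDerivation_smul, Derivation.smul_apply, MvPolynomial.smul_eq_C_mul]
    exact (idealOf G).mul_mem_left _ (hX p hp)
  lie_mem' {X Y} hX hY p hp := by
    rw [leftInvariantDerivation_lie, Derivation.commutator_apply]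
    exact (idealOf G).sub_mem (hX _ (hY p hp)) (hY _ (hX p hp))

/-- `G` is a semisimple linear algebraic group over `ℚ`: closed over `ℚ`, connected (an algebraic
group is connected exactly if it is irreducible as a variety), and with semisimple Lie algebra,
which in characteristic zero is the same as having trivial radical. -/
class IsSemisimpleOverQ {N : ℕ} (G : Subgroup (Matrix.GeneralLinearGroup (Fin N) ℂ)) : Prop where
  isClosedOverQ : IsClosedOverQ G
  connected : (idealOf G).IsPrime
  semisimple : LieAlgebra.HasTrivialRadical ℂ (lieAlg G)

instance instHasTrivialRadical {N : ℕ} (G : Subgroup (Matrix.GeneralLinearGroup (Fin N) ℂ))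
    [h : IsSemisimpleOverQ G] : LieAlgebra.HasTrivialRadical ℂ (lieAlg G) :=
  h.semisimple

/-- `g` is a real point of `G`. -/
def IsRealPoint {N : ℕ} {G : Subgroup (Matrix.GeneralLinearGroup (Fin N) ℂ)} (g : G) : Prop :=
  ∀ i j, ((g : Matrix.GeneralLinearGroup (Fin N) ℂ) i j).im = 0

/-- `φ` is a homomorphism `S¹ → G_ℝ` of real algebraic groups: the matrix entries of `φ(z)` are
real polynomials in the real and imaginary parts of `z`. In particular `φ(z) ∈ G(ℝ)`. -/
def IsAlgebraicCircle {N : ℕ} {G : Subgroup (Matrix.GeneralLinearGroup (Fin N) ℂ)}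
    (φ : Circle →* G) : Prop :=
  ∀ i j, ∃ p : MvPolynomial (Fin 2) ℝ, ∀ z : Circle,
    (φ z : Matrix.GeneralLinearGroup (Fin N) ℂ) i j =
      ((MvPolynomial.eval ![(z : ℂ).re, (z : ℂ).im] p : ℝ) : ℂ)

/-! ## Complexifications of rational vector spaces -/

section Complexification

variable (V : Type*) [AddCommGroup V] [Module ℚ V]

/-- `V_ℝ`, as a real subspace of `V_ℂ = ℂ ⊗ V`. -/
def realPoints : Submodule ℝ (ℂ ⊗[ℚ] V) :=
  Submodule.span ℝ (Set.range fun v : V => (1 : ℂ) ⊗ₜ[ℚ] v)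

/-- Complex conjugation on `V_ℂ = ℂ ⊗ V`. -/
def conj : (ℂ ⊗[ℚ] V) →ₗ[ℚ] (ℂ ⊗[ℚ] V) :=
  LinearMap.rTensor V (Complex.conjAe.toLinearMap.restrictScalars ℚ)

variable {V}

/-- The complex linear form on `V_ℂ` that extends a rational linear form on `V`. -/
def extend (l : Module.Dual ℚ V) : (ℂ ⊗[ℚ] V) →ₗ[ℂ] ℂ :=
  Module.Dual.baseChange ℂ l

/-- The representation `ρ` of `G(ℂ)` on `V_ℂ` is the one of a representation of the algebraic group
`G` on `V` defined over `ℚ`: its matrix coefficients with respect to `V` are regular functions over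
`ℚ`, that is polynomials in the matrix entries over a power of the determinant. -/
def IsDefinedOverQ {N : ℕ} {G : Subgroup (Matrix.GeneralLinearGroup (Fin N) ℂ)}
    (ρ : Representation ℂ G (ℂ ⊗[ℚ] V)) : Prop :=
  ∀ (v : V) (l : Module.Dual ℚ V), ∃ (p : MvPolynomial (Fin N × Fin N) ℚ) (k : ℕ), ∀ g : G,
    extend l (ρ g (1 ⊗ₜ[ℚ] v)) *
        (Matrix.det ((g : Matrix.GeneralLinearGroup (Fin N) ℂ) : Matrix (Fin N) (Fin N) ℂ)) ^ k =
      MvPolynomial.aeval (entries (g : Matrix.GeneralLinearGroup (Fin N) ℂ)) p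

/-- `V_ℝ` is an irreducible representation of `G(ℝ)`. -/
def IsRealIrreducible {N : ℕ} {G : Subgroup (Matrix.GeneralLinearGroup (Fin N) ℂ)}
    (ρ : Representation ℂ G (ℂ ⊗[ℚ] V)) : Prop :=
  Nontrivial V ∧ ∀ W : Submodule ℝ (ℂ ⊗[ℚ] V), W ≤ realPoints V →
    (∀ g : G, IsRealPoint g → ∀ w ∈ W, ρ g w ∈ W) → W = ⊥ ∨ W = realPoints V

/-! ## Polarized Hodge structures -/

/-- The subspace of `V_ℂ` on which `z ∈ S¹` acts by `z ^ k`. -/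
def circleWeightSpace (ψ : Representation ℂ Circle (ℂ ⊗[ℚ] V)) (k : ℤ) :
    Submodule ℂ (ℂ ⊗[ℚ] V) where
  carrier := {v | ∀ z : Circle, ψ z v = ((z : ℂ) ^ k) • v}
  zero_mem' z := by simp
  add_mem' {v w} hv hw z := by rw [map_add, hv z, hw z, smul_add]
  smul_mem' c v hv z := by rw [map_smul, hv z, smul_comm]

/-- A Hodge structure of weight `n` on the rational vector space `V`: a homomorphism
`ψ : S¹ → SL(V_ℝ)` of real algebraic groups with `ψ(-1) = (-1)^n`. Here `ψ(z)` is extended to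
`V_ℂ`, and it is required to preserve `V_ℝ`. -/
structure IsHodgeStructure (n : ℤ) (ψ : Representation ℂ Circle (ℂ ⊗[ℚ] V)) : Prop where
  real : ∀ z, ∀ v ∈ realPoints V, ψ z v ∈ realPoints V
  det_eq_one : ∀ z, LinearMap.det (ψ z) = 1
  algebraic : ∀ (v : V) (l : Module.Dual ℚ V), ∃ p : MvPolynomial (Fin 2) ℝ, ∀ z : Circle,
    extend l (ψ z (1 ⊗ₜ[ℚ] v)) = ((MvPolynomial.eval ![(z : ℂ).re, (z : ℂ).im] p : ℝ) : ℂ)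
  weight : ∀ v, ψ (-1) v = ((-1 : ℂ) ^ n) • v

/-- The piece `V^{p,q}`, on which `z ∈ S¹` acts by `z ^ (p - q)`. -/
def hodgePiece (ψ : Representation ℂ Circle (ℂ ⊗[ℚ] V)) (p q : ℤ) : Submodule ℂ (ℂ ⊗[ℚ] V) :=
  circleWeightSpace ψ (p - q)

/-- The Hodge filtration `F^p`, the sum of the `V^{a,n-a}` with `a ≥ p`. -/
def hodgeFiltration (n : ℤ) (ψ : Representation ℂ Circle (ℂ ⊗[ℚ] V)) (p : ℤ) :
    Submodule ℂ (ℂ ⊗[ℚ] V) :=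
  ⨆ a : ℤ, ⨆ _ : p ≤ a, hodgePiece ψ a (n - a)

/-- The point `i` of the unit circle. -/
def circleI : Circle := Circle.exp (Real.pi / 2)

/-- `Q` polarizes the Hodge structure `ψ` of weight `n`: it is nondegenerate, `(-1)^n`-symmetric,
and satisfies the Hodge-Riemann bilinear relations. -/
structure IsPolarization (n : ℤ) (ψ : Representation ℂ Circle (ℂ ⊗[ℚ] V))
    (Q : LinearMap.BilinForm ℚ V) : Prop where
  nondegenerate : Q.Nondegenerate
  parity : ∀ u v, Q u v = (-1 : ℚ) ^ n * Q v u
  first : ∀ p : ℤ, ∀ x ∈ hodgeFiltration n ψ p, ∀ y ∈ hodgeFiltration n ψ (n - p + 1),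
    LinearMap.BilinForm.baseChange ℂ Q x y = 0
  second : ∀ v : ℂ ⊗[ℚ] V, v ≠ 0 →
    0 < (LinearMap.BilinForm.baseChange ℂ Q v (ψ circleI (conj V v))).re ∧
      (LinearMap.BilinForm.baseChange ℂ Q v (ψ circleI (conj V v))).im = 0

/-- The Hodge structure `ψ` is of Calabi-Yau type: the nonzero piece `V^{p,q}` for which `p - q` is
the largest (and equal to `m ≥ 0`) has complex dimension one. -/
def IsCalabiYau (ψ : Representation ℂ Circle (ℂ ⊗[ℚ] V)) : Prop :=
  ∃ m : ℕ, (∀ k : ℤ, (m : ℤ) < k → circleWeightSpace ψ k = ⊥) ∧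
    Module.finrank ℂ (circleWeightSpace ψ m) = 1

/-- The Hodge structure `ρ ∘ φ` on `V`, for `φ : S¹ → G` and a representation `ρ` of `G`. -/
def inducedCircle {N : ℕ} {G : Subgroup (Matrix.GeneralLinearGroup (Fin N) ℂ)}
    (ρ : Representation ℂ G (ℂ ⊗[ℚ] V)) (φ : Circle →* G) :
    Representation ℂ Circle (ℂ ⊗[ℚ] V) :=
  MonoidHom.comp ρ φ

/-- `(G, ρ, φ)` is a Hodge representation on `(V, Q)`, of weight `n`: `ρ : G → Aut(V, Q)` is defined
over `ℚ`, `φ : S¹ → G_ℝ` is a non-constant homomorphism of real algebraic groups, and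
`(V, Q, ρ ∘ φ)` is a polarized Hodge structure. -/
structure IsHodgeRepresentation {N : ℕ} {G : Subgroup (Matrix.GeneralLinearGroup (Fin N) ℂ)}
    (n : ℤ) (Q : LinearMap.BilinForm ℚ V) (ρ : Representation ℂ G (ℂ ⊗[ℚ] V))
    (φ : Circle →* G) : Prop where
  isDefinedOverQ : IsDefinedOverQ ρ
  preserves : ∀ (g : G) (x y : ℂ ⊗[ℚ] V), LinearMap.BilinForm.baseChange ℂ Q (ρ g x) (ρ g y) =
    LinearMap.BilinForm.baseChange ℂ Q x y
  isAlgebraicCircle : IsAlgebraicCircle φ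
  nonconstant : φ ≠ 1
  isHodgeStructure : IsHodgeStructure n (inducedCircle ρ φ)
  isPolarization : IsPolarization n (inducedCircle ρ φ) Q

end Complexification

/-! ## Grading elements, highest weights and types of representations -/

/-- The matrix `T_φ` with `4πi T_φ = L_φ`, where `L_φ` is the derivative at `t = 0` of
`t ↦ φ(exp(2πi t))`. -/
def gradingMatrix {N : ℕ} {G : Subgroup (Matrix.GeneralLinearGroup (Fin N) ℂ)}
    (φ : Circle →* G) : Matrix (Fin N) (Fin N) ℂ :=
  (4 * (Real.pi : ℂ) * Complex.I)⁻¹ • Matrix.of fun i j =>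
    deriv (fun t : ℝ =>
      (φ (Circle.exp (2 * Real.pi * t)) : Matrix.GeneralLinearGroup (Fin N) ℂ) i j) 0

section Roots

variable {N : ℕ} {G : Subgroup (Matrix.GeneralLinearGroup (Fin N) ℂ)} [IsSemisimpleOverQ G]
  {H : LieSubalgebra ℂ (lieAlg G)} [H.IsCartanSubalgebra]

open Classical in
/-- The basis `T_1, …, T_r` of the Cartan subalgebra dual to the simple roots. -/
def dualBasis (b : (LieAlgebra.IsKilling.rootSystem H).Base) : Module.Basis b.support ℂ H :=
  b.toWeightBasis.dualBasis.map (Module.evalEquiv ℂ H).symm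

open Classical in
theorem root_dualBasis (b : (LieAlgebra.IsKilling.rootSystem H).Base) (i j : b.support) :
    (LieAlgebra.IsKilling.rootSystem H).root i (dualBasis b j) = if i = j then 1 else 0 := by
  have h := Module.apply_evalEquiv_symm_apply (R := ℂ) (M := H)
    ((LieAlgebra.IsKilling.rootSystem H).root i) (b.toWeightBasis.dualBasis j)
  rw [dualBasis, Module.Basis.map_apply, h, ← b.toWeightBasis_apply i,
    Module.Basis.dualBasis_apply_self]

/-- `w` is the longest element of the Weyl group: it makes every positive root negative. -/
def IsLongest (b : (LieAlgebra.IsKilling.rootSystem H).Base)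
    (w : (LieAlgebra.IsKilling.rootSystem H).weylGroup) : Prop :=
  ∀ i, b.IsPos i → ¬ b.IsPos (w • i)

/-- `μ` is the highest weight of the representation `τ` of `G(ℂ)`: there is a nonzero vector on
which `exp h` acts by `e^{μ(h)}` for all `h` in the Cartan subalgebra, and which is fixed by
`exp e` for all `e` in the positive root spaces. -/
def IsHighestWeight {U : Type*} [AddCommGroup U] [Module ℂ U]
    (b : (LieAlgebra.IsKilling.rootSystem H).Base) (τ : Representation ℂ G U)
    (μ : Module.Dual ℂ H) : Prop :=
  ∃ u : U, u ≠ 0 ∧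
    (∀ (h : H) (g : G),
      ((g : Matrix.GeneralLinearGroup (Fin N) ℂ) : Matrix (Fin N) (Fin N) ℂ) =
        NormedSpace.exp ((h : lieAlg G) : Matrix (Fin N) (Fin N) ℂ) →
      τ g u = Complex.exp (μ h) • u) ∧
    (∀ i : H.root, b.IsPos i →
      ∀ e ∈ LieAlgebra.rootSpace H (i : LieModule.Weight ℂ H (lieAlg G)), ∀ g : G,
      ((g : Matrix.GeneralLinearGroup (Fin N) ℂ) : Matrix (Fin N) (Fin N) ℂ) =
        NormedSpace.exp (e : Matrix (Fin N) (Fin N) ℂ) →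
      τ g u = u)

open Classical in
/-- The sum of the `μ(T_i)` over the simple roots for which `n_i` is an even integer. -/
def evenSum (b : (LieAlgebra.IsKilling.rootSystem H).Base) (n : b.support → ℝ)
    (μ : Module.Dual ℂ H) : ℂ :=
  ∑ i : b.support, if ∃ k : ℤ, n i = 2 * k then μ (dualBasis b i) else 0

end Roots

section Types

variable {N : ℕ} {G : Subgroup (Matrix.GeneralLinearGroup (Fin N) ℂ)}
  {V : Type*} [AddCommGroup V] [Module ℚ V] {U : Type*} [AddCommGroup U] [Module ℂ U]

/-- `V_ℂ ≃ U`: the representation `U` is real. -/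
def IsRealType (ρ : Representation ℂ G (ℂ ⊗[ℚ] V)) (τ : Representation ℂ G U) : Prop :=
  Nonempty (ρ.Equiv τ)

/-- `V_ℂ ≃ U ⊕ U*`. -/
def IsSumWithDual (ρ : Representation ℂ G (ℂ ⊗[ℚ] V)) (τ : Representation ℂ G U) : Prop :=
  Nonempty (ρ.Equiv (τ.prod τ.dual))

/-- `V_ℂ ≃ U ⊕ U*` with `U` and `U*` not isomorphic: the representation `U` is complex. -/
def IsComplexType (ρ : Representation ℂ G (ℂ ⊗[ℚ] V)) (τ : Representation ℂ G U) : Prop :=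
  IsSumWithDual ρ τ ∧ IsEmpty (τ.Equiv τ.dual)

/-- `U` is the irreducible complex representation associated with `V`: either `V_ℂ ≃ U`, or
`V_ℂ ≃ U ⊕ U*`. -/
def IsAssociated (ρ : Representation ℂ G (ℂ ⊗[ℚ] V)) (τ : Representation ℂ G U) : Prop :=
  τ.IsIrreducible ∧ (IsRealType ρ τ ∨ IsSumWithDual ρ τ)

end Types

end

end HodgeCY

/-! Differentiating `τ` gives a representation `L` of the Lie algebra on U, and z ∈ S¹ acts by z^k
on a vector exactly when T has eigenvalue k/2 on it. All weights of U have the form μ minus a sum of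
simple roots. As n_i ≥ 0, the largest eigenvalue of T is μ(T) on U and μ*(T) on U*. The
μ(T)-eigenspace is the line of the highest weight vector exactly when no lowering operator with n_i
= 0 moves that vector, that is, when μ^i = 0 for all such i (`finrank_eigenspace_eq_one_iff`). If
V_ℂ = U, this eigenspace is the top Hodge piece. If V_ℂ = U ⊕ U*, then U* adds to the top piece
exactly when μ*(T) = μ(T). This is the Calabi-Yau criterion.

For the type of U: U ≃ U* amounts to μ = μ*. In that case U has an invariant form, symmetric or
alternating, and a principal sl₂-triple computes its sign as (-1)^{2μ(P)} with P = ∑ T_i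
(`sign_of_invariant_form`). If U is real, the polarization is such a form and its sign is (-1)^w.
Conversely, suppose U has a form of sign (-1)^w and V_ℂ = U ⊕ U*. The form pulls back to a
degenerate form on V_ℂ, but polarization and irreducibility over ℝ make every invariant form of that
symmetry a multiple of Q (`IsHodgeRepresentation.eq_zero_of_degenerate`), a contradiction. So U is
real exactly when U is selfdual and the two signs agree. Since φ(-1) acts by (-1)^w = e^{2πi μ(T)},
the signs agree when μ(P) - μ(T) is an integer. Modulo ℤ this difference is the sum of the μ(T_i)
with n_i even (`exists_sub_eq_evenSum_add`). If U is real or selfdual, then μ = μ*, which gives the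
last assertion.

The passage from the Lie algebra back to G rests on the Zariski density of the subgroup generated by
exponentials. The proof of density is algebraic: an ideal stable under the left-invariant
derivations and vanishing at the identity is compared with the ideal of G by means of an Euler field
and Krull's intersection theorem (`le_idealOf_of_derivation_stable`). -/

namespace HodgeCY

noncomputable section

/-! ## Zariski density of one-parameter subgroups -/

section Density

variable {N : ℕ}

/-- Evaluation of a polynomial in the matrix entries at a matrix. -/
def evalMat (A : Matrix (Fin N) (Fin N) ℂ) : MvPolynomial (Fin N × Fin N) ℂ →ₐ[ℂ] ℂ :=
  MvPolynomial.aeval fun ij => A ij.1 ij.2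

@[simp]
theorem evalMat_X (A : Matrix (Fin N) (Fin N) ℂ) (ij : Fin N × Fin N) :
    evalMat A (MvPolynomial.X ij) = A ij.1 ij.2 := by
  simp [evalMat]

@[simp]
theorem evalMat_C (A : Matrix (Fin N) (Fin N) ℂ) (c : ℂ) :
    evalMat A (MvPolynomial.C c) = c := by
  simp [evalMat]

theorem mem_idealOf {G : Subgroup (Matrix.GeneralLinearGroup (Fin N) ℂ)}
    {p : MvPolynomial (Fin N × Fin N) ℂ} :
    p ∈ idealOf G ↔ ∀ g ∈ G, evalMat (g : Matrix (Fin N) (Fin N) ℂ) p = 0 := by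
  rw [idealOf, MvPolynomial.mem_vanishingIdeal_iff]
  simp only [Set.mem_image, forall_exists_index, and_imp, forall_apply_eq_imp_iff₂]
  rfl

/-- Both sides satisfy the Leibniz rule in `p`, so the hypothesis is needed only for the coordinate
functions. -/
theorem hasDerivAt_evalMat {γ : ℂ → Matrix (Fin N) (Fin N) ℂ} {X : Matrix (Fin N) (Fin N) ℂ}
    {t : ℂ} (h : ∀ i j, HasDerivAt (fun s => γ s i j) ((γ t * X) i j) t)
    (p : MvPolynomial (Fin N × Fin N) ℂ) :
    HasDerivAt (fun s => evalMat (γ s) p) (evalMat (γ t) (leftInvariantDerivation X p)) t := by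
  induction p using MvPolynomial.induction_on with
  | C a =>
    have : leftInvariantDerivation X (MvPolynomial.C a) = 0 := MvPolynomial.derivation_C _ _
    simpa [this] using hasDerivAt_const t a
  | add p q hp hq =>
    simp only [map_add]
    exact hp.add hq
  | mul_X p ij hp =>
    simp only [map_mul, evalMat_X, Derivation.leibniz, leftInvariantDerivation_X, map_add,
      smul_eq_mul, map_sum, evalMat_C]
    refine (hp.mul (h ij.1 ij.2)).congr_deriv ?_
    rw [Matrix.mul_apply]
    ring

theorem exp_entries_hasDerivAt (g X : Matrix (Fin N) (Fin N) ℂ) (t : ℂ) (i j : Fin N) :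
    HasDerivAt (fun s : ℂ => (g * NormedSpace.exp (s • X)) i j)
      ((g * NormedSpace.exp (t • X) * X) i j) t := by
  -- Any Banach algebra norm serves here, since the conclusion concerns single entries.
  let _ : NormedRing (Matrix (Fin N) (Fin N) ℂ) := Matrix.linftyOpNormedRing
  let _ : NormedAlgebra ℂ (Matrix (Fin N) (Fin N) ℂ) := Matrix.linftyOpNormedAlgebra
  have h := ((hasDerivAt_exp_smul_const X t).const_mul g).congr_deriv (mul_assoc _ _ _).symm
  exact (hasDerivAt_pi.1 ((hasDerivAt_pi.1 h) i)) j

theorem hasDerivAt_evalMat_exp (g X : Matrix (Fin N) (Fin N) ℂ)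
    (p : MvPolynomial (Fin N × Fin N) ℂ) (t : ℂ) :
    HasDerivAt (fun s : ℂ => evalMat (g * NormedSpace.exp (s • X)) p)
      (evalMat (g * NormedSpace.exp (t • X)) (leftInvariantDerivation X p)) t :=
  hasDerivAt_evalMat (exp_entries_hasDerivAt g X t) p

/-- A family of functions that vanish at `0` and is stable under derivation is zero. -/
theorem eq_zero_of_deriv_closed (S : Set (ℂ → ℂ))
    (h : ∀ f ∈ S, f 0 = 0 ∧ ∃ f' ∈ S, ∀ t, HasDerivAt f (f' t) t) :
    ∀ f ∈ S, f = 0 := by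
  -- Quantifying over all of `S` lets the induction pass to the derivative. All Taylor coefficients
  -- at 0 of these entire functions then vanish.
  have hit : ∀ n : ℕ, ∀ f ∈ S, iteratedDeriv n f 0 = 0 := by
    intro n
    induction n with
    | zero => intro f hf; simpa using (h f hf).1
    | succ n ih =>
      intro f hf
      obtain ⟨f', hf', hd⟩ := (h f hf).2
      rw [iteratedDeriv_succ', show deriv f = f' from funext fun t => (hd t).deriv]
      exact ih f' hf'
  intro f hf
  obtain ⟨f', -, hd⟩ := (h f hf).2
  have hdiff : Differentiable ℂ f := fun t => (hd t).differentiableAt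
  funext z
  rw [← Complex.taylorSeries_eq_of_entire' 0 z hdiff]
  simp [hit _ f hf]

/-- The polynomial `h ↦ p (g h)`. -/
def leftTranslate (g : Matrix (Fin N) (Fin N) ℂ) :
    MvPolynomial (Fin N × Fin N) ℂ →ₐ[ℂ] MvPolynomial (Fin N × Fin N) ℂ :=
  MvPolynomial.aeval fun ij => ∑ k, MvPolynomial.C (g ij.1 k) * MvPolynomial.X (k, ij.2)

theorem evalMat_leftTranslate (g h : Matrix (Fin N) (Fin N) ℂ)
    (p : MvPolynomial (Fin N × Fin N) ℂ) :
    evalMat h (leftTranslate g p) = evalMat (g * h) p := by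
  have : (evalMat h).comp (leftTranslate g) = evalMat (g * h) := by
    apply MvPolynomial.algHom_ext
    intro ij
    simp [leftTranslate, Matrix.mul_apply]
  exact DFunLike.congr_fun this p

variable (G : Subgroup (Matrix.GeneralLinearGroup (Fin N) ℂ))

/-- Left translation by an element of G preserves the ideal and commutes with left-invariant
derivations, so tangency at the identity propagates to all of G. -/
theorem mem_lieAlg_of_forall_evalMat_one {X : Matrix (Fin N) (Fin N) ℂ}
    (h : ∀ p ∈ idealOf G, evalMat 1 (leftInvariantDerivation X p) = 0) : X ∈ lieAlg G := by
  intro p hp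
  rw [mem_idealOf] at hp ⊢
  intro g hg
  have h1 := hasDerivAt_evalMat_exp (g : Matrix (Fin N) (Fin N) ℂ) X p 0
  have h2 := hasDerivAt_evalMat_exp 1 X (leftTranslate (g : Matrix (Fin N) (Fin N) ℂ) p) 0
  simp only [evalMat_leftTranslate, zero_smul, NormedSpace.exp_zero, mul_one, one_mul] at h1 h2
  rw [h1.unique h2]
  refine h _ (mem_idealOf.2 fun x hx => ?_)
  rw [evalMat_leftTranslate]
  exact hp (g * x) (G.mul_mem hg hx)

/-- The polynomials that vanish at the identity matrix. -/
def idealOne (N : ℕ) : Ideal (MvPolynomial (Fin N × Fin N) ℂ) :=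
  RingHom.ker (evalMat (1 : Matrix (Fin N) (Fin N) ℂ))

theorem mem_idealOne {p : MvPolynomial (Fin N × Fin N) ℂ} : p ∈ idealOne N ↔ evalMat 1 p = 0 :=
  RingHom.mem_ker

theorem idealOf_le_idealOne : idealOf G ≤ idealOne N := fun p hp => by
  simpa [mem_idealOne] using mem_idealOf.1 hp 1 G.one_mem

/-- The linear form on matrices that is the differential at the identity of a polynomial. -/
def differentialAtOne : MvPolynomial (Fin N × Fin N) ℂ →ₗ[ℂ]
    Module.Dual ℂ (Matrix (Fin N) (Fin N) ℂ) :=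
  LinearMap.mk₂ ℂ (fun p X => evalMat 1 (leftInvariantDerivation X p))
    (fun p q X => by simp) (fun c p X => by simp)
    (fun p X Y => by simp [leftInvariantDerivation_add])
    (fun c p X => by simp [leftInvariantDerivation_smul])

@[simp]
theorem differentialAtOne_apply (p : MvPolynomial (Fin N × Fin N) ℂ)
    (X : Matrix (Fin N) (Fin N) ℂ) :
    differentialAtOne p X = evalMat 1 (leftInvariantDerivation X p) := rfl

/-- The polynomial `g ↦ l (g - 1)` for a linear form `l` on matrices. -/
def linearPoly (N : ℕ) : Module.Dual ℂ (Matrix (Fin N) (Fin N) ℂ) →ₗ[ℂ]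
    MvPolynomial (Fin N × Fin N) ℂ where
  toFun l := ∑ ij : Fin N × Fin N, MvPolynomial.C (l (Matrix.single ij.1 ij.2 1)) *
    (MvPolynomial.X ij - MvPolynomial.C ((1 : Matrix (Fin N) (Fin N) ℂ) ij.1 ij.2))
  map_add' l l' := by simp [add_mul, Finset.sum_add_distrib]
  map_smul' c l := by
    simp [Finset.smul_sum, MvPolynomial.smul_eq_C_mul, mul_assoc]

theorem linearPoly_mem (l : Module.Dual ℂ (Matrix (Fin N) (Fin N) ℂ)) :
    linearPoly N l ∈ idealOne N := by
  simp [mem_idealOne, linearPoly]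

theorem idealOne_eq_span : idealOne N = Ideal.span (Set.range fun ij : Fin N × Fin N =>
    (MvPolynomial.X ij - MvPolynomial.C ((1 : Matrix (Fin N) (Fin N) ℂ) ij.1 ij.2) :
      MvPolynomial (Fin N × Fin N) ℂ)) := by
  apply le_antisymm
  · intro p hp
    have key : ∀ q : MvPolynomial (Fin N × Fin N) ℂ, q - MvPolynomial.C (evalMat 1 q) ∈
        Ideal.span (Set.range fun ij : Fin N × Fin N =>
          (MvPolynomial.X ij - MvPolynomial.C ((1 : Matrix (Fin N) (Fin N) ℂ) ij.1 ij.2) :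
            MvPolynomial (Fin N × Fin N) ℂ)) := by
      intro q
      induction q using MvPolynomial.induction_on with
      | C a => simp
      | add p q hp hq =>
        convert Ideal.add_mem _ hp hq using 1
        simp
        ring
      | mul_X p ij hp =>
        have h1 := Ideal.mul_mem_right (MvPolynomial.C ((1 : Matrix (Fin N) (Fin N) ℂ) ij.1 ij.2))
          _ hp
        have h2 := Ideal.mul_mem_left (Ideal.span (Set.range fun ij : Fin N × Fin N =>
          (MvPolynomial.X ij - MvPolynomial.C ((1 : Matrix (Fin N) (Fin N) ℂ) ij.1 ij.2) :
            MvPolynomial (Fin N × Fin N) ℂ))) p (Ideal.subset_span (Set.mem_range_self ij))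
        convert Ideal.add_mem _ h1 h2 using 1
        simp only [map_mul, evalMat_X]
        ring
    have := key p
    rwa [mem_idealOne.1 hp, map_zero, sub_zero] at this
  · rw [Ideal.span_le]
    rintro _ ⟨ij, rfl⟩
    simp [mem_idealOne]

theorem linearPoly_differentialAtOne_X (ij : Fin N × Fin N) :
    linearPoly N (differentialAtOne (MvPolynomial.X ij -
      MvPolynomial.C ((1 : Matrix (Fin N) (Fin N) ℂ) ij.1 ij.2))) =
    MvPolynomial.X ij - MvPolynomial.C ((1 : Matrix (Fin N) (Fin N) ℂ) ij.1 ij.2) := by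
  have h : ∀ X : Matrix (Fin N) (Fin N) ℂ, differentialAtOne (MvPolynomial.X ij -
      MvPolynomial.C ((1 : Matrix (Fin N) (Fin N) ℂ) ij.1 ij.2)) X = X ij.1 ij.2 := by
    intro X
    rw [differentialAtOne_apply, map_sub, leftInvariantDerivation_X,
      show leftInvariantDerivation X (MvPolynomial.C _) = 0 from MvPolynomial.derivation_C _ _]
    simp [Matrix.one_apply]
  simp only [linearPoly, LinearMap.coe_mk, AddHom.coe_mk, h]
  rw [Finset.sum_eq_single ij]
  · simp
  · intro b _ hb
    rw [Matrix.single_apply, if_neg, map_zero, zero_mul]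
    rintro ⟨h1, h2⟩
    exact hb (Prod.ext h1 h2)
  · simp

/-- First-order Taylor expansion at the identity. It is exact on the generators, and modulo the
square a coefficient may be replaced by its value at the identity. -/
theorem sub_linearPoly_mem {p : MvPolynomial (Fin N × Fin N) ℂ} (hp : p ∈ idealOne N) :
    p - linearPoly N (differentialAtOne p) ∈ idealOne N ^ 2 := by
  rw [idealOne_eq_span] at hp
  induction hp using Submodule.span_induction with
  | mem x hx =>
    obtain ⟨ij, rfl⟩ := hx
    simp only [linearPoly_differentialAtOne_X, sub_self, zero_mem]
  | zero => simp
  | add x y _ _ hx hy =>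
    convert Ideal.add_mem _ hx hy using 1
    rw [map_add, map_add]
    ring
  | smul c x hx ih =>
    have hx' : x ∈ idealOne N := by rw [idealOne_eq_span]; exact hx
    have h1 : differentialAtOne (c • x) = evalMat 1 c • differentialAtOne x := by
      ext1 X
      simp [mem_idealOne.1 hx']
    have h2 : c - MvPolynomial.C (evalMat 1 c) ∈ idealOne N := by simp [mem_idealOne]
    have h3 : (c - MvPolynomial.C (evalMat 1 c)) * x ∈ idealOne N ^ 2 := by
      rw [pow_two]; exact Ideal.mul_mem_mul h2 hx'
    have h4 := Ideal.mul_mem_left _ (MvPolynomial.C (evalMat 1 c)) ih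
    convert Ideal.add_mem _ h3 h4 using 1
    rw [h1, map_smul, MvPolynomial.smul_eq_C_mul, smul_eq_mul]
    ring

/-- By double annihilators in finite dimension, a form that kills the Lie algebra is the
differential of an element of `idealOf G`. That element equals its linear part up to second order.
-/
theorem linearPoly_mem_of_vanishes {l : Module.Dual ℂ (Matrix (Fin N) (Fin N) ℂ)}
    (hl : ∀ X ∈ lieAlg G, l X = 0) : linearPoly N l ∈ idealOne N ^ 2 ⊔ idealOf G := by
  have hmem : l ∈ ((idealOf G).restrictScalars ℂ).map differentialAtOne := by
    rw [← Subspace.dualCoannihilator_dualAnnihilator_eq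
      (W := ((idealOf G).restrictScalars ℂ).map differentialAtOne), Submodule.mem_dualAnnihilator]
    intro X hX
    rw [Submodule.mem_dualCoannihilator] at hX
    exact hl X (mem_lieAlg_of_forall_evalMat_one G fun p hp => hX _ ⟨p, hp, rfl⟩)
  obtain ⟨p, hp, rfl⟩ := hmem
  have hp' : p ∈ idealOf G := hp
  have h1 := sub_linearPoly_mem (idealOf_le_idealOne G hp')
  have : linearPoly N (differentialAtOne p) =
      -(p - linearPoly N (differentialAtOne p)) + p := by ring
  rw [this]
  exact Submodule.add_mem_sup (neg_mem h1) hp'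

/-- An Euler vector field for the group `G` at the identity. -/
theorem exists_euler : ∃ E : Derivation ℂ (MvPolynomial (Fin N × Fin N) ℂ)
    (MvPolynomial (Fin N × Fin N) ℂ),
    (∀ p ∈ idealOne N, E p - p ∈ idealOne N ^ 2 ⊔ idealOf G) ∧
    (∀ J : Ideal (MvPolynomial (Fin N × Fin N) ℂ),
      (∀ X ∈ lieAlg G, ∀ p ∈ J, leftInvariantDerivation X p ∈ J) →
        ∀ p ∈ J, E p ∈ idealOne N * J) := by
  let B := Module.finBasis ℂ (lieAlg G)
  have hext : ∀ i, ∃ l : Module.Dual ℂ (Matrix (Fin N) (Fin N) ℂ),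
      ∀ X : lieAlg G, l X = B.coord i X := by
    intro i
    obtain ⟨l, hl⟩ := LinearMap.exists_extend (p := (lieAlg G).toSubmodule) (B.coord i)
    exact ⟨l, fun X => DFunLike.congr_fun hl X⟩
  choose ξ hξ using hext
  -- Coordinates on the Lie algebra, extended to all matrices, times the corresponding
  -- left-invariant fields: the radial vector field along G to first order.
  let E : Derivation ℂ (MvPolynomial (Fin N × Fin N) ℂ) (MvPolynomial (Fin N × Fin N) ℂ) :=
    ∑ i, linearPoly N (ξ i) • leftInvariantDerivation (B i : Matrix (Fin N) (Fin N) ℂ)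
  have hE : ∀ p, E p = ∑ i, linearPoly N (ξ i) *
      leftInvariantDerivation (B i : Matrix (Fin N) (Fin N) ℂ) p := by
    intro p
    change Derivation.coeFnAddMonoidHom E p = _
    rw [map_sum, Finset.sum_apply]
    rfl
  have hJ : ∀ J : Ideal (MvPolynomial (Fin N × Fin N) ℂ),
      (∀ X ∈ lieAlg G, ∀ p ∈ J, leftInvariantDerivation X p ∈ J) →
        ∀ p ∈ J, E p ∈ idealOne N * J := by
    intro J hJ p hp
    rw [hE]
    exact Ideal.sum_mem _ fun i _ => Ideal.mul_mem_mul (linearPoly_mem _)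
      (hJ _ (B i).2 p hp)
  refine ⟨E, ?_, hJ⟩
  intro p hp
  -- compare `E p` with the value of the differential of `p` on the basis
  have h1 : E p - ∑ i, linearPoly N (ξ i) * MvPolynomial.C (differentialAtOne p (B i)) ∈
      idealOne N ^ 2 := by
    rw [hE, ← Finset.sum_sub_distrib, pow_two]
    refine Ideal.sum_mem _ fun i _ => ?_
    rw [← mul_sub]
    refine Ideal.mul_mem_mul (linearPoly_mem _) ?_
    simp [mem_idealOne]
  -- The two linear forms agree on the Lie algebra, by expansion in the basis `B`.
  have h2 : linearPoly N (∑ i, differentialAtOne p (B i) • ξ i - differentialAtOne p) ∈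
      idealOne N ^ 2 ⊔ idealOf G := by
    apply linearPoly_mem_of_vanishes
    intro X hX
    have : X = ((∑ i, B.repr ⟨X, hX⟩ i • B i : lieAlg G) : Matrix (Fin N) (Fin N) ℂ) := by
      rw [B.sum_repr]
    have hd : differentialAtOne p X = ∑ i, B.repr ⟨X, hX⟩ i * differentialAtOne p (B i) := by
      conv_lhs => rw [this]
      rw [show ((∑ i, B.repr ⟨X, hX⟩ i • B i : lieAlg G) : Matrix (Fin N) (Fin N) ℂ) =
        ∑ i, B.repr ⟨X, hX⟩ i • (B i : Matrix (Fin N) (Fin N) ℂ) from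
        map_sum (lieAlg G).toSubmodule.subtype _ _, map_sum]
      simp only [map_smul, smul_eq_mul]
    rw [LinearMap.sub_apply, hd, LinearMap.sum_apply, sub_eq_zero]
    refine Finset.sum_congr rfl fun i _ => ?_
    rw [LinearMap.smul_apply, smul_eq_mul, show ξ i X = B.repr ⟨X, hX⟩ i from hξ i ⟨X, hX⟩]
    ring
  have h3 := sub_linearPoly_mem hp
  have : E p - p = (E p - ∑ i, linearPoly N (ξ i) * MvPolynomial.C (differentialAtOne p (B i))) +
      linearPoly N (∑ i, differentialAtOne p (B i) • ξ i - differentialAtOne p) -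
      (p - linearPoly N (differentialAtOne p)) := by
    rw [map_sub, map_sum]
    simp only [map_smul, MvPolynomial.smul_eq_C_mul]
    rw [show ∑ i, linearPoly N (ξ i) * MvPolynomial.C (differentialAtOne p (B i)) =
      ∑ i, MvPolynomial.C (differentialAtOne p (B i)) * linearPoly N (ξ i) from
      Finset.sum_congr rfl fun i _ => mul_comm _ _]
    ring
  rw [this]
  exact sub_mem (add_mem (Ideal.mem_sup_left h1) h2) (Ideal.mem_sup_left h3)

variable {G}

theorem mem_sup_of_mem_sup_mul {R : Type*} [CommRing R] {I A B : Ideal R} {x : R}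
    (h : x ∈ A ⊔ B * I) : x ∈ A ⊔ I :=
  (sup_le_sup_left (Ideal.mul_le_right : B * I ≤ I) A) h

/-- Euler's relation. A derivation that is the identity on m/m² modulo the ideal of G is
multiplication by n on mⁿ/mⁿ⁺¹, by the Leibniz rule. -/
theorem euler_sub_smul_mem
    {E : Derivation ℂ (MvPolynomial (Fin N × Fin N) ℂ) (MvPolynomial (Fin N × Fin N) ℂ)}
    (hE1 : ∀ p ∈ idealOne N, E p - p ∈ idealOne N ^ 2 ⊔ idealOf G)
    (hE0 : ∀ p, E p ∈ idealOne N) (n : ℕ) :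
    ∀ p ∈ idealOne N ^ n, E p - (n : ℂ) • p ∈ idealOne N ^ (n + 1) ⊔ idealOf G := by
  induction n with
  | zero =>
    intro p _
    simpa using Ideal.mem_sup_left (hE0 p)
  | succ n ih =>
    intro p hp
    rw [pow_succ'] at hp
    refine Submodule.mul_induction_on hp ?_ ?_
    · intro a ha b hb
      have key : E (a * b) - ((n + 1 : ℕ) : ℂ) • (a * b) =
          a * (E b - (n : ℂ) • b) + b * (E a - a) := by
        rw [Derivation.leibniz]
        simp only [smul_eq_mul, MvPolynomial.smul_eq_C_mul]
        push_cast
        simp only [map_add, map_natCast, map_one]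
        ring
      rw [key]
      refine add_mem ?_ ?_
      · have := Ideal.mul_mem_mul ha (ih b hb)
        rw [Ideal.mul_sup, ← pow_succ'] at this
        exact mem_sup_of_mem_sup_mul this
      · have := Ideal.mul_mem_mul hb (hE1 a ha)
        rw [Ideal.mul_sup, ← pow_add] at this
        exact mem_sup_of_mem_sup_mul this
    · intro x y hx hy
      convert add_mem hx hy using 1
      rw [map_add, smul_add]
      ring

/-- Krull's intersection theorem, relative to a prime ideal. -/
theorem le_of_forall_le_pow_sup {R : Type*} [CommRing R] [IsNoetherianRing R] {I m J : Ideal R}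
    (hI : I.IsPrime) (hIm : I ≤ m) (hm : m ≠ ⊤) (h : ∀ n : ℕ, J ≤ m ^ n ⊔ I) : J ≤ I := by
  intro p hp
  rw [← Ideal.Quotient.eq_zero_iff_mem]
  -- Since I ≤ m, the image of m in the domain R/I pulls back to m. It therefore stays proper, and
  -- Krull's theorem applies.
  have hne : m.map (Ideal.Quotient.mk I) ≠ ⊤ := by
    intro htop
    have h1 := Ideal.comap_map_of_surjective (Ideal.Quotient.mk I) Ideal.Quotient.mk_surjective m
    rw [htop, Ideal.comap_top, ← RingHom.ker_eq_comap_bot, Ideal.mk_ker, sup_eq_left.2 hIm] at h1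
    exact hm h1.symm
  have hbot := Ideal.iInf_pow_eq_bot_of_isDomain (m.map (Ideal.Quotient.mk I)) hne
  rw [← Ideal.mem_bot, ← hbot, Ideal.mem_iInf]
  intro n
  have := Ideal.mem_map_of_mem (Ideal.Quotient.mk I) (h n hp)
  rwa [Ideal.map_sup, Ideal.map_quotient_self, sup_bot_eq, Ideal.map_pow] at this

/-- An ideal of polynomials that vanish at the identity, which contains the ideal of the connected
group `G` and is stable under the derivations attached to `lieAlg G`, is the ideal of `G`. -/
theorem le_idealOf_of_derivation_stable (hG : (idealOf G).IsPrime)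
    (J : Ideal (MvPolynomial (Fin N × Fin N) ℂ)) (hJ1 : J ≤ idealOne N)
    (hD : ∀ X ∈ lieAlg G, ∀ p ∈ J, leftInvariantDerivation X p ∈ J) : J ≤ idealOf G := by
  obtain ⟨E, hE1, hE2⟩ := exists_euler G
  have hEI : ∀ p ∈ idealOf G, E p ∈ idealOf G := by
    intro p hp
    have h : E p ∈ idealOne N * idealOf G := hE2 (idealOf G) (fun X hX p hp => hX p hp) p hp
    exact (Ideal.mul_le_right : idealOne N * idealOf G ≤ idealOf G) h
  have hE0 : ∀ p, E p ∈ idealOne N := by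
    intro p
    have h : E p ∈ idealOne N * ⊤ := hE2 ⊤ (fun _ _ _ _ => Submodule.mem_top) p Submodule.mem_top
    rwa [Ideal.mul_top] at h
  have hEn := euler_sub_smul_mem hE1 hE0
  refine le_of_forall_le_pow_sup hG (idealOf_le_idealOne G) (RingHom.ker_ne_top _) ?_
  -- Bootstrapping: write p = q + r with q ∈ mⁿ and r in the ideal of G. Then `E p` lies in m J,
  -- hence in mⁿ⁺¹ modulo the ideal of G, while `E q` is n q to the same order. As n is invertible,
  -- q gains one order. For n = 0 one cannot divide, and `hJ1` gives the step.
  intro n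
  induction n with
  | zero => simp
  | succ n ih =>
    rcases Nat.eq_zero_or_pos n with rfl | hn
    · simpa using le_sup_of_le_left hJ1
    intro p hp
    obtain ⟨q, hq, r, hr, rfl⟩ := Submodule.mem_sup.1 (ih hp)
    have h1 : E (q + r) ∈ idealOne N ^ (n + 1) ⊔ idealOf G := by
      have := Ideal.mul_mono_right ih (hE2 J hD _ hp)
      rw [Ideal.mul_sup, ← pow_succ'] at this
      exact mem_sup_of_mem_sup_mul this
    have h3 : (n : ℂ) • q ∈ idealOne N ^ (n + 1) ⊔ idealOf G := by
      have : (n : ℂ) • q = E (q + r) - E r - (E q - (n : ℂ) • q) := by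
        rw [map_add]; ring
      rw [this]
      exact sub_mem (sub_mem h1 (Ideal.mem_sup_right (hEI r hr))) (hEn n q hq)
    have hne : (n : ℂ) ≠ 0 := by exact_mod_cast hn.ne'
    have h4 : q ∈ idealOne N ^ (n + 1) ⊔ idealOf G := by
      have := Ideal.mul_mem_left _ (MvPolynomial.C ((n : ℂ)⁻¹)) h3
      rwa [← MvPolynomial.smul_eq_C_mul, smul_smul, inv_mul_cancel₀ hne, one_smul] at this
    exact add_mem h4 (Ideal.mem_sup_right hr)

end Density

/-! ## Exponentials and differentials of representations -/

section Differential

variable {N : ℕ} {G : Subgroup (Matrix.GeneralLinearGroup (Fin N) ℂ)}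

/-- The functions t ↦ q(exp tX), for q in the ideal, vanish at 0 and form a family closed under
d/dt. -/
theorem evalMat_exp_eq_zero {p : MvPolynomial (Fin N × Fin N) ℂ} (hp : p ∈ idealOf G)
    {X : Matrix (Fin N) (Fin N) ℂ} (hX : X ∈ lieAlg G) (t : ℂ) :
    evalMat (NormedSpace.exp (t • X)) p = 0 := by
  have h := eq_zero_of_deriv_closed
    {f | ∃ q ∈ idealOf G, f = fun t : ℂ => evalMat (NormedSpace.exp (t • X)) q} ?_
    (fun t : ℂ => evalMat (NormedSpace.exp (t • X)) p) ⟨p, hp, rfl⟩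
  · exact congrFun h t
  · rintro _ ⟨q, hq, rfl⟩
    refine ⟨?_, _, ⟨leftInvariantDerivation X q, hX q hq, rfl⟩, fun t => ?_⟩
    · simpa [mem_idealOne] using idealOf_le_idealOne G hq
    · simpa using hasDerivAt_evalMat_exp 1 X q t

/-- The rational equations of G, read over ℂ, belong to `idealOf G` and so vanish on exponentials.
-/
theorem exists_coe_eq_exp [IsSemisimpleOverQ G] (X : lieAlg G) :
    ∃ g : G, ((g : Matrix.GeneralLinearGroup (Fin N) ℂ) : Matrix (Fin N) (Fin N) ℂ) =
      NormedSpace.exp (X : Matrix (Fin N) (Fin N) ℂ) := by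
  obtain ⟨g, hg⟩ := Matrix.isUnit_exp (X : Matrix (Fin N) (Fin N) ℂ)
  obtain ⟨S, hS⟩ := IsSemisimpleOverQ.isClosedOverQ (G := G)
  have hmap : ∀ (x : Matrix.GeneralLinearGroup (Fin N) ℂ) (p : MvPolynomial (Fin N × Fin N) ℚ),
      evalMat (x : Matrix (Fin N) (Fin N) ℂ) (MvPolynomial.map (algebraMap ℚ ℂ) p) =
        MvPolynomial.aeval (entries x) p := fun x p =>
    MvPolynomial.aeval_map_algebraMap ℂ (entries x) p
  have hgG : (g : Matrix.GeneralLinearGroup (Fin N) ℂ) ∈ G := by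
    rw [hS]
    intro p hp
    rw [← hmap g p, hg]
    have : MvPolynomial.map (algebraMap ℚ ℂ) p ∈ idealOf G :=
      mem_idealOf.2 fun x hx => by rw [hmap]; exact (hS x).1 hx p hp
    simpa using evalMat_exp_eq_zero this X.2 1
  exact ⟨⟨g, hgG⟩, hg⟩

theorem eq_of_coe_eq {g h : G}
    (H : ((g : Matrix.GeneralLinearGroup (Fin N) ℂ) : Matrix (Fin N) (Fin N) ℂ) =
      ((h : Matrix.GeneralLinearGroup (Fin N) ℂ) : Matrix (Fin N) (Fin N) ℂ)) : g = h :=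
  Subtype.ext (Units.ext H)

variable [IsSemisimpleOverQ G]

/-- The exponential map of `G`. -/
def expG (X : lieAlg G) : G := (exists_coe_eq_exp X).choose

theorem coe_expG (X : lieAlg G) :
    ((expG X : Matrix.GeneralLinearGroup (Fin N) ℂ) : Matrix (Fin N) (Fin N) ℂ) =
      NormedSpace.exp (X : Matrix (Fin N) (Fin N) ℂ) :=
  (exists_coe_eq_exp X).choose_spec

theorem coe_expG_smul (t : ℂ) (X : lieAlg G) :
    ((expG (t • X) : Matrix.GeneralLinearGroup (Fin N) ℂ) : Matrix (Fin N) (Fin N) ℂ) =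
      NormedSpace.exp (t • (X : Matrix (Fin N) (Fin N) ℂ)) :=
  coe_expG _

theorem expG_zero : expG (0 : lieAlg G) = 1 :=
  eq_of_coe_eq (by rw [coe_expG]; exact NormedSpace.exp_zero)

theorem expG_add_smul (s t : ℂ) (X : lieAlg G) :
    expG ((s + t) • X) = expG (s • X) * expG (t • X) := by
  apply eq_of_coe_eq
  rw [coe_expG_smul, add_smul, Matrix.exp_add_of_commute _ _
    ((Commute.refl (X : Matrix (Fin N) (Fin N) ℂ)).smul_left s |>.smul_right t)]
  simp [coe_expG_smul]

variable {U : Type*} [AddCommGroup U] [Module ℂ U]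

/-- The matrix coefficients of `τ` are regular functions on `G`. -/
def IsAlgebraicRep (τ : Representation ℂ G U) : Prop :=
  ∀ (u : U) (l : Module.Dual ℂ U), ∃ (p : MvPolynomial (Fin N × Fin N) ℂ) (k : ℕ), ∀ g : G,
    l (τ g u) *
        (Matrix.det ((g : Matrix.GeneralLinearGroup (Fin N) ℂ) : Matrix (Fin N) (Fin N) ℂ)) ^ k =
      evalMat ((g : Matrix.GeneralLinearGroup (Fin N) ℂ) : Matrix (Fin N) (Fin N) ℂ) p

/-- The Lie algebra representation `L` is the differential of `τ`. -/
def HasDifferential (τ : Representation ℂ G U) (L : lieAlg G →ₗ⁅ℂ⁆ Module.End ℂ U) : Prop :=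
  ∀ (X : lieAlg G) (u : U) (l : Module.Dual ℂ U),
    HasDerivAt (fun t : ℂ => l (τ (expG (t • X)) u)) (l (L X u)) 0

theorem HasDifferential.hasDerivAt {τ : Representation ℂ G U}
    {L : lieAlg G →ₗ⁅ℂ⁆ Module.End ℂ U} (h : HasDifferential τ L) (X : lieAlg G) (u : U)
    (l : Module.Dual ℂ U) (t : ℂ) :
    HasDerivAt (fun s : ℂ => l (τ (expG (s • X)) u)) (l (τ (expG (t • X)) (L X u))) t := by
  have h0 := h X u (l ∘ₗ τ (expG (t • X)))
  have h1 : HasDerivAt (fun s : ℂ => s - t) 1 t := (hasDerivAt_id t).sub_const t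
  have h2 := HasDerivAt.comp (h := fun s : ℂ => s - t) (h' := 1) t (by simpa using h0) h1
  refine (h2.congr_deriv (by simp)).congr_of_eventuallyEq (Filter.Eventually.of_forall fun s => ?_)
  have : expG (s • X) = expG (t • X) * expG ((s - t) • X) := by
    rw [← expG_add_smul]; congr 2; ring
  simp [this]

/-- The differential at the identity of the `k`-th power of the determinant. -/
def detDifferential (N k : ℕ) : Module.Dual ℂ (Matrix (Fin N) (Fin N) ℂ) :=
  differentialAtOne ((Matrix.mvPolynomialX (Fin N) (Fin N) ℂ).det ^ k)

theorem evalMat_det (A : Matrix (Fin N) (Fin N) ℂ) (k : ℕ) :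
    evalMat A ((Matrix.mvPolynomialX (Fin N) (Fin N) ℂ).det ^ k) = A.det ^ k := by
  rw [map_pow, AlgHom.map_det]
  congr 2
  ext i j
  simp

theorem coe_det_exp_hasDerivAt (X : Matrix (Fin N) (Fin N) ℂ) (k : ℕ) :
    HasDerivAt (fun t : ℂ => (Matrix.det (NormedSpace.exp (t • X))) ^ k)
      (detDifferential N k X) 0 := by
  have h := hasDerivAt_evalMat_exp 1 X ((Matrix.mvPolynomialX (Fin N) (Fin N) ℂ).det ^ k) 0
  simp only [one_mul, evalMat_det, zero_smul, NormedSpace.exp_zero] at h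
  exact h

/-- A power of the determinant is a character, so its second derivative at the identity along X and
Y is a product of scalars, symmetric in X and Y. -/
theorem detDifferential_lie (X Y : Matrix (Fin N) (Fin N) ℂ) (k : ℕ) :
    detDifferential N k ⁅X, Y⁆ = 0 := by
  have h1 : ∀ (X g : Matrix (Fin N) (Fin N) ℂ), evalMat g (leftInvariantDerivation X
      ((Matrix.mvPolynomialX (Fin N) (Fin N) ℂ).det ^ k)) = g.det ^ k * detDifferential N k X := by
    intro X g
    have h := hasDerivAt_evalMat_exp g X ((Matrix.mvPolynomialX (Fin N) (Fin N) ℂ).det ^ k) 0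
    simp only [evalMat_det, zero_smul, NormedSpace.exp_zero, mul_one, Matrix.det_mul,
      mul_pow] at h
    exact h.unique ((coe_det_exp_hasDerivAt X k).const_mul _)
  have h2 : ∀ X Y : Matrix (Fin N) (Fin N) ℂ, evalMat 1 (leftInvariantDerivation X
      (leftInvariantDerivation Y ((Matrix.mvPolynomialX (Fin N) (Fin N) ℂ).det ^ k))) =
        detDifferential N k X * detDifferential N k Y := by
    intro X Y
    have h := hasDerivAt_evalMat_exp 1 X
      (leftInvariantDerivation Y ((Matrix.mvPolynomialX (Fin N) (Fin N) ℂ).det ^ k)) 0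
    simp only [h1 Y, zero_smul, NormedSpace.exp_zero, one_mul] at h
    exact h.unique ((coe_det_exp_hasDerivAt X k).mul_const _)
  rw [detDifferential, differentialAtOne_apply, leftInvariantDerivation_lie,
    Derivation.commutator_apply, map_sub, h2, h2, mul_comm, sub_self]

theorem det_exp_ne_zero (X : Matrix (Fin N) (Fin N) ℂ) : (NormedSpace.exp X).det ≠ 0 := by
  have h := Matrix.isUnit_exp X
  rw [Matrix.isUnit_iff_isUnit_det] at h
  exact h.ne_zero

/-- The differential at the identity of the function `p / det ^ k` on `G`. -/
def coefficientDifferential (G : Subgroup (Matrix.GeneralLinearGroup (Fin N) ℂ))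
    (p : MvPolynomial (Fin N × Fin N) ℂ) (k : ℕ) : Module.Dual ℂ (lieAlg G) where
  toFun X := differentialAtOne p X - evalMat 1 p * detDifferential N k X
  map_add' X Y := by
    simp only [AddMemClass.coe_add, map_add]
    ring
  map_smul' c X := by
    simp only [SetLike.val_smul, map_smul, smul_eq_mul, RingHom.id_apply]
    ring

theorem hasDerivAt_coefficient {τ : Representation ℂ G U}
    (u : U) (l : Module.Dual ℂ U) (p : MvPolynomial (Fin N × Fin N) ℂ) (k : ℕ)
    (hp : ∀ g : G, l (τ g u) *
        (Matrix.det ((g : Matrix.GeneralLinearGroup (Fin N) ℂ) : Matrix (Fin N) (Fin N) ℂ)) ^ k =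
      evalMat ((g : Matrix.GeneralLinearGroup (Fin N) ℂ) : Matrix (Fin N) (Fin N) ℂ) p)
    (X : lieAlg G) :
    HasDerivAt (fun t : ℂ => l (τ (expG (t • X)) u)) (coefficientDifferential G p k X) 0 := by
  have hne : ∀ t : ℂ, (Matrix.det (NormedSpace.exp (t • (X : Matrix (Fin N) (Fin N) ℂ)))) ^ k ≠ 0 :=
    fun t => pow_ne_zero _ (det_exp_ne_zero _)
  have h1 := hasDerivAt_evalMat_exp 1 (X : Matrix (Fin N) (Fin N) ℂ) p 0
  have h2 := coe_det_exp_hasDerivAt (X : Matrix (Fin N) (Fin N) ℂ) k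
  have h3 := h1.fun_div h2 (hne 0)
  refine (h3.congr_deriv ?_).congr_of_eventuallyEq (Filter.Eventually.of_forall fun t => ?_)
  · simp only [zero_smul, NormedSpace.exp_zero, Matrix.det_one, one_pow, mul_one, div_one]
    rfl
  · have := hp (expG (t • X))
    rw [coe_expG_smul] at this
    simp only [one_mul]
    rw [eq_div_iff (hne t), this]

/-- Matrix coefficients are polynomials over powers of the determinant, so their derivatives at the
identity exist and are linear in X. Applying two left-invariant derivations to the numerators gives
compatibility with brackets. -/
theorem exists_differential [FiniteDimensional ℂ U] {τ : Representation ℂ G U}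
    (hτ : IsAlgebraicRep τ) : ∃ L : lieAlg G →ₗ⁅ℂ⁆ Module.End ℂ U, HasDifferential τ L := by
  have hδ' : ∀ (u : U) (l : Module.Dual ℂ U), ∃ δ : Module.Dual ℂ (lieAlg G), ∀ X : lieAlg G,
      HasDerivAt (fun t : ℂ => l (τ (expG (t • X)) u)) (δ X) 0 := by
    intro u l
    obtain ⟨p, k, hp⟩ := hτ u l
    exact ⟨_, hasDerivAt_coefficient u l p k hp⟩
  choose δ hδ using hδ'
  -- Uniqueness of derivatives makes `δ u l X` linear in `l`, hence an element of the double dual,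
  -- which is a vector.
  have hlin : ∀ X u, ∃ v : U, ∀ l : Module.Dual ℂ U, l v = δ u l X := by
    intro X u
    let d : Module.Dual ℂ (Module.Dual ℂ U) :=
      { toFun := fun l => δ u l X
        map_add' := fun l l' => (hδ u (l + l') X).unique ((hδ u l X).add (hδ u l' X))
        map_smul' := fun c l => (hδ u (c • l) X).unique ((hδ u l X).const_mul c) }
    exact ⟨(Module.evalEquiv ℂ U).symm d, fun l => Module.apply_evalEquiv_symm_apply ℂ U l d⟩
  choose D hD using hlin
  have hext : ∀ v w : U, (∀ l : Module.Dual ℂ U, l v = l w) → v = w := fun v w h =>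
    (Module.forall_dual_apply_eq_zero_iff ℂ (v - w)).1 (fun l => by simp [h l]) |> sub_eq_zero.1
  have hDd : ∀ X u (l : Module.Dual ℂ U),
      HasDerivAt (fun t : ℂ => l (τ (expG (t • X)) u)) (l (D X u)) 0 := by
    intro X u l
    rw [hD]
    exact hδ u l X
  let L : lieAlg G →ₗ[ℂ] Module.End ℂ U := LinearMap.mk₂ ℂ D
    (fun X Y u => hext _ _ fun l => by simp [hD])
    (fun c X u => hext _ _ fun l => by simp [hD])
    (fun X u v => hext _ _ fun l => (hDd X (u + v) l).unique (by
      simpa using (hDd X u l).fun_add (hDd X v l)))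
    (fun c X u => hext _ _ fun l => (hDd X (c • u) l).unique (by
      simpa using (hDd X u l).const_mul c))
  have hL : ∀ X u (l : Module.Dual ℂ U),
      HasDerivAt (fun t : ℂ => l (τ (expG (t • X)) u)) (l (L X u)) 0 := hDd
  -- the left-invariant derivation of the numerator of a coefficient
  have hcoef : ∀ (u : U) (l : Module.Dual ℂ U) (p : MvPolynomial (Fin N × Fin N) ℂ) (k : ℕ),
      (∀ g : G, l (τ g u) *
        (Matrix.det ((g : Matrix.GeneralLinearGroup (Fin N) ℂ) : Matrix (Fin N) (Fin N) ℂ)) ^ k =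
      evalMat ((g : Matrix.GeneralLinearGroup (Fin N) ℂ) : Matrix (Fin N) (Fin N) ℂ) p) →
      ∀ (X : lieAlg G) (g : G),
        evalMat ((g : Matrix.GeneralLinearGroup (Fin N) ℂ) : Matrix (Fin N) (Fin N) ℂ)
          (leftInvariantDerivation X p) =
        (l (τ g (L X u)) + detDifferential N k X * l (τ g u)) *
          (Matrix.det ((g : Matrix.GeneralLinearGroup (Fin N) ℂ) : Matrix (Fin N) (Fin N) ℂ)) ^ k :=
      by
    intro u l p k hp X g
    have h1 := hasDerivAt_evalMat_exp
      ((g : Matrix.GeneralLinearGroup (Fin N) ℂ) : Matrix (Fin N) (Fin N) ℂ)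
      (X : Matrix (Fin N) (Fin N) ℂ) p 0
    have h2 := coe_det_exp_hasDerivAt (X : Matrix (Fin N) (Fin N) ℂ) k
    have h3 := ((hL X u (l ∘ₗ τ g)).mul h2).mul_const ((Matrix.det
      ((g : Matrix.GeneralLinearGroup (Fin N) ℂ) : Matrix (Fin N) (Fin N) ℂ)) ^ k)
    have h4 := h1.unique (h3.congr_of_eventuallyEq (Filter.Eventually.of_forall fun t => by
      have := hp (g * expG (t • X))
      simp only [Subgroup.coe_mul, Units.val_mul, coe_expG_smul, Matrix.det_mul] at this
      simp only [← this, map_mul, Module.End.mul_apply, LinearMap.comp_apply, Pi.mul_apply]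
      ring))
    simp only [zero_smul, NormedSpace.exp_zero, mul_one, expG_zero, map_one, Module.End.one_apply,
      Matrix.det_one, one_pow, LinearMap.comp_apply] at h4
    rw [h4]
    ring
  have hbr : ∀ X Y u, L ⁅X, Y⁆ u = L X (L Y u) - L Y (L X u) := by
    intro X Y u
    refine hext _ _ fun l => ?_
    obtain ⟨p, k, hp⟩ := hτ u l
    -- the second derivative at the identity
    have h2 : ∀ X Y : lieAlg G, evalMat 1 (leftInvariantDerivation X (leftInvariantDerivation Y p)) =
        l (L X (L Y u)) + detDifferential N k X * l (L Y u) +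
          detDifferential N k Y *
            (l (L X u) + detDifferential N k X * l u) := by
      intro X Y
      have h1 := hasDerivAt_evalMat_exp 1 (X : Matrix (Fin N) (Fin N) ℂ)
        (leftInvariantDerivation Y p) 0
      have h3 := ((hL X (L Y u) l).add ((hL X u l).const_mul
        (detDifferential N k Y))).mul
        (coe_det_exp_hasDerivAt (X : Matrix (Fin N) (Fin N) ℂ) k)
      have h4 := h1.unique (h3.congr_of_eventuallyEq (Filter.Eventually.of_forall fun t => by
        have := hcoef u l p k hp Y (expG (t • X))
        rw [coe_expG_smul] at this
        simp only [one_mul, this, Pi.mul_apply, Pi.add_apply]))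
      simp only [zero_smul, NormedSpace.exp_zero, mul_one, expG_zero, map_one,
        Module.End.one_apply, Matrix.det_one, one_pow, Pi.add_apply] at h4
      rw [h4]
      ring
    -- The determinant terms in `h2` are symmetric in X and Y and cancel in the commutator; that of
    -- the bracket vanishes by `detDifferential_lie`.
    have h3 := hcoef u l p k hp ⁅X, Y⁆ 1
    have h4 : ((⁅X, Y⁆ : lieAlg G) : Matrix (Fin N) (Fin N) ℂ) =
      ⁅(X : Matrix (Fin N) (Fin N) ℂ), (Y : Matrix (Fin N) (Fin N) ℂ)⁆ := rfl
    rw [h4, detDifferential_lie, leftInvariantDerivation_lie, Derivation.commutator_apply] at h3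
    simp only [OneMemClass.coe_one, Units.val_one, map_sub, h2, map_one, Matrix.det_one, one_pow,
      Module.End.one_apply] at h3
    rw [map_sub]
    linear_combination -h3
  refine ⟨{ L with map_lie' := ?_ }, hL⟩
  intro X Y
  ext u
  rw [Ring.lie_def]
  exact hbr X Y u

/-- A subspace that is stable under the differential of `τ` is stable under `τ`. -/
theorem HasDifferential.apply_mem [FiniteDimensional ℂ U] {τ : Representation ℂ G U}
    {L : lieAlg G →ₗ⁅ℂ⁆ Module.End ℂ U} (h : HasDifferential τ L) (hτ : IsAlgebraicRep τ)
    (W : Submodule ℂ U) (hW : ∀ X, ∀ w ∈ W, L X w ∈ W) (g : G) {w : U} (hw : w ∈ W) :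
    τ g w ∈ W := by
  have hexp : ∀ X : lieAlg G, ∀ w ∈ W, τ (expG X) w ∈ W := by
    intro X w hw
    rw [← Subspace.dualAnnihilator_dualCoannihilator_eq (W := W), Submodule.mem_dualCoannihilator]
    intro l hl
    rw [Submodule.mem_dualAnnihilator] at hl
    have h0 := eq_zero_of_deriv_closed
      {f | ∃ v ∈ W, f = fun t : ℂ => l (τ (expG (t • X)) v)} ?_
      (fun t : ℂ => l (τ (expG (t • X)) w)) ⟨w, hw, rfl⟩
    · simpa using congrFun h0 1
    · rintro _ ⟨v, hv, rfl⟩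
      refine ⟨?_, _, ⟨L X v, hW X v hv, rfl⟩, fun t => h.hasDerivAt X v l t⟩
      simp [expG_zero, hl v hv]
  -- The subgroup generated by exponentials is Zariski dense. It absorbs right multiplication by
  -- exp(sX), so its ideal `J` is stable under the left-invariant derivations.
  let E : Subgroup G := Subgroup.closure (Set.range expG)
  have hinv : ∀ X : lieAlg G, (expG X)⁻¹ = expG (-X) := by
    intro X
    rw [inv_eq_iff_mul_eq_one]
    have := expG_add_smul 1 (-1) X
    simpa [expG_zero] using this.symm
  have hE : ∀ x ∈ E, ∀ w ∈ W, τ x w ∈ W := by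
    intro x hx
    induction hx using Subgroup.closure_induction'' with
    | mem x hx => obtain ⟨X, rfl⟩ := hx; exact hexp X
    | inv_mem x hx =>
      obtain ⟨X, rfl⟩ := hx
      rw [hinv]
      exact hexp _
    | one => simp
    | mul x y _ _ hx hy =>
      intro w hw
      rw [map_mul]
      exact hx _ (hy w hw)
  let J : Ideal (MvPolynomial (Fin N × Fin N) ℂ) :=
    { carrier := {p | ∀ x ∈ E, evalMat
        ((x : Matrix.GeneralLinearGroup (Fin N) ℂ) : Matrix (Fin N) (Fin N) ℂ) p = 0}
      zero_mem' := by simp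
      add_mem' := fun {p q} hp hq x hx => by simp [hp x hx, hq x hx]
      smul_mem' := fun c p hp x hx => by simp [hp x hx] }
  have hJ : J ≤ idealOf G := by
    refine le_idealOf_of_derivation_stable IsSemisimpleOverQ.connected J ?_ ?_
    · intro p hp
      simpa [mem_idealOne] using hp 1 E.one_mem
    · intro X hX p hp x hx
      have h1 := hasDerivAt_evalMat_exp
        ((x : Matrix.GeneralLinearGroup (Fin N) ℂ) : Matrix (Fin N) (Fin N) ℂ) X p 0
      have h2 : (fun s : ℂ => evalMat (((x : Matrix.GeneralLinearGroup (Fin N) ℂ) :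
          Matrix (Fin N) (Fin N) ℂ) * NormedSpace.exp (s • X)) p) = fun _ => 0 := by
        funext s
        have := hp (x * expG (s • ⟨X, hX⟩)) (E.mul_mem hx (Subgroup.subset_closure ⟨_, rfl⟩))
        rwa [Subgroup.coe_mul, Units.val_mul, coe_expG_smul] at this
      rw [h2] at h1
      simpa using h1.unique (hasDerivAt_const 0 0)
  -- W is cut out by linear forms. For such a form, the numerator of the coefficient vanishes on E,
  -- hence on G.
  rw [← Subspace.dualAnnihilator_dualCoannihilator_eq (W := W), Submodule.mem_dualCoannihilator]
  intro l hl
  rw [Submodule.mem_dualAnnihilator] at hl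
  obtain ⟨p, k, hp⟩ := hτ w l
  have hpJ : p ∈ J := by
    intro x hx
    rw [← hp x, hl _ (hE x hx w hw), zero_mul]
  have h0 := hp g
  rw [mem_idealOf.1 (hJ hpJ) g g.2] at h0
  refine (mul_eq_zero.1 h0).resolve_right (pow_ne_zero _ ?_)
  exact ((Matrix.isUnit_iff_isUnit_det _).1
    (g : Matrix.GeneralLinearGroup (Fin N) ℂ).isUnit).ne_zero

end Differential

/-! ## Highest weight theory -/

section HighestWeight

open LieAlgebra LieAlgebra.IsKilling

theorem lieHom_lie_apply {𝔤 U : Type*} [LieRing 𝔤] [LieAlgebra ℂ 𝔤] [AddCommGroup U] [Module ℂ U]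
    (L : 𝔤 →ₗ⁅ℂ⁆ Module.End ℂ U) (x y : 𝔤) (v : U) :
    L ⁅x, y⁆ v = L x (L y v) - L y (L x v) := by
  rw [LieHom.map_lie, Ring.lie_def]
  rfl

variable {𝔤 : Type*} [LieRing 𝔤] [LieAlgebra ℂ 𝔤] [FiniteDimensional ℂ 𝔤] [IsKilling ℂ 𝔤]
  {H : LieSubalgebra ℂ 𝔤} [H.IsCartanSubalgebra] (b : (rootSystem H).Base)

/-- The sum of the simple roots with multiplicities `m`. -/
def rootSum (m : b.support → ℕ) : Module.Dual ℂ H :=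
  ∑ i : b.support, (m i : ℂ) • (rootSystem H).root i

theorem rootSum_apply (m : b.support → ℕ) (h : H) :
    rootSum b m h = ∑ i : b.support, (m i : ℂ) * (rootSystem H).root i h := by
  simp [rootSum]

theorem rootSum_zero : rootSum b 0 = 0 := by simp [rootSum]

theorem rootSum_add (m m' : b.support → ℕ) : rootSum b (m + m') = rootSum b m + rootSum b m' := by
  simp [rootSum, add_smul, Finset.sum_add_distrib]

theorem rootSum_sum {ι : Type*} (s : Finset ι) (m : ι → b.support → ℕ) :
    rootSum b (∑ k ∈ s, m k) = ∑ k ∈ s, rootSum b (m k) := by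
  classical
  induction s using Finset.induction_on with
  | empty => simp [rootSum_zero]
  | insert a s ha ih => rw [Finset.sum_insert ha, Finset.sum_insert ha, rootSum_add, ih]

theorem rootSum_smul (c : ℕ) (m : b.support → ℕ) :
    rootSum b (c • m) = (c : ℂ) • rootSum b m := by
  simp [rootSum, Finset.smul_sum, mul_smul]

/-- The value of a sum of simple roots on an element on which they are real. -/
theorem rootSum_apply_real (m : b.support → ℕ) {T : H} {n : b.support → ℝ}
    (hT : ∀ i : b.support, (rootSystem H).root i T = n i) :
    rootSum b m T = ((∑ i, m i * n i : ℝ) : ℂ) := by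
  rw [rootSum_apply]
  push_cast
  exact Finset.sum_congr rfl fun i _ => by rw [hT]

theorem rootSum_injective : Function.Injective (rootSum b) := by
  intro m m' h
  have hl := Fintype.linearIndependent_iff.1 b.toWeightBasis.linearIndependent
    (fun i => (m i : ℂ) - m' i) (by
      simp only [RootPairing.Base.toWeightBasis_apply, sub_smul, Finset.sum_sub_distrib]
      exact sub_eq_zero.2 h)
  funext i
  exact_mod_cast sub_eq_zero.1 (hl i)

variable {b}

theorem exists_root_eq_rootSum_or_neg (i : H.root) :
    ∃ m : b.support → ℕ, (b.IsPos i ∧ (rootSystem H).root i = rootSum b m) ∨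
      (¬ b.IsPos i ∧ (rootSystem H).root i = -rootSum b m) := by
  obtain ⟨f, -, hf⟩ := b.exists_root_eq_sum_nat_or_neg i
  have hsum : ∑ j ∈ b.support, f j • (rootSystem H).root j =
      rootSum b fun j => f j := by
    rw [rootSum, ← Finset.sum_coe_sort]
    simp only [Nat.cast_smul_eq_nsmul]
  refine ⟨fun j => f j, ?_⟩
  rcases hf with hf | hf
  · left
    refine ⟨?_, hf.trans hsum⟩
    rw [RootPairing.Base.isPos_iff', RootPairing.Base.height_eq_sum (f := fun j => (f j : ℤ))
      (by simpa using hf)]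
    positivity
  · right
    refine ⟨?_, by rw [hf, hsum]⟩
    rw [RootPairing.Base.isPos_iff, RootPairing.Base.height_eq_sum (f := fun j => -(f j : ℤ))
      (by simpa using hf), Finset.sum_neg_distrib]
    simp only [Left.neg_pos_iff, not_lt]
    positivity

theorem exists_root_eq_rootSum {i : H.root} (hi : b.IsPos i) :
    ∃ m : b.support → ℕ, (rootSystem H).root i = rootSum b m := by
  obtain ⟨m, h | h⟩ := exists_root_eq_rootSum_or_neg (b := b) i
  · exact ⟨m, h.2⟩
  · exact absurd hi h.1

theorem exists_root_eq_neg_rootSum {i : H.root} (hi : ¬ b.IsPos i) :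
    ∃ m : b.support → ℕ, (rootSystem H).root i = -rootSum b m := by
  obtain ⟨m, h | h⟩ := exists_root_eq_rootSum_or_neg (b := b) i
  · exact absurd h.1 hi
  · exact ⟨m, h.2⟩

variable (b) in
/-- A subspace that contains the Cartan subalgebra and the root spaces is everything. -/
theorem eq_top_of_rootSpace_le (S : Submodule ℂ 𝔤) (hH : ∀ h : H, (h : 𝔤) ∈ S)
    (hpos : ∀ i : H.root, b.IsPos i → ∀ x ∈ rootSpace H (i : LieModule.Weight ℂ H 𝔤), x ∈ S)
    (hneg : ∀ i : H.root, b.IsPos i → ∀ x ∈ rootSpace H (-(i : LieModule.Weight ℂ H 𝔤)), x ∈ S) :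
    S = ⊤ := by
  have h := congrArg LieSubmodule.toSubmodule (cartan_sup_iSup_rootSpace_eq_top (H := H))
  simp only [LieSubmodule.sup_toSubmodule, LieSubmodule.iSup_toSubmodule,
    LieSubmodule.top_toSubmodule] at h
  rw [eq_top_iff, ← h]
  refine sup_le (fun x hx => hH ⟨x, hx⟩) (iSup₂_le fun α hα x hx => ?_)
  have hα' : α ∈ H.root := by simpa using hα
  let _ := (rootSystem H).indexNeg
  rcases RootPairing.Base.IsPos.or_neg b ⟨α, hα'⟩ with hi | hi
  · exact hpos _ hi x hx
  · refine hneg _ hi x ?_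
    have hneg : ((-(⟨α, hα'⟩ : H.root) : H.root) : LieModule.Weight ℂ H 𝔤) = -α := by
      have := (rootSystem H).root_reflectionPerm ⟨α, hα'⟩ ⟨α, hα'⟩
      rw [RootPairing.reflection_apply_self] at this
      exact LieModule.Weight.ext fun h => DFunLike.congr_fun this h
    rw [hneg]
    simpa using hx

variable {U : Type*} [AddCommGroup U] [Module ℂ U] {L : 𝔤 →ₗ⁅ℂ⁆ Module.End ℂ U}

theorem lie_eq_smul {α : H → ℂ} {x : 𝔤} (hx : x ∈ rootSpace H α) (h : H) :
    ⁅(h : 𝔤), x⁆ = α h • x :=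
  lie_eq_smul_of_mem_rootSpace hx h

/-- The vector `v` has weight `l`. -/
def HasWeight (L : 𝔤 →ₗ⁅ℂ⁆ Module.End ℂ U) (l : Module.Dual ℂ H) (v : U) : Prop :=
  ∀ h : H, L h v = l h • v

theorem HasWeight.apply_root {l : Module.Dual ℂ H} {v : U} (hv : HasWeight L l v)
    {α : Module.Dual ℂ H} {x : 𝔤} (hx : x ∈ rootSpace H α) : HasWeight L (l + α) (L x v) := by
  intro h
  have h1 := lieHom_lie_apply L h x v
  rw [lie_eq_smul hx, map_smul, LinearMap.smul_apply, hv h, map_smul] at h1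
  rw [sub_eq_iff_eq_add'.1 h1.symm, LinearMap.add_apply, add_smul]

theorem HasWeight.apply_pow {l : Module.Dual ℂ H} {v : U} (hv : HasWeight L l v)
    {α : Module.Dual ℂ H} {x : 𝔤} (hx : x ∈ rootSpace H α) (k : ℕ) :
    HasWeight L (l + (k : ℂ) • α) ((L x ^ k) v) := by
  induction k with
  | zero => simpa using hv
  | succ k ih =>
    rw [pow_succ', Module.End.mul_apply]
    convert ih.apply_root hx using 1
    push_cast
    module

variable (b L) in
/-- The vector `u` is a highest weight vector of weight `μ`. -/
structure IsHighestWeightVector (μ : Module.Dual ℂ H) (u : U) : Prop where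
  ne_zero : u ≠ 0
  hasWeight : HasWeight L μ u
  raise : ∀ i : H.root, b.IsPos i → ∀ e ∈ rootSpace H (i : LieModule.Weight ℂ H 𝔤), L e u = 0

variable (b L) in
/-- The vectors obtained from `u` by applying negative root vectors; `m` records how the weight
has been lowered. -/
inductive IsWord (u : U) : (b.support → ℕ) → U → Prop
  | nil : IsWord u 0 u
  | cons {m v} (i : H.root) (hi : b.IsPos i) (k : b.support → ℕ)
      (hk : (rootSystem H).root i = rootSum b k) (y : 𝔤)
      (hy : y ∈ rootSpace H (-(i : LieModule.Weight ℂ H 𝔤))) (hv : IsWord u m v) :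
      IsWord u (k + m) (L y v)

theorem rootSpace_neg_eq (i : H.root) :
    rootSpace H (-(i : LieModule.Weight ℂ H 𝔤)) =
      rootSpace H (-(rootSystem H).root i : Module.Dual ℂ H) := rfl

theorem rootSpace_eq (i : H.root) :
    rootSpace H (i : LieModule.Weight ℂ H 𝔤) =
      rootSpace H ((rootSystem H).root i : Module.Dual ℂ H) := rfl

theorem IsWord.hasWeight {μ : Module.Dual ℂ H} {u : U} (hu : HasWeight L μ u)
    {m : b.support → ℕ} {v : U} (hv : IsWord b L u m v) : HasWeight L (μ - rootSum b m) v := by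
  induction hv with
  | nil => simpa [rootSum_zero] using hu
  | cons i hi k hk y hy hv ih =>
    rw [rootSpace_neg_eq] at hy
    convert ih.apply_root hy using 1
    rw [rootSum_add, hk]
    abel

variable (b L) in
/-- The span of the words on `u`. -/
def wordSpan (u : U) : Submodule ℂ U := Submodule.span ℂ {v | ∃ m, IsWord b L u m v}

theorem mem_wordSpan {u : U} {m : b.support → ℕ} {v : U} (hv : IsWord b L u m v) :
    v ∈ wordSpan b L u := Submodule.subset_span ⟨m, hv⟩

theorem self_mem_wordSpan {u : U} : u ∈ wordSpan b L u := mem_wordSpan IsWord.nil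

theorem lower_mem_wordSpan {u : U} {i : H.root} (hi : b.IsPos i) {y : 𝔤}
    (hy : y ∈ rootSpace H (-(i : LieModule.Weight ℂ H 𝔤))) {v : U} (hv : v ∈ wordSpan b L u) :
    L y v ∈ wordSpan b L u := by
  obtain ⟨k, hk⟩ := exists_root_eq_rootSum hi
  induction hv using Submodule.span_induction with
  | mem v hv =>
    obtain ⟨m, hv⟩ := hv
    exact mem_wordSpan (IsWord.cons i hi k hk y hy hv)
  | zero => simp
  | add v w _ _ hv hw => rw [map_add]; exact add_mem hv hw
  | smul c v _ hv => rw [map_smul]; exact Submodule.smul_mem _ _ hv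

/-- The span of the words on a highest weight vector is a submodule. -/
theorem IsHighestWeightVector.apply_mem_wordSpan {μ : Module.Dual ℂ H} {u : U}
    (hu : IsHighestWeightVector b L μ u) (x : 𝔤) {v : U} (hv : v ∈ wordSpan b L u) :
    L x v ∈ wordSpan b L u := by
  have key : ∀ (m : b.support → ℕ) (v : U), IsWord b L u m v → ∀ x, L x v ∈ wordSpan b L u := by
    intro m v hv
    induction hv with
    | nil =>
      intro x
      let S : Submodule ℂ 𝔤 := (wordSpan b L u).comap
        ((LinearMap.applyₗ u).comp (L : 𝔤 →ₗ[ℂ] Module.End ℂ U))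
      have hS : S = ⊤ := by
        apply eq_top_of_rootSpace_le b S
        · intro h
          change L h u ∈ wordSpan b L u
          rw [hu.hasWeight h]
          exact Submodule.smul_mem _ _ self_mem_wordSpan
        · intro i hi e he
          change L e u ∈ wordSpan b L u
          rw [hu.raise i hi e he]
          exact zero_mem _
        · intro i hi e he
          exact lower_mem_wordSpan hi he self_mem_wordSpan
      exact (hS ▸ Submodule.mem_top : x ∈ S)
    | cons i hi k hk y hy hv ih =>
      rename_i m v
      intro x
      -- After moving x past y, both terms involve only the shorter word `v`. The induction
      -- hypothesis is needed for ⁅x, y⁆ as well as for x.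
      have : L x (L y v) = L ⁅x, y⁆ v + L y (L x v) := by
        rw [lieHom_lie_apply, sub_add_cancel]
      rw [this]
      exact add_mem (ih _) (lower_mem_wordSpan hi hy (ih x))
  induction hv using Submodule.span_induction with
  | mem v hv =>
    obtain ⟨m, hv⟩ := hv
    exact key m v hv x
  | zero => simp
  | add v w _ _ hv hw => rw [map_add]; exact add_mem hv hw
  | smul c v _ hv => rw [map_smul]; exact Submodule.smul_mem _ _ hv

/-- The representation `L` has no invariant subspaces but `0` and everything. -/
def IsIrreducibleLie (L : 𝔤 →ₗ⁅ℂ⁆ Module.End ℂ U) : Prop :=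
  ∀ W : Submodule ℂ U, (∀ x, ∀ w ∈ W, L x w ∈ W) → W = ⊥ ∨ W = ⊤

theorem IsHighestWeightVector.wordSpan_eq_top {μ : Module.Dual ℂ H} {u : U}
    (hu : IsHighestWeightVector b L μ u) (hL : IsIrreducibleLie L) : wordSpan b L u = ⊤ := by
  refine (hL _ fun x w hw => hu.apply_mem_wordSpan x hw).resolve_left fun h => hu.ne_zero ?_
  have := self_mem_wordSpan (b := b) (L := L) (u := u)
  rwa [h, Submodule.mem_bot] at this

/-- A vector in the span of the words that is an eigenvector of `T` with eigenvalue `c` is in the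
span of the words with the same property. -/
theorem mem_span_words_of_eigenvector {μ : Module.Dual ℂ H} {u : U} (hu : HasWeight L μ u)
    {T : H} {c : ℂ} {v : U} (hv : v ∈ wordSpan b L u) (hT : L T v = c • v) :
    v ∈ Submodule.span ℂ {w | ∃ m, IsWord b L u m w ∧ (μ - rootSum b m) T = c} := by
  set A := Submodule.span ℂ {w | ∃ m, IsWord b L u m w ∧ (μ - rootSum b m) T = c} with hA
  have hAe : A ≤ (L T).eigenspace c := by
    rw [hA, Submodule.span_le]
    rintro w ⟨m, hw, hc⟩
    rw [SetLike.mem_coe, Module.End.mem_eigenspace_iff, hw.hasWeight hu, hc]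
  -- Every word is an eigenvector of T, so it lies in `A` or in the eigenspace of another
  -- eigenvalue. Independence of eigenspaces leaves only the part in `A`.
  have hsup : wordSpan b L u ≤ A ⊔ ⨆ d, ⨆ _ : d ≠ c, (L T).eigenspace d := by
    rw [wordSpan, Submodule.span_le]
    rintro w ⟨m, hw⟩
    by_cases hc : (μ - rootSum b m) T = c
    · exact Submodule.mem_sup_left (Submodule.subset_span ⟨m, hw, hc⟩)
    · refine Submodule.mem_sup_right ?_
      refine (le_iSup₂_of_le ((μ - rootSum b m) T) hc le_rfl :
        (L T).eigenspace ((μ - rootSum b m) T) ≤ _) ?_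
      rw [Module.End.mem_eigenspace_iff, hw.hasWeight hu]
  obtain ⟨a, ha, w, hw, rfl⟩ := Submodule.mem_sup.1 (hsup hv)
  have hwc : w ∈ (L T).eigenspace c := by
    have h1 : a + w ∈ (L T).eigenspace c := Module.End.mem_eigenspace_iff.2 hT
    simpa using sub_mem h1 (hAe ha)
  have := (Module.End.eigenspaces_iSupIndep (L T) c).le_bot ⟨hwc, hw⟩
  rw [Submodule.mem_bot] at this
  rwa [this, add_zero]

/-- A weight of a module that is spanned by the words on `u`. -/
theorem exists_eq_sub_rootSum {μ l : Module.Dual ℂ H} {u : U} (hu : HasWeight L μ u)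
    (htop : wordSpan b L u = ⊤) {v : U} (hv : v ≠ 0) (hl : HasWeight L l v) :
    ∃ m, (∃ w, w ≠ 0 ∧ IsWord b L u m w) ∧ l = μ - rootSum b m := by
  by_contra! hcon
  -- Joint generalized eigenspaces are independent because H is abelian. If the weight `l` were not
  -- that of a nonzero word, the other ones would already span U.
  let F : (H → ℂ) → Submodule ℂ U := fun χ => ⨅ h : H, (L h).maxGenEigenspace (χ h)
  have hF : ∀ (l : Module.Dual ℂ H) (v : U), HasWeight L l v → v ∈ F l := by
    intro l v hv
    simp only [F, Submodule.mem_iInf]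
    intro h
    exact Module.End.mem_maxGenEigenspace _ _ _ |>.2 ⟨1, by simp [hv h]⟩
  have hind : iSupIndep F := by
    apply Module.End.independent_iInf_maxGenEigenspace_of_forall_mapsTo
    intro h h' φ
    apply Module.End.mapsTo_maxGenEigenspace_of_comm
    have h0 : ⁅(h' : 𝔤), (h : 𝔤)⁆ = 0 := by
      have := LieSubalgebra.coe_bracket H h' h
      rw [← this, trivial_lie_zero]
      rfl
    have h1 : ⁅L h', L h⁆ = 0 := by rw [← LieHom.map_lie, h0, map_zero]
    rw [Ring.lie_def, sub_eq_zero] at h1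
    exact h1
  have hle : (⊤ : Submodule ℂ U) ≤ ⨆ χ, ⨆ _ : χ ≠ (l : H → ℂ), F χ := by
    rw [← htop, wordSpan, Submodule.span_le]
    rintro w ⟨m, hw⟩
    by_cases hw0 : w = 0
    · rw [hw0]; exact zero_mem _
    · have hne : ((μ - rootSum b m : Module.Dual ℂ H) : H → ℂ) ≠ l := fun h =>
        hcon m ⟨w, hw0, hw⟩ (DFunLike.coe_injective h).symm
      exact Submodule.mem_iSup_of_mem _ (Submodule.mem_iSup_of_mem hne (hF _ _ (hw.hasWeight hu)))
  have := (hind l).le_bot ⟨hF l v hl, hle Submodule.mem_top⟩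
  exact hv this

end HighestWeight

/-! ### Weights, reflections and the lowest weight -/

section Weights

open LieAlgebra LieAlgebra.IsKilling

/-- A highest weight vector for an `sl₂`-triple. -/
theorem sl2_primitive {𝔤 U : Type*} [LieRing 𝔤] [LieAlgebra ℂ 𝔤] [AddCommGroup U] [Module ℂ U]
    [FiniteDimensional ℂ U] (L : 𝔤 →ₗ⁅ℂ⁆ Module.End ℂ U) {h e f : 𝔤} (t : IsSl2Triple h e f)
    {v : U} {k : ℂ} (hv : v ≠ 0) (hh : L h v = k • v) (he : L e v = 0) :
    ∃ n : ℕ, k = n ∧ (∀ i ≤ n, (L f ^ i) v ≠ 0) ∧ (L f ^ (n + 1)) v = 0 := by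
  let _ : LieRingModule 𝔤 U := LieRingModule.compLieHom U L
  have _ : LieModule ℂ 𝔤 U := LieModule.compLieHom U L
  have P : t.HasPrimitiveVectorWith v k := ⟨hv, hh, he⟩
  have hL : LieModule.toEnd ℂ 𝔤 U f = L f := rfl
  obtain ⟨n, hn⟩ := P.exists_nat
  refine ⟨n, hn, fun i hi => ?_, ?_⟩
  · have := P.pow_toEnd_f_ne_zero_of_eq_nat hn hi
    rwa [hL] at this
  · have := P.pow_toEnd_f_eq_zero_of_eq_nat hn
    rwa [hL] at this

/-- Each application of e raises the eigenvalue of h by 2, and there are finitely many eigenvalues.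
The last nonzero e^p v is taken. -/
theorem sl2_exists_pow {𝔤 U : Type*} [LieRing 𝔤] [LieAlgebra ℂ 𝔤] [AddCommGroup U] [Module ℂ U]
    [FiniteDimensional ℂ U] (L : 𝔤 →ₗ⁅ℂ⁆ Module.End ℂ U) {h e f : 𝔤} (t : IsSl2Triple h e f)
    {v : U} {k : ℂ} (hv : v ≠ 0) (hh : L h v = k • v) :
    ∃ p : ℕ, (L e ^ p) v ≠ 0 ∧ L e ((L e ^ p) v) = 0 ∧
      L h ((L e ^ p) v) = (k + 2 * p) • (L e ^ p) v := by
  let _ : LieRingModule 𝔤 U := LieRingModule.compLieHom U L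
  have _ : LieModule ℂ 𝔤 U := LieModule.compLieHom U L
  have hL : LieModule.toEnd ℂ 𝔤 U e = L e := rfl
  have hk : ∀ p : ℕ, L h ((L e ^ p) v) = (k + 2 * p) • (L e ^ p) v := by
    intro p
    have := t.lie_h_pow_toEnd_e (R := ℂ) hh p
    rwa [hL] at this
  have hex : ∃ p : ℕ, (L e ^ p) v = 0 := by
    by_contra! hcon
    have hfin := Module.End.finite_hasEigenvalue (L h)
    refine Set.infinite_of_injective_forall_mem (f := fun p : ℕ => k + 2 * (p : ℂ)) ?_ ?_ hfin
    · intro p q hpq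
      simpa using hpq
    · intro p
      exact Module.End.hasEigenvalue_of_hasEigenvector
        ⟨Module.End.mem_eigenspace_iff.2 (hk p), hcon p⟩
  obtain ⟨p, hp, hp'⟩ := Nat.exists_not_and_succ_of_not_zero_of_exists
    (p := fun p => (L e ^ p) v = 0) (by simpa using hv) hex
  refine ⟨p, hp, ?_, hk p⟩
  rw [← Module.End.mul_apply, ← pow_succ']
  exact hp'

variable {𝔤 : Type*} [LieRing 𝔤] [LieAlgebra ℂ 𝔤] [FiniteDimensional ℂ 𝔤] [IsKilling ℂ 𝔤]
  {H : LieSubalgebra ℂ 𝔤} [H.IsCartanSubalgebra] {b : (rootSystem H).Base}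

theorem exists_sl2Triple (i : H.root) : ∃ e f : 𝔤,
    IsSl2Triple ((rootSystem H).coroot i : 𝔤) e f ∧
      e ∈ rootSpace H ((rootSystem H).root i : Module.Dual ℂ H) ∧
      f ∈ rootSpace H (-(rootSystem H).root i : Module.Dual ℂ H) := by
  have hα : (i : LieModule.Weight ℂ H 𝔤).IsNonZero := LieSubalgebra.isNonZero_coe_root i
  obtain ⟨h, e, f, ht, he, hf⟩ := exists_isSl2Triple_of_weight_isNonZero hα
  have := ht.h_eq_coroot hα he hf
  subst this
  exact ⟨e, f, ht, he, hf⟩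

variable (b) in
theorem exists_root_apply_eq (c : b.support → ℂ) :
    ∃ T : H, ∀ i : b.support, (rootSystem H).root i T = c i := by
  let d : Module.Dual ℂ (Module.Dual ℂ H) := b.toWeightBasis.constr ℂ c
  refine ⟨(Module.evalEquiv ℂ H).symm d, fun i => ?_⟩
  rw [Module.apply_evalEquiv_symm_apply, ← b.toWeightBasis_apply, Module.Basis.constr_basis]

variable (b) in
theorem eq_of_forall_root_apply_eq {T T' : H}
    (h : ∀ i : b.support, (rootSystem H).root i T = (rootSystem H).root i T') : T = T' := by
  have : ∀ l : Module.Dual ℂ H, l T = l T' := by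
    intro l
    have := b.toWeightBasis.sum_repr l
    rw [← this]
    simp only [LinearMap.sum_apply, LinearMap.smul_apply, RootPairing.Base.toWeightBasis_apply, h]
  rw [← sub_eq_zero, ← Module.forall_dual_apply_eq_zero_iff ℂ]
  intro l
  rw [map_sub, this, sub_self]

variable {U : Type*} [AddCommGroup U] [Module ℂ U] {L : 𝔤 →ₗ⁅ℂ⁆ Module.End ℂ U}

section

variable [FiniteDimensional ℂ U]

/-- If e^p v is primitive of weight n = k + 2p, lowering it n - p times reaches the reflected
weight, and sl₂-theory keeps the result nonzero. -/
theorem exists_hasWeight_reflection {l : Module.Dual ℂ H} {v : U} (hv : v ≠ 0)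
    (hl : HasWeight L l v) (i : H.root) :
    ∃ w : U, w ≠ 0 ∧
      HasWeight L (l - l ((rootSystem H).coroot i) • (rootSystem H).root i) w := by
  obtain ⟨e, f, t, he, hf⟩ := exists_sl2Triple i
  set k := l ((rootSystem H).coroot i)
  obtain ⟨p, hp, hp0, hph⟩ := sl2_exists_pow L t hv (hl _)
  obtain ⟨n, hn, hnz, -⟩ := sl2_primitive L t hp hph hp0
  -- For k = n - 2p ≥ 0 the natural subtraction n - p is exact. For k < 0 the same argument runs
  -- with e and f exchanged.
  rcases le_or_gt ((2 : ℤ) * p) n with hle | hlt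
  · -- the eigenvalue `k = n - 2p` is nonnegative
    refine ⟨(L f ^ (n - p)) ((L e ^ p) v), hnz _ (Nat.sub_le _ _), ?_⟩
    convert (hl.apply_pow he p).apply_pow hf (n - p) using 1
    have h1 : ((n - p : ℕ) : ℂ) = k + p := by
      rw [Nat.cast_sub (by omega), ← hn]; ring
    rw [h1]
    module
  · have t' := t.symm
    have hl' : L (-((rootSystem H).coroot i : 𝔤)) v = (-k) • v := by
      rw [map_neg, LinearMap.neg_apply, hl, neg_smul]
    obtain ⟨q, hq, hq0, hqh⟩ := sl2_exists_pow L t' hv hl'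
    obtain ⟨n', hn', hnz', -⟩ := sl2_primitive L t' hq hqh hq0
    have hkk : (n : ℤ) - 2 * p = 2 * q - n' := by
      have : (n : ℂ) - 2 * p = 2 * q - n' := by rw [← hn, ← hn']; ring
      exact_mod_cast this
    refine ⟨(L e ^ (n' - q)) ((L f ^ q) v), hnz' _ (Nat.sub_le _ _), ?_⟩
    convert (hl.apply_pow hf q).apply_pow he (n' - q) using 1
    have h1 : ((n' - q : ℕ) : ℂ) = -k + q := by
      rw [Nat.cast_sub (by omega), ← hn']; ring
    rw [h1]
    module

theorem exists_hasWeight_weylGroup (w : (rootSystem H).weylGroup) {l : Module.Dual ℂ H} {v : U}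
    (hv : v ≠ 0) (hl : HasWeight L l v) : ∃ v' : U, v' ≠ 0 ∧ HasWeight L (w • l) v' := by
  obtain ⟨w, hw⟩ := w
  induction hw using RootPairing.weylGroup.induction generalizing l v with
  | mem i =>
    obtain ⟨v', hv', h⟩ := exists_hasWeight_reflection hv hl i
    exact ⟨v', hv', h⟩
  | one =>
    refine ⟨v, hv, ?_⟩
    convert hl
    exact one_smul _ l
  | mul x y hx hy ihx ihy =>
    obtain ⟨v1, hv1, h1⟩ := ihy hv hl
    obtain ⟨v2, hv2, h2⟩ := ihx hv1 h1
    refine ⟨v2, hv2, ?_⟩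
    convert h2 using 1
    exact mul_smul (⟨x, hx⟩ : (rootSystem H).weylGroup) ⟨y, hy⟩ l

theorem smul_rootSum_of_longest {w : (rootSystem H).weylGroup}
    (hw : ∀ i, b.IsPos i → ¬ b.IsPos (w • i)) (m : b.support → ℕ) :
    ∃ m' : b.support → ℕ, w • rootSum b m = -rootSum b m' := by
  have h1 : ∀ i : b.support, ∃ m' : b.support → ℕ,
      w • (rootSystem H).root i = -rootSum b m' := by
    intro i
    obtain ⟨m', hm'⟩ := exists_root_eq_neg_rootSum
      (hw i (RootPairing.Base.isPos_of_mem_support i.2))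
    exact ⟨m', by rw [← hm', RootPairing.weylGroup_apply_root]; rfl⟩
  choose m' hm' using h1
  refine ⟨∑ i, m i • m' i, ?_⟩
  rw [rootSum_sum, rootSum, Finset.smul_sum, ← Finset.sum_neg_distrib]
  refine Finset.sum_congr rfl fun i _ => ?_
  rw [rootSum_smul, smul_comm, hm', smul_neg]

/-- The translate of the highest weight by the longest element of the Weyl group is the lowest
weight. -/
theorem exists_eq_add_rootSum_of_longest {μ l : Module.Dual ℂ H} {u v : U}
    (hu : HasWeight L μ u) (htop : wordSpan b L u = ⊤) {w : (rootSystem H).weylGroup}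
    (hw : ∀ i, b.IsPos i → ¬ b.IsPos (w • i)) (hv : v ≠ 0) (hl : HasWeight L l v) :
    ∃ m, l = w • μ + rootSum b m := by
  -- The weight w⁻¹ l lies below μ, and applying w turns the subtracted simple roots into added
  -- ones.
  obtain ⟨v', hv', hl'⟩ := exists_hasWeight_weylGroup w⁻¹ hv hl
  obtain ⟨m, -, hm⟩ := exists_eq_sub_rootSum hu htop hv' hl'
  obtain ⟨m', hm'⟩ := smul_rootSum_of_longest hw m
  refine ⟨m', ?_⟩
  rw [inv_smul_eq_iff] at hm
  rw [hm, smul_sub, hm', sub_neg_eq_add]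

end

/-! ### Eigenspaces of elements of the Cartan subalgebra -/

theorem exists_word_of_eigenvector {μ : Module.Dual ℂ H} {u : U} (hu : HasWeight L μ u)
    (htop : wordSpan b L u = ⊤) {T : H} {c : ℂ} {v : U} (hv : v ≠ 0) (hT : L T v = c • v) :
    ∃ m w, w ≠ 0 ∧ IsWord b L u m w ∧ (μ - rootSum b m) T = c := by
  have h := mem_span_words_of_eigenvector (b := b) hu (htop ▸ Submodule.mem_top) hT
  by_contra! hcon
  refine hv ?_
  rw [← Submodule.mem_bot ℂ]
  refine (Submodule.span_le.2 ?_ : _ ≤ (⊥ : Submodule ℂ U)) h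
  rintro w ⟨m, hw, hc⟩
  by_contra hw0
  exact hcon m w hw0 hw hc

/-- A word that has not been lowered is the vector itself. -/
theorem IsWord.eq_of_rootSum_eq_zero {u : U} {m : b.support → ℕ} {v : U} (hv : IsWord b L u m v)
    (hm : m = 0) : v = u := by
  cases hv with
  | nil => rfl
  | cons i hi k hk y hy hv =>
    rename_i m v
    have hk0 : k = 0 := by
      funext j
      have := congrFun hm j
      simp only [Pi.add_apply, Pi.zero_apply, Nat.add_eq_zero_iff] at this
      exact this.1
    rw [hk0, rootSum_zero] at hk
    exact absurd hk ((rootSystem H).ne_zero i)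

/-- The Killing form identifies each coroot with a nonzero multiple of its root, so the coroot of ∑
k_j σ_j is a combination of the simple coroots with k_j ≠ 0. -/
theorem apply_coroot_eq_zero_of_rootSum {μ : Module.Dual ℂ H} {i : H.root} {k : b.support → ℕ}
    (hk : (rootSystem H).root i = rootSum b k)
    (h : ∀ j : b.support, k j ≠ 0 → μ ((rootSystem H).coroot j) = 0) :
    μ ((rootSystem H).coroot i) = 0 := by
  have hc : ∀ j : H.root, ∃ c : ℂ, c ≠ 0 ∧ (rootSystem H).coroot j =
      c • (cartanEquivDual H).symm ((rootSystem H).root j) := by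
    intro j
    refine ⟨2 * ((j : LieModule.Weight ℂ H 𝔤)
      ((cartanEquivDual H).symm (j : LieModule.Weight ℂ H 𝔤).toLinear))⁻¹, ?_, ?_⟩
    · exact mul_ne_zero two_ne_zero (inv_ne_zero
        (root_apply_cartanEquivDual_symm_ne_zero (LieSubalgebra.isNonZero_coe_root j)))
    · rw [rootSystem_coroot_apply, coroot, mul_smul, ← Nat.cast_smul_eq_nsmul ℂ, Nat.cast_ofNat]
      rfl
  obtain ⟨c, -, hci⟩ := hc i
  rw [hci, hk, rootSum, map_sum, map_smul, map_sum]
  have : ∀ j : b.support, μ ((cartanEquivDual H).symm ((k j : ℂ) • (rootSystem H).root j)) = 0 := by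
    intro j
    by_cases hj : k j = 0
    · simp [hj]
    · obtain ⟨d, hd, hdj⟩ := hc j
      have := h j hj
      rw [hdj, map_smul, smul_eq_mul] at this
      rw [map_smul, map_smul, (mul_eq_zero.1 this).resolve_left hd, smul_zero]
  rw [Finset.sum_eq_zero fun j _ => this j, smul_zero]

theorem sum_eq_zero_iff_of_nonneg_real {m : b.support → ℕ} {n : b.support → ℝ}
    (hn : ∀ i, 0 ≤ n i) : ∑ i, (m i : ℝ) * n i = 0 ↔ ∀ i, m i ≠ 0 → n i = 0 := by
  rw [Finset.sum_eq_zero_iff_of_nonneg fun i _ => mul_nonneg (Nat.cast_nonneg _) (hn i)]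
  simp only [Finset.mem_univ, forall_const, mul_eq_zero, Nat.cast_eq_zero]
  exact forall_congr' fun i => or_iff_not_imp_left

/-- The words on which `T` has its largest eigenvalue. -/
theorem IsWord.mem_span_of_apply_eq_zero [FiniteDimensional ℂ U] {μ : Module.Dual ℂ H} {u : U}
    (hu : IsHighestWeightVector b L μ u) {n : b.support → ℝ}
    (hμ : ∀ i : b.support, n i = 0 → μ ((rootSystem H).coroot i) = 0)
    {m : b.support → ℕ} {v : U} (hv : IsWord b L u m v) (hm : ∀ i, m i ≠ 0 → n i = 0) :
    v ∈ Submodule.span ℂ {u} := by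
  induction hv with
  | nil => exact Submodule.mem_span_singleton_self u
  | cons i hi k hk y hy hv ih =>
    rename_i m v
    have hv' := ih fun j hj => hm j (by simp only [Pi.add_apply]; omega)
    obtain ⟨c, rfl⟩ := Submodule.mem_span_singleton.1 hv'
    have h0 : μ ((rootSystem H).coroot i) = 0 :=
      apply_coroot_eq_zero_of_rootSum hk fun j hj => hμ j (hm j (by
        simp only [Pi.add_apply]; omega))
    obtain ⟨e, f, t, he, hf⟩ := exists_sl2Triple i
    -- A primitive vector of sl₂-weight 0 is killed by f.
    have hfu : L f u = 0 := by
      obtain ⟨p, hp, -, hp0⟩ := sl2_primitive L t hu.ne_zero (hu.hasWeight _) (hu.raise i hi e he)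
      rw [h0] at hp
      have : p = 0 := by exact_mod_cast hp.symm
      subst this
      simpa using hp0
    -- the root space is a line
    have hfin : Module.finrank ℂ (rootSpace H (-(i : LieModule.Weight ℂ H 𝔤))) = 1 :=
      finrank_rootSpace_eq_one (-(i : LieModule.Weight ℂ H 𝔤))
        (LieSubalgebra.isNonZero_coe_root i).neg
    obtain ⟨d, hd⟩ := (finrank_eq_one_iff_of_nonzero' (⟨f, hf⟩ :
      rootSpace H (-(i : LieModule.Weight ℂ H 𝔤))) (by
        intro h; exact t.f_ne_zero (congrArg Subtype.val h))).1 hfin ⟨y, hy⟩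
    have hy' : y = d • f := (congrArg Subtype.val hd).symm
    rw [hy', map_smul, map_smul, LinearMap.smul_apply, hfu, smul_zero, smul_zero]
    exact zero_mem _

/-- If n_i = 0, then f_i u stays in the eigenspace, hence is a multiple of u, and e_i f_i u =
μ(σ_i^∨) u must vanish. Conversely, words in the eigenspace use only simple roots with n_i = 0, and
such words do not leave the line of u. -/
theorem finrank_eigenspace_eq_one_iff [FiniteDimensional ℂ U] {μ : Module.Dual ℂ H} {u : U}
    (hu : IsHighestWeightVector b L μ u) (htop : wordSpan b L u = ⊤) {T : H}
    {n : b.support → ℝ} (hn : ∀ i, 0 ≤ n i)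
    (hT : ∀ i : b.support, (rootSystem H).root i T = n i) :
    Module.finrank ℂ ((L T).eigenspace (μ T)) = 1 ↔
      ∀ i : b.support, n i = 0 → μ ((rootSystem H).coroot i) = 0 := by
  have humem : u ∈ (L T).eigenspace (μ T) := Module.End.mem_eigenspace_iff.2 (hu.hasWeight T)
  constructor
  · intro h1 i hi
    obtain ⟨e, f, t, he, hf⟩ := exists_sl2Triple (i : H.root)
    have hfu : HasWeight L (μ + -(rootSystem H).root i) (L f u) := hu.hasWeight.apply_root hf
    have hfmem : L f u ∈ (L T).eigenspace (μ T) := by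
      rw [Module.End.mem_eigenspace_iff, hfu T, LinearMap.add_apply, LinearMap.neg_apply, hT, hi,
        Complex.ofReal_zero, neg_zero, add_zero]
    obtain ⟨d, hd⟩ := (finrank_eq_one_iff_of_nonzero' (⟨u, humem⟩ : (L T).eigenspace (μ T)) (by
      intro h; exact hu.ne_zero (congrArg Subtype.val h))).1 h1 ⟨_, hfmem⟩
    have hd' : d • u = L f u := congrArg Subtype.val hd
    have heu := hu.raise i (RootPairing.Base.isPos_of_mem_support i.2) e he
    have h2 : L e (L f u) = μ ((rootSystem H).coroot i) • u := by
      have := lieHom_lie_apply L e f u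
      rw [t.lie_e_f, hu.hasWeight, heu, map_zero, sub_zero] at this
      exact this.symm
    rw [← hd', map_smul, heu, smul_zero] at h2
    exact (smul_eq_zero.1 h2.symm).resolve_right hu.ne_zero
  · intro hμ
    have : (L T).eigenspace (μ T) = Submodule.span ℂ {u} := by
      apply le_antisymm
      · intro v hv
        have h := mem_span_words_of_eigenvector (b := b) hu.hasWeight (htop ▸ Submodule.mem_top)
          (Module.End.mem_eigenspace_iff.1 hv)
        refine (Submodule.span_le.2 ?_ : _ ≤ Submodule.span ℂ {u}) h
        rintro w ⟨m, hw, hc⟩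
        refine hw.mem_span_of_apply_eq_zero hu hμ ((sum_eq_zero_iff_of_nonneg_real hn).1 ?_)
        rw [LinearMap.sub_apply, sub_eq_self, rootSum_apply_real b m hT] at hc
        exact_mod_cast hc
      · rw [Submodule.span_singleton_le_iff_mem]
        exact humem
    rw [this]
    exact finrank_span_singleton hu.ne_zero

end Weights

/-! ### Duals, isomorphisms and invariant forms -/

section Duals

open LieAlgebra LieAlgebra.IsKilling

/-- The dual of a representation of a Lie algebra. -/
def dualLie {𝔤 U : Type*} [LieRing 𝔤] [LieAlgebra ℂ 𝔤] [AddCommGroup U] [Module ℂ U]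
    (L : 𝔤 →ₗ⁅ℂ⁆ Module.End ℂ U) : 𝔤 →ₗ⁅ℂ⁆ Module.End ℂ (Module.Dual ℂ U) where
  toLinearMap := -((Module.Dual.transpose (R := ℂ) (M := U) (M' := U)).comp
    (L : 𝔤 →ₗ[ℂ] Module.End ℂ U))
  map_lie' := by
    intro x y
    ext ξ v
    rw [Ring.lie_def]
    simp [Module.Dual.transpose_apply]

@[simp]
theorem dualLie_apply {𝔤 U : Type*} [LieRing 𝔤] [LieAlgebra ℂ 𝔤] [AddCommGroup U] [Module ℂ U]
    (L : 𝔤 →ₗ⁅ℂ⁆ Module.End ℂ U) (x : 𝔤) (ξ : Module.Dual ℂ U) (v : U) :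
    dualLie L x ξ v = -ξ (L x v) := rfl

/-- The direct sum of two representations of a Lie algebra. -/
def prodLie {𝔤 U U' : Type*} [LieRing 𝔤] [LieAlgebra ℂ 𝔤] [AddCommGroup U] [Module ℂ U]
    [AddCommGroup U'] [Module ℂ U'] (L : 𝔤 →ₗ⁅ℂ⁆ Module.End ℂ U)
    (L' : 𝔤 →ₗ⁅ℂ⁆ Module.End ℂ U') : 𝔤 →ₗ⁅ℂ⁆ Module.End ℂ (U × U') where
  toFun x := (L x).prodMap (L' x)
  map_add' x y := by ext <;> simp
  map_smul' c x := by ext <;> simp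
  map_lie' := by
    intro x y
    ext v <;> simp [Ring.lie_def]

@[simp]
theorem prodLie_apply {𝔤 U U' : Type*} [LieRing 𝔤] [LieAlgebra ℂ 𝔤] [AddCommGroup U] [Module ℂ U]
    [AddCommGroup U'] [Module ℂ U'] (L : 𝔤 →ₗ⁅ℂ⁆ Module.End ℂ U)
    (L' : 𝔤 →ₗ⁅ℂ⁆ Module.End ℂ U') (x : 𝔤) (v : U × U') :
    prodLie L L' x v = (L x v.1, L' x v.2) := rfl

variable {𝔤 : Type*} [LieRing 𝔤] [LieAlgebra ℂ 𝔤] [FiniteDimensional ℂ 𝔤] [IsKilling ℂ 𝔤]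
  {H : LieSubalgebra ℂ 𝔤} [H.IsCartanSubalgebra] {b : (rootSystem H).Base}
  {U : Type*} [AddCommGroup U] [Module ℂ U] {L : 𝔤 →ₗ⁅ℂ⁆ Module.End ℂ U}

theorem exists_word_apply_ne_zero {u : U} (htop : wordSpan b L u = ⊤) {ξ : Module.Dual ℂ U}
    (hξ : ξ ≠ 0) : ∃ m v, IsWord b L u m v ∧ ξ v ≠ 0 := by
  by_contra! hcon
  refine hξ (LinearMap.ker_eq_top.1 (top_le_iff.1 ?_))
  rw [← htop, wordSpan, Submodule.span_le]
  rintro v ⟨m, hv⟩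
  exact hcon m v hv

theorem IsWord.apply_eq_neg {μ : Module.Dual ℂ H} {u : U} (hu : HasWeight L μ u)
    {m : b.support → ℕ} {v : U} (hv : IsWord b L u m v) {ξ : Module.Dual ℂ U} (hξ : ξ v ≠ 0)
    {h : H} {c : ℂ} (hc : dualLie L h ξ = c • ξ) : (μ - rootSum b m) h = -c := by
  have h1 := LinearMap.congr_fun hc v
  rw [dualLie_apply, hv.hasWeight hu, map_smul, LinearMap.smul_apply, smul_eq_mul, smul_eq_mul,
    ← neg_mul] at h1
  rw [← mul_right_cancel₀ hξ h1, neg_neg]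

theorem rootSum_apply_rho {P : H} (hP : ∀ i : b.support, (rootSystem H).root i P = 1)
    (m : b.support → ℕ) : rootSum b m P = ((∑ i, m i : ℕ) : ℂ) := by
  rw [rootSum_apply]
  push_cast
  exact Finset.sum_congr rfl fun i _ => by rw [hP, mul_one]

/-- P measures height, so its eigenvalue alone separates `u` from all properly lowered words. -/
theorem rootSum_apply_rho_eq_zero {P : H} (hP : ∀ i : b.support, (rootSystem H).root i P = 1)
    {m : b.support → ℕ} : rootSum b m P = 0 ↔ m = 0 := by
  rw [rootSum_apply_rho hP, Nat.cast_eq_zero, Finset.sum_eq_zero_iff]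
  exact ⟨fun h => funext fun i => h i (Finset.mem_univ i), fun h i _ => congrFun h i⟩

theorem IsWord.eq_of_apply_rho {μ : Module.Dual ℂ H} {u : U} {P : H}
    (hP : ∀ i : b.support, (rootSystem H).root i P = 1) {m : b.support → ℕ} {v : U}
    (hv : IsWord b L u m v) (h : (μ - rootSum b m) P = μ P) : v = u := by
  rw [LinearMap.sub_apply, sub_eq_self, rootSum_apply_rho_eq_zero hP] at h
  exact hv.eq_of_rootSum_eq_zero h

theorem exists_rho (b : (rootSystem H).Base) :
    ∃ P : H, ∀ i : b.support, (rootSystem H).root i P = 1 :=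
  exists_root_apply_eq b fun _ => 1

/-- The dual of an irreducible representation has a highest weight vector. -/
theorem exists_isHighestWeightVector_dual [FiniteDimensional ℂ U] {μ : Module.Dual ℂ H} {u : U}
    (hu : IsHighestWeightVector b L μ u) (htop : wordSpan b L u = ⊤)
    {w : (rootSystem H).weylGroup} (hw : ∀ i, b.IsPos i → ¬ b.IsPos (w • i)) :
    ∃ ξ, IsHighestWeightVector b (dualLie L) (-(w • μ)) ξ := by
  obtain ⟨P, hP⟩ := exists_rho b
  obtain ⟨v, hv, hvw⟩ := exists_hasWeight_weylGroup w hu.ne_zero hu.hasWeight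
  set ν := w • μ
  have hlow : ∀ (l : Module.Dual ℂ H) (x : U), x ≠ 0 → HasWeight L l x → ∃ m, l = ν + rootSum b m :=
    fun l x hx hl => exists_eq_add_rootSum_of_longest hu.hasWeight htop hw hx hl
  -- A form vanishing on `Z` but not at the lowest weight vector `v` is the required dual highest
  -- weight vector: every weight other than ν has larger height and is killed.
  let Z : Submodule ℂ U := ⨆ d, ⨆ _ : d ≠ ν P, (L P).eigenspace d
  have hvZ : v ∉ Z := fun h => hv ((Submodule.mem_bot ℂ).1
    ((Module.End.eigenspaces_iSupIndep (L P) (ν P)).le_bot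
      ⟨Module.End.mem_eigenspace_iff.2 (hvw P), h⟩))
  have hZ : ∀ (l : Module.Dual ℂ H) (x : U), HasWeight L l x → l P ≠ ν P → x ∈ Z :=
    fun l x hl hne => Submodule.mem_iSup_of_mem _ (Submodule.mem_iSup_of_mem hne
      (Module.End.mem_eigenspace_iff.2 (hl P)))
  obtain ⟨ξ, hξv, hξZ⟩ : ∃ ξ : Module.Dual ℂ U, ξ v ≠ 0 ∧ ∀ z ∈ Z, ξ z = 0 := by
    by_contra! hcon
    refine hvZ ?_
    rw [← Subspace.dualAnnihilator_dualCoannihilator_eq (W := Z), Submodule.mem_dualCoannihilator]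
    intro ξ hξ
    rw [Submodule.mem_dualAnnihilator] at hξ
    by_contra h
    obtain ⟨z, hz, hz'⟩ := hcon ξ h
    exact hz' (hξ z hz)
  have hext : ∀ ξ ξ' : Module.Dual ℂ U, (∀ m x, x ≠ 0 → IsWord b L u m x → ξ x = ξ' x) →
      ξ = ξ' := by
    intro ξ ξ' h
    by_contra hne
    obtain ⟨m, x, hx, hx'⟩ := exists_word_apply_ne_zero htop (sub_ne_zero.2 hne)
    by_cases hx0 : x = 0
    · simp [hx0] at hx'
    · exact hx' (by rw [LinearMap.sub_apply, h m x hx0 hx, sub_self])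
  refine ⟨ξ, fun h => hξv (by rw [h]; rfl), ?_, ?_⟩
  · intro h
    refine hext _ _ fun m x hx0 hx => ?_
    obtain ⟨m', hm'⟩ := hlow _ x hx0 (hx.hasWeight hu.hasWeight)
    rw [dualLie_apply, hx.hasWeight hu.hasWeight h, map_smul, LinearMap.smul_apply, hm']
    by_cases h0 : m' = 0
    · simp [h0, rootSum_zero]
    · have : ξ x = 0 := by
        refine hξZ _ (hZ _ x (hx.hasWeight hu.hasWeight) ?_)
        rw [hm', LinearMap.add_apply, ne_eq, add_eq_left, rootSum_apply_rho_eq_zero hP]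
        exact h0
      simp [this]
  · intro i hi e he
    rw [rootSpace_eq] at he
    refine hext _ _ fun m x hx0 hx => ?_
    obtain ⟨m', hm'⟩ := hlow _ x hx0 (hx.hasWeight hu.hasWeight)
    obtain ⟨k, hk⟩ := exists_root_eq_rootSum hi
    have h1 := (hx.hasWeight hu.hasWeight).apply_root he
    -- A positive root vector lands strictly above the lowest weight, where ξ vanishes.
    have : ξ (L e x) = 0 := by
      refine hξZ _ (hZ _ _ h1 ?_)
      rw [hm', hk, add_assoc, ← rootSum_add, LinearMap.add_apply, ne_eq, add_eq_left,
        rootSum_apply_rho_eq_zero hP]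
      intro h0
      have hk0 : k = 0 := by
        funext j
        have := congrFun h0 j
        simp only [Pi.add_apply, Pi.zero_apply, Nat.add_eq_zero_iff] at this
        exact this.2
      rw [hk0, rootSum_zero] at hk
      exact (rootSystem H).ne_zero i hk
    rw [dualLie_apply, this, neg_zero, LinearMap.zero_apply]

/-- If a representation with a highest weight embeds into its dual, then the highest weight is the
negative of the lowest weight. -/
theorem eq_neg_smul_of_injective_dual [FiniteDimensional ℂ U] {μ : Module.Dual ℂ H} {u : U}
    (hu : IsHighestWeightVector b L μ u) (htop : wordSpan b L u = ⊤)
    {w : (rootSystem H).weylGroup} (hw : ∀ i, b.IsPos i → ¬ b.IsPos (w • i))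
    (F : U →ₗ[ℂ] Module.Dual ℂ U) (hF : ∀ x v, F (L x v) = dualLie L x (F v))
    (hinj : Function.Injective F) : μ = -(w • μ) := by
  obtain ⟨v, hv, hvw⟩ := exists_hasWeight_weylGroup w hu.ne_zero hu.hasWeight
  have hFw : ∀ (l : Module.Dual ℂ H) (v : U), v ≠ 0 → HasWeight L l v →
      ∃ m x, x ≠ 0 ∧ IsWord b L u m x ∧ μ - rootSum b m = -l := by
    intro l v hv hl
    have hne : F v ≠ 0 := fun h => hv (hinj (by rw [h, map_zero]))
    obtain ⟨m, x, hx, hx'⟩ := exists_word_apply_ne_zero htop hne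
    refine ⟨m, x, fun h => hx' (by rw [h, map_zero]), hx, LinearMap.ext fun h => ?_⟩
    exact hx.apply_eq_neg hu.hasWeight hx' (by rw [← hF, hl h, map_smul])
  obtain ⟨m, -, -, -, hm⟩ := hFw _ v hv hvw
  obtain ⟨m', x, hx0, hx, hm'⟩ := hFw _ u hu.ne_zero hu.hasWeight
  obtain ⟨k, hk⟩ := exists_eq_add_rootSum_of_longest hu.hasWeight htop hw hx0
    (hx.hasWeight hu.hasWeight)
  rw [hm'] at hk
  -- The image of the lowest weight vector gives -wμ = μ - `rootSum b m`, and that of `u` gives -μ =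
  -- wμ + `rootSum b k`. Adding these forces both sums to vanish.
  have h0 : rootSum b (m + k) = rootSum b 0 := by
    rw [rootSum_add, rootSum_zero]
    have h1 : rootSum b m = μ + w • μ := by rw [← sub_sub_cancel μ (rootSum b m), hm, sub_neg_eq_add]
    have h2 : rootSum b k = -μ - w • μ := by rw [hk]; abel
    rw [h1, h2]; abel
  have hmk := rootSum_injective b h0
  have hm0 : m = 0 := by
    funext j
    have := congrFun hmk j
    simp only [Pi.add_apply, Pi.zero_apply, Nat.add_eq_zero_iff] at this
    exact this.1
  rw [← hm, hm0, rootSum_zero, sub_zero]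

/-- An irreducible representation is determined by its highest weight. -/
theorem exists_equiv_of_highestWeight {U' : Type*} [AddCommGroup U'] [Module ℂ U']
    [FiniteDimensional ℂ U] [FiniteDimensional ℂ U'] {L' : 𝔤 →ₗ⁅ℂ⁆ Module.End ℂ U'}
    (hL : IsIrreducibleLie L) {μ : Module.Dual ℂ H} {u : U} {u' : U'}
    (hu : IsHighestWeightVector b L μ u) (hu' : IsHighestWeightVector b L' μ u')
    (hdim : Module.finrank ℂ U' = Module.finrank ℂ U) :
    ∃ F : U ≃ₗ[ℂ] U', ∀ x v, F (L x v) = L' x (F v) := by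
  obtain ⟨P, hP⟩ := exists_rho b
  have huu : IsHighestWeightVector b (prodLie L L') μ (u, u') :=
    ⟨fun h => hu.ne_zero (congrArg Prod.fst h),
      fun h => by rw [prodLie_apply, hu.hasWeight, hu'.hasWeight]; rfl,
      fun i hi e he => by rw [prodLie_apply, hu.raise i hi e he, hu'.raise i hi e he]; rfl⟩
  -- M will be the graph of the isomorphism: it projects onto U by irreducibility, injects into U'
  -- by `hker`, and `hdim` makes both projections bijective.
  let M : Submodule ℂ (U × U') := wordSpan b (prodLie L L') (u, u')
  have hM : ∀ x, ∀ v ∈ M, (L x v.1, L' x v.2) ∈ M := fun x v hv => huu.apply_mem_wordSpan x hv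
  have huM : (u, u') ∈ M := self_mem_wordSpan
  have hker : ∀ v : U, (v, (0 : U')) ∈ M → v = 0 := by
    have hbot : M.comap (LinearMap.inl ℂ U U') = ⊥ := by
      refine (hL _ fun x v hv => ?_).resolve_right fun htop => ?_
      · have := hM x _ (Submodule.mem_comap.1 hv)
        simpa using this
      · have h1 : (u, (0 : U')) ∈ M := by
          have : u ∈ M.comap (LinearMap.inl ℂ U U') := htop ▸ Submodule.mem_top
          simpa using this
        -- Within M the P-eigenvalue μ(P) occurs only on the line of (u, u'), which does not contain
        -- (u, 0).
        have h2 := mem_span_words_of_eigenvector (T := P) (c := μ P) huu.hasWeight h1 (by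
          rw [prodLie_apply, hu.hasWeight, map_zero, Prod.smul_mk, smul_zero])
        have h3 : (u, (0 : U')) ∈ Submodule.span ℂ {(u, u')} := by
          refine Submodule.span_mono ?_ h2
          rintro x ⟨m, hx, hxP⟩
          exact hx.eq_of_apply_rho hP hxP
        obtain ⟨c, hc⟩ := Submodule.mem_span_singleton.1 h3
        have hc2 : c • u' = 0 := congrArg Prod.snd hc
        have hc1 : c • u = u := congrArg Prod.fst hc
        rw [(smul_eq_zero.1 hc2).resolve_right hu'.ne_zero, zero_smul] at hc1
        exact hu.ne_zero hc1.symm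
    intro v hv
    have : v ∈ M.comap (LinearMap.inl ℂ U U') := by simpa using hv
    rwa [hbot, Submodule.mem_bot] at this
  let p1 : M →ₗ[ℂ] U := (LinearMap.fst ℂ U U').domRestrict M
  let p2 : M →ₗ[ℂ] U' := (LinearMap.snd ℂ U U').domRestrict M
  have hp2 : Function.Injective p2 := by
    rw [← LinearMap.ker_eq_bot, LinearMap.ker_eq_bot']
    rintro ⟨⟨x, y⟩, hxy⟩ h
    obtain rfl : y = 0 := h
    have := hker x hxy
    subst this
    rfl
  have hp1 : Function.Surjective p1 := by
    rw [← LinearMap.range_eq_top]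
    refine (hL _ ?_).resolve_left fun h => hu.ne_zero ?_
    · rintro x _ ⟨⟨v, hv⟩, rfl⟩
      exact ⟨⟨_, hM x v hv⟩, rfl⟩
    · have : u ∈ LinearMap.range p1 := ⟨⟨_, huM⟩, rfl⟩
      rwa [h, Submodule.mem_bot] at this
  have hd1 := LinearMap.finrank_le_finrank_of_injective hp2
  have hd2 : Module.finrank ℂ U ≤ Module.finrank ℂ M := by
    rw [← finrank_top ℂ U, ← LinearMap.range_eq_top.2 hp1]
    exact LinearMap.finrank_range_le p1
  have hb1 : Function.Bijective p1 :=
    ⟨(LinearMap.injective_iff_surjective_of_finrank_eq_finrank (by omega)).2 hp1, hp1⟩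
  have hb2 : Function.Bijective p2 :=
    ⟨hp2, (LinearMap.injective_iff_surjective_of_finrank_eq_finrank (by omega)).1 hp2⟩
  refine ⟨(LinearEquiv.ofBijective p1 hb1).symm.trans (LinearEquiv.ofBijective p2 hb2), ?_⟩
  intro x v
  obtain ⟨⟨v, hv⟩, rfl⟩ := hp1 v
  have h1 : (LinearEquiv.ofBijective p1 hb1).symm (p1 ⟨v, hv⟩) = ⟨v, hv⟩ :=
    (LinearEquiv.ofBijective p1 hb1).symm_apply_apply _
  have h2 : (LinearEquiv.ofBijective p1 hb1).symm (L x (p1 ⟨v, hv⟩)) = ⟨_, hM x v hv⟩ :=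
    (LinearEquiv.ofBijective p1 hb1).symm_apply_apply ⟨_, hM x v hv⟩
  rw [LinearEquiv.trans_apply, LinearEquiv.trans_apply, h1, h2]
  rfl

/-- The difference of two distinct simple roots is neither zero nor a root. -/
theorem lie_simple_eq_zero {i j : b.support} (hij : i ≠ j) {e f : 𝔤}
    (he : e ∈ rootSpace H ((rootSystem H).root i : Module.Dual ℂ H))
    (hf : f ∈ rootSpace H (-(rootSystem H).root j : Module.Dual ℂ H)) : ⁅e, f⁆ = 0 := by
  have hmem := lie_mem_genWeightSpace_of_mem_genWeightSpace he hf
  by_contra hne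
  set χ : H → ℂ := ((rootSystem H).root i : Module.Dual ℂ H) +
    (-(rootSystem H).root j : Module.Dual ℂ H) with hχ
  have hbot : LieModule.genWeightSpace 𝔤 χ ≠ ⊥ := fun h => hne (by
    rwa [h, LieSubmodule.mem_bot] at hmem)
  let α : LieModule.Weight ℂ H 𝔤 := ⟨χ, hbot⟩
  have hα : α.toLinear = (rootSystem H).root i - (rootSystem H).root j := by
    ext h
    change χ h = _
    simp only [hχ, sub_eq_add_neg]
    rfl
  by_cases h0 : α.IsZero
  · have : (rootSystem H).root i = (rootSystem H).root j := by
      rw [← sub_eq_zero, ← hα]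
      ext h
      exact congrFun h0 h
    exact hij (Subtype.ext ((rootSystem H).root.injective this))
  · have hmem' : α ∈ H.root := by simpa using h0
    exact b.sub_notMem_range_root i.2 j.2 ⟨⟨α, hmem'⟩, hα⟩

/-- The lowering operator of a principal `sl₂`-triple. -/
theorem exists_principal_lowering [FiniteDimensional ℂ U] {μ : Module.Dual ℂ H} {u : U}
    (hu : IsHighestWeightVector b L μ u) {P : H}
    (hP : ∀ i : b.support, (rootSystem H).root i P = 1) :
    ∃ (f : 𝔤) (M : ℕ), 2 * μ P = M ∧ (L f ^ M) u ≠ 0 ∧ ⁅(P : 𝔤), f⁆ = -f := by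
  -- This happens only when there are no simple roots, and then `IsSl2Triple` is impossible because
  -- it requires h ≠ 0.
  by_cases hP0 : P = 0
  · exact ⟨0, 0, by simp [hP0], by simpa using hu.ne_zero, by simp⟩
  choose e f ht he hf using fun i : b.support => exists_sl2Triple (i : H.root)
  -- With these coefficients [∑ e_i, ∑ c_i f_i] = 2P, as the cross terms vanish.
  let c := fun i => b.toCoweightBasis.repr ((2 : ℂ) • P) i
  have hc : (2 : ℂ) • P = ∑ i, c i • (rootSystem H).coroot i := by
    conv_lhs => rw [← b.toCoweightBasis.sum_repr ((2 : ℂ) • P)]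
    simp [c]
  have hPe : ∀ i, ⁅(P : 𝔤), e i⁆ = e i := fun i => by rw [lie_eq_smul (he i), hP, one_smul]
  have hPf : ∀ i, ⁅(P : 𝔤), f i⁆ = -f i := fun i => by
    rw [lie_eq_smul (hf i), LinearMap.neg_apply, hP, neg_smul, one_smul]
  have hPE : ⁅(P : 𝔤), ∑ i, e i⁆ = ∑ i, e i := by
    rw [lie_sum]
    exact Finset.sum_congr rfl fun i _ => hPe i
  have hPF : ⁅(P : 𝔤), ∑ i, c i • f i⁆ = -∑ i, c i • f i := by
    rw [lie_sum, ← Finset.sum_neg_distrib]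
    exact Finset.sum_congr rfl fun i _ => by rw [lie_smul, hPf, smul_neg]
  have t : IsSl2Triple ((2 : ℂ) • (P : 𝔤)) (∑ i, e i) (∑ i, c i • f i) := by
    refine ⟨?_, ?_, ?_, ?_⟩
    · rw [smul_ne_zero_iff]
      exact ⟨two_ne_zero, fun h => hP0 (Subtype.ext h)⟩
    · have : (2 : ℂ) • (P : 𝔤) = ((∑ i, c i • (rootSystem H).coroot i : H) : 𝔤) := by
        rw [← hc]; rfl
      rw [this, sum_lie, show ((∑ i, c i • (rootSystem H).coroot i : H) : 𝔤) =
        ∑ i, c i • ((rootSystem H).coroot i : 𝔤) from map_sum H.toSubmodule.subtype _ _]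
      refine Finset.sum_congr rfl fun i _ => ?_
      rw [lie_sum, Finset.sum_eq_single i]
      · rw [lie_smul, (ht i).lie_e_f]
      · intro j _ hj
        rw [lie_smul, lie_simple_eq_zero hj.symm (he i) (hf j), smul_zero]
      · simp
    · rw [smul_lie, hPE, two_smul, two_smul]
    · rw [smul_lie, hPF, two_smul, two_smul, neg_add]
  obtain ⟨M, hM, hne, -⟩ := sl2_primitive L t (v := u) (k := 2 * μ P) hu.ne_zero
    (by rw [map_smul, LinearMap.smul_apply, hu.hasWeight, smul_smul])
    (by
      rw [map_sum, LinearMap.sum_apply]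
      exact Finset.sum_eq_zero fun i _ =>
        hu.raise i (RootPairing.Base.isPos_of_mem_support i.2) _ (he i))
  exact ⟨_, M, hM, hne M le_rfl, hPF⟩

/-- The sign of an invariant bilinear form. -/
theorem sign_of_invariant_form [FiniteDimensional ℂ U] {μ : Module.Dual ℂ H} {u : U}
    (hu : IsHighestWeightVector b L μ u) (htop : wordSpan b L u = ⊤) {P : H}
    (hP : ∀ i : b.support, (rootSystem H).root i P = 1)
    (F : U →ₗ[ℂ] Module.Dual ℂ U) (hF : ∀ x v, F (L x v) = dualLie L x (F v))
    (hinj : Function.Injective F) {ε : ℂ} (hε : ∀ v w, F v w = ε * F w v) :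
    ∃ M : ℕ, 2 * μ P = M ∧ ε = (-1) ^ M := by
  obtain ⟨f, M, hM, hne, hPf⟩ := exists_principal_lowering hu hP
  refine ⟨M, hM, ?_⟩
  have hPw : ∀ k : ℕ, L P ((L f ^ k) u) = (μ P - k) • (L f ^ k) u := by
    intro k
    induction k with
    | zero => simpa using hu.hasWeight P
    | succ k ih =>
      have h1 := lieHom_lie_apply L P f ((L f ^ k) u)
      rw [hPf, ih, map_neg, map_smul, LinearMap.neg_apply, eq_sub_iff_add_eq] at h1
      rw [pow_succ', Module.End.mul_apply, ← h1]
      push_cast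
      module
  set w := (L f ^ M) u
  -- `w` has P-eigenvalue μ(P) - M = -μ(P), so `F w` pairs nontrivially only with words of
  -- P-eigenvalue μ(P), and `u` is the only such word.
  have hFw : F w ≠ 0 := fun h => hne (hinj (by rw [h, map_zero]))
  obtain ⟨m, x, hx, hx'⟩ := exists_word_apply_ne_zero htop hFw
  have hxP := hx.apply_eq_neg hu.hasWeight hx' (h := P) (c := -μ P) (by
    rw [← hF, hPw, map_smul, ← hM]
    congr 1
    ring)
  rw [neg_neg] at hxP
  rw [hx.eq_of_apply_rho hP hxP] at hx'
  -- Each f crosses the invariant form with a minus sign. At (f^M u, u) this is compared with the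
  -- symmetry ε.
  have hswap : ∀ (k : ℕ) (a : U), F ((L f ^ k) a) u = (-1) ^ k * F a ((L f ^ k) u) := by
    intro k
    induction k with
    | zero => simp
    | succ k ih =>
      intro a
      rw [pow_succ, Module.End.mul_apply, ih, hF, dualLie_apply, ← Module.End.mul_apply,
        ← pow_succ', ← pow_succ]
      ring
  have h1 := hswap M u
  rw [hε u] at h1
  have h2 : (-1 : ℂ) ^ M * ε = 1 := by
    apply mul_right_cancel₀ hx'
    rw [one_mul, mul_assoc]
    exact h1.symm
  have h3 : ((-1 : ℂ) ^ M) * (-1) ^ M = 1 := by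
    rw [← mul_pow]; simp
  calc ε = ((-1 : ℂ) ^ M * (-1) ^ M) * ε := by rw [h3, one_mul]
    _ = (-1) ^ M := by rw [mul_assoc, h2, mul_one]

/-- If the eigenvalues of `T` differ by integers, then the simple roots that are not integral on
`T` do not contribute to the highest weight. -/
theorem integral_or_apply_eq_zero {μ : Module.Dual ℂ H} {u : U}
    (hu : IsHighestWeightVector b L μ u) (htop : wordSpan b L u = ⊤) {T : H}
    (hT : ∀ c d : ℂ, (L T).HasEigenvalue c → (L T).HasEigenvalue d → ∃ k : ℤ, c - d = k)
    (i : b.support) {S : H}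
    (hS : ∀ j : b.support, j ≠ i → (rootSystem H).root j S = 0) :
    (∃ k : ℤ, (rootSystem H).root i T = k) ∨ μ S = 0 := by
  classical
  by_cases hint : ∃ k : ℤ, (rootSystem H).root i T = k
  · exact Or.inl hint
  right
  -- A nonzero action would produce two eigenvalues of T differing by the non-integer σ_i(T).
  have hroot : ∀ x ∈ rootSpace H ((rootSystem H).root i : Module.Dual ℂ H), L x = 0 := by
    intro x hx
    refine LinearMap.ker_eq_top.1 (top_le_iff.1 ?_)
    rw [← htop, wordSpan, Submodule.span_le]
    rintro v ⟨m, hv⟩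
    by_contra hne
    have hne' : L x v ≠ 0 := hne
    have h1 := hv.hasWeight hu.hasWeight
    have h2 := h1.apply_root hx
    have hv0 : v ≠ 0 := fun h => hne' (by rw [h, map_zero])
    obtain ⟨k, hk⟩ := hT _ _ (Module.End.hasEigenvalue_of_hasEigenvector
      ⟨Module.End.mem_eigenspace_iff.2 (h2 T), hne'⟩) (Module.End.hasEigenvalue_of_hasEigenvector
      ⟨Module.End.mem_eigenspace_iff.2 (h1 T), hv0⟩)
    refine hint ⟨k, ?_⟩
    rw [← hk, LinearMap.add_apply, add_sub_cancel_left]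
  choose e f ht he hf using fun j : H.root => exists_sl2Triple j
  have hcor : ∀ j : H.root, L (e j) = 0 → L ((rootSystem H).coroot j) = 0 := by
    intro j hj
    rw [← (ht j).lie_e_f, LieHom.map_lie, hj, zero_lie]
  -- Roots acting trivially are orthogonal to those that do not: [h_j, e_k] = σ_k(h_j) e_k acts by
  -- zero while e_k does not.
  have hperp : ∀ j k : H.root, L ((rootSystem H).coroot j) = 0 →
      L ((rootSystem H).coroot k) ≠ 0 → (rootSystem H).pairing k j = 0 := by
    intro j k hj hk
    have h1 : L ⁅((rootSystem H).coroot j : 𝔤), e k⁆ = 0 := by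
      rw [LieHom.map_lie, hj, zero_lie]
    rw [lie_eq_smul (he k), map_smul] at h1
    exact (smul_eq_zero.1 h1).resolve_right fun h => hk (hcor k h)
  have hi : L ((rootSystem H).coroot i) = 0 := hcor i (hroot _ (he i))
  -- `S` is a combination of the coroots that act trivially
  let c := fun j => b.toCoweightBasis.repr S j
  have hc : S = ∑ j, c j • (rootSystem H).coroot j := by
    conv_lhs => rw [← b.toCoweightBasis.sum_repr S]
    simp [c]
  let S' : H := ∑ j : b.support,
    if L ((rootSystem H).coroot j) = 0 then c j • (rootSystem H).coroot j else 0
  -- If the coroot of k acts trivially, the dropped terms are orthogonal to it. Otherwise k ≠ i, so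
  -- σ_k(S) = 0, and the kept terms are orthogonal to σ_k.
  have hSS : S = S' := by
    apply eq_of_forall_root_apply_eq b
    intro k
    by_cases hk : L ((rootSystem H).coroot k) = 0
    · conv_lhs => rw [hc]
      rw [map_sum, map_sum]
      refine Finset.sum_congr rfl fun j _ => ?_
      split_ifs with hj
      · rfl
      · have h1 := hperp k j hk hj
        rw [RootPairing.pairing_eq_zero_iff] at h1
        rw [map_smul, map_zero]
        rw [show (rootSystem H).root k ((rootSystem H).coroot j) = 0 from h1, smul_zero]
    · rw [hS k (by rintro rfl; exact hk hi), map_sum]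
      symm
      refine Finset.sum_eq_zero fun j _ => ?_
      split_ifs with hj
      · rw [map_smul, show (rootSystem H).root k ((rootSystem H).coroot j) = 0 from hperp j k hj hk,
          smul_zero]
      · rw [map_zero]
  have hLS : L (S : 𝔤) = 0 := by
    rw [hSS, show ((S' : H) : 𝔤) = ∑ j : b.support, ((if L ((rootSystem H).coroot j) = 0 then
      c j • (rootSystem H).coroot j else 0 : H) : 𝔤) from map_sum H.toSubmodule.subtype _ _,
      map_sum]
    refine Finset.sum_eq_zero fun j _ => ?_
    split_ifs with hj
    · rw [SetLike.val_smul, map_smul, hj, smul_zero]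
    · rw [ZeroMemClass.coe_zero, map_zero]
  have := hu.hasWeight S
  rw [hLS, LinearMap.zero_apply] at this
  exact (smul_eq_zero.1 this.symm).resolve_right hu.ne_zero

end Duals

/-! ### Regular functions and algebraic representations -/

section Regular

variable {N : ℕ} {G : Subgroup (Matrix.GeneralLinearGroup (Fin N) ℂ)}

/-- The regular functions on `G`. -/
def IsRegular (f : G → ℂ) : Prop :=
  ∃ (p : MvPolynomial (Fin N × Fin N) ℂ) (k : ℕ), ∀ g : G,
    f g * (Matrix.det ((g : Matrix.GeneralLinearGroup (Fin N) ℂ) : Matrix (Fin N) (Fin N) ℂ)) ^ k =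
      evalMat ((g : Matrix.GeneralLinearGroup (Fin N) ℂ) : Matrix (Fin N) (Fin N) ℂ) p

theorem det_coe_ne_zero (g : G) :
    Matrix.det ((g : Matrix.GeneralLinearGroup (Fin N) ℂ) : Matrix (Fin N) (Fin N) ℂ) ≠ 0 :=
  ((Matrix.isUnit_iff_isUnit_det _).1 (g : Matrix.GeneralLinearGroup (Fin N) ℂ).isUnit).ne_zero

theorem isRegular_evalMat (p : MvPolynomial (Fin N × Fin N) ℂ) : IsRegular fun g : G =>
    evalMat ((g : Matrix.GeneralLinearGroup (Fin N) ℂ) : Matrix (Fin N) (Fin N) ℂ) p :=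
  ⟨p, 0, fun g => by simp⟩

theorem isRegular_const (c : ℂ) : IsRegular fun _ : G => c :=
  ⟨MvPolynomial.C c, 0, fun g => by simp⟩

theorem IsRegular.mul {f f' : G → ℂ} (h : IsRegular f) (h' : IsRegular f') :
    IsRegular fun g => f g * f' g := by
  obtain ⟨p, k, hp⟩ := h
  obtain ⟨p', k', hp'⟩ := h'
  exact ⟨p * p', k + k', fun g => by rw [map_mul, ← hp, ← hp', pow_add]; ring⟩

theorem IsRegular.add {f f' : G → ℂ} (h : IsRegular f) (h' : IsRegular f') :
    IsRegular fun g => f g + f' g := by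
  obtain ⟨p, k, hp⟩ := h
  obtain ⟨p', k', hp'⟩ := h'
  refine ⟨p * (Matrix.mvPolynomialX (Fin N) (Fin N) ℂ).det ^ k' +
    p' * (Matrix.mvPolynomialX (Fin N) (Fin N) ℂ).det ^ k, k + k', fun g => ?_⟩
  rw [map_add, map_mul, map_mul, evalMat_det, evalMat_det, ← hp, ← hp', pow_add]
  ring

theorem IsRegular.sum {ι : Type*} {s : Finset ι} {f : ι → G → ℂ}
    (h : ∀ i ∈ s, IsRegular (f i)) : IsRegular fun g => ∑ i ∈ s, f i g := by
  classical
  induction s using Finset.induction_on with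
  | empty => simpa using isRegular_const 0
  | insert a s ha ih =>
    simp only [Finset.sum_insert ha]
    exact (h a (Finset.mem_insert_self a s)).add
      (ih fun i hi => h i (Finset.mem_insert_of_mem hi))

theorem isRegular_inv_apply (i j : Fin N) : IsRegular fun g : G =>
    (((g⁻¹ : G) : Matrix.GeneralLinearGroup (Fin N) ℂ) : Matrix (Fin N) (Fin N) ℂ) i j := by
  refine ⟨(Matrix.mvPolynomialX (Fin N) (Fin N) ℂ).adjugate i j, 1, fun g => ?_⟩
  have h1 := (evalMat ((g : Matrix.GeneralLinearGroup (Fin N) ℂ) :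
    Matrix (Fin N) (Fin N) ℂ)).map_adjugate (Matrix.mvPolynomialX (Fin N) (Fin N) ℂ)
  have h2 := congrFun (congrFun h1 i) j
  have h3 : (evalMat ((g : Matrix.GeneralLinearGroup (Fin N) ℂ) :
      Matrix (Fin N) (Fin N) ℂ)).mapMatrix (Matrix.mvPolynomialX (Fin N) (Fin N) ℂ) =
      ((g : Matrix.GeneralLinearGroup (Fin N) ℂ) : Matrix (Fin N) (Fin N) ℂ) := by
    ext; simp
  rw [h3] at h2
  beta_reduce
  rw [show evalMat _ ((Matrix.mvPolynomialX (Fin N) (Fin N) ℂ).adjugate i j) = _ from h2,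
    Subgroup.coe_inv, Matrix.coe_units_inv, Matrix.inv_def, Matrix.smul_apply, smul_eq_mul,
    Ring.inverse_eq_inv', pow_one, mul_comm, ← mul_assoc, mul_inv_cancel₀ (det_coe_ne_zero g),
    one_mul]

theorem isRegular_evalMat_inv (p : MvPolynomial (Fin N × Fin N) ℂ) : IsRegular fun g : G =>
    evalMat (((g⁻¹ : G) : Matrix.GeneralLinearGroup (Fin N) ℂ) : Matrix (Fin N) (Fin N) ℂ) p := by
  induction p using MvPolynomial.induction_on with
  | C a => simpa using isRegular_const a
  | add p q hp hq => simpa only [map_add] using hp.add hq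
  | mul_X p ij hp => simpa only [map_mul, evalMat_X] using hp.mul (isRegular_inv_apply ij.1 ij.2)

/-- f(g⁻¹) = p(g⁻¹) det(g)^k, and the entries of g⁻¹ are regular by Cramer's rule. This makes dual
representations algebraic. -/
theorem IsRegular.inv {f : G → ℂ} (h : IsRegular f) : IsRegular fun g => f g⁻¹ := by
  obtain ⟨p, k, hp⟩ := h
  have h2 := (isRegular_evalMat (G := G)
    ((Matrix.mvPolynomialX (Fin N) (Fin N) ℂ).det ^ k)).mul (isRegular_evalMat_inv p)
  convert h2 using 2 with g
  rw [← hp, evalMat_det, mul_comm, mul_assoc, ← mul_pow, ← Matrix.det_mul, ← Units.val_mul,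
    ← Subgroup.coe_mul, inv_mul_cancel]
  simp

variable {U U' : Type*} [AddCommGroup U] [Module ℂ U] [AddCommGroup U'] [Module ℂ U']
  {τ : Representation ℂ G U} {τ' : Representation ℂ G U'}

theorem IsAlgebraicRep.of_retract (h : IsAlgebraicRep τ') (j : U →ₗ[ℂ] U') (r : U' →ₗ[ℂ] U)
    (hr : ∀ g u, τ g u = r (τ' g (j u))) : IsAlgebraicRep τ := by
  intro u l
  obtain ⟨p, k, hp⟩ := h (j u) (l ∘ₗ r)
  exact ⟨p, k, fun g => by rw [hr]; exact hp g⟩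

theorem IsAlgebraicRep.dual [FiniteDimensional ℂ U] (h : IsAlgebraicRep τ) :
    IsAlgebraicRep τ.dual := by
  intro ξ l
  obtain ⟨u, rfl⟩ := (Module.evalEquiv ℂ U).surjective l
  exact IsRegular.inv (h u ξ)

theorem IsAlgebraicRep.prod (h : IsAlgebraicRep τ) (h' : IsAlgebraicRep τ') :
    IsAlgebraicRep (τ.prod τ') := by
  intro u l
  have h1 := IsRegular.add (h u.1 (l ∘ₗ LinearMap.inl ℂ U U')) (h' u.2 (l ∘ₗ LinearMap.inr ℂ U U'))
  change IsRegular _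
  have : ∀ g, l ((τ.prod τ') g u) = (l ∘ₗ LinearMap.inl ℂ U U') (τ g u.1) +
      (l ∘ₗ LinearMap.inr ℂ U U') (τ' g u.2) := fun g => by
    rw [LinearMap.comp_apply, LinearMap.comp_apply, ← map_add]
    simp
  simp only [this]
  exact h1

theorem IsDefinedOverQ.isAlgebraicRep {V : Type*} [AddCommGroup V] [Module ℚ V]
    [FiniteDimensional ℚ V] {ρ : Representation ℂ G (ℂ ⊗[ℚ] V)} (h : IsDefinedOverQ ρ) :
    IsAlgebraicRep ρ := by
  let B := Module.finBasis ℚ V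
  let B' := B.baseChange ℂ
  intro v l
  have hl : l = ∑ j, l (B' j) • extend (B.coord j) := by
    refine B'.ext fun i => ?_
    simp [B', extend, Module.Basis.baseChange_apply, Finsupp.single_apply]
  have hv : ∀ g, l (ρ g v) = ∑ i, ∑ j, (l (B' j) * B'.repr v i) *
      extend (B.coord j) (ρ g (1 ⊗ₜ B i)) := by
    intro g
    conv_lhs => rw [← B'.sum_repr v, hl]
    simp only [map_sum, map_smul, LinearMap.sum_apply, LinearMap.smul_apply, smul_eq_mul, B',
      Module.Basis.baseChange_apply, Finset.mul_sum]
    refine Finset.sum_congr rfl fun i _ => Finset.sum_congr rfl fun j _ => ?_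
    ring
  change IsRegular fun g => l (ρ g v)
  simp only [hv]
  refine IsRegular.sum fun i _ => IsRegular.sum fun j _ => (isRegular_const _).mul ?_
  obtain ⟨p, k, hp⟩ := h (B i) (B.coord j)
  refine ⟨MvPolynomial.map (algebraMap ℚ ℂ) p, k, fun g => ?_⟩
  rw [hp]
  exact (MvPolynomial.aeval_map_algebraMap ℂ _ p).symm

theorem eq_bot_or_eq_top_of_isIrreducible (h : τ.IsIrreducible) (W : Submodule ℂ U)
    (hW : ∀ g, ∀ w ∈ W, τ g w ∈ W) : W = ⊥ ∨ W = ⊤ := by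
  rcases h.eq_bot_or_eq_top ⟨W, fun g w hw => hW g w hw⟩ with h | h
  · exact Or.inl (congrArg Subrepresentation.toSubmodule h)
  · exact Or.inr (congrArg Subrepresentation.toSubmodule h)

theorem nontrivial_of_isIrreducible (h : τ.IsIrreducible) : Nontrivial U := by
  by_contra hU
  rw [not_nontrivial_iff_subsingleton] at hU
  obtain ⟨a, c, hac⟩ := h.exists_pair_ne
  exact hac (Subrepresentation.toSubmodule_injective (Subsingleton.elim _ _))

end Regular

/-! ### Transfer between representations of G and of its Lie algebra -/

section Transfer

open LieAlgebra LieAlgebra.IsKilling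

variable {N : ℕ} {G : Subgroup (Matrix.GeneralLinearGroup (Fin N) ℂ)} [IsSemisimpleOverQ G]
  {U U' : Type*} [AddCommGroup U] [Module ℂ U] [AddCommGroup U'] [Module ℂ U']
  {τ : Representation ℂ G U} {τ' : Representation ℂ G U'}
  {L : lieAlg G →ₗ⁅ℂ⁆ Module.End ℂ U} {L' : lieAlg G →ₗ⁅ℂ⁆ Module.End ℂ U'}

theorem expG_neg (X : lieAlg G) : expG (-X) = (expG X)⁻¹ := by
  rw [eq_inv_iff_mul_eq_one]
  have := expG_add_smul (-1) 1 X
  simpa [expG_zero] using this.symm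

theorem HasDifferential.dual [FiniteDimensional ℂ U] (h : HasDifferential τ L) :
    HasDifferential τ.dual (dualLie L) := by
  intro X ξ l
  obtain ⟨u, rfl⟩ := (Module.evalEquiv ℂ U).surjective l
  have h1 := h (-X) u ξ
  refine (h1.congr_deriv ?_).congr_of_eventuallyEq (Filter.Eventually.of_forall fun t => ?_)
  · simp
  · simp only [smul_neg, expG_neg]
    rfl

theorem HasDifferential.prod (h : HasDifferential τ L) (h' : HasDifferential τ' L') :
    HasDifferential (τ.prod τ') (prodLie L L') := by
  intro X u l
  have hl : ∀ a b, l (a, b) = (l ∘ₗ LinearMap.inl ℂ U U') a + (l ∘ₗ LinearMap.inr ℂ U U') b :=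
    fun a b => by rw [LinearMap.comp_apply, LinearMap.comp_apply, ← map_add]; simp
  have h1 := (h X u.1 (l ∘ₗ LinearMap.inl ℂ U U')).fun_add (h' X u.2 (l ∘ₗ LinearMap.inr ℂ U U'))
  refine (h1.congr_deriv ?_).congr_of_eventuallyEq (Filter.Eventually.of_forall fun t => ?_)
  · rw [prodLie_apply, hl]
  · exact hl _ _

/-- An intertwining map commutes with the differentials. -/
theorem HasDifferential.map_apply (h : HasDifferential τ L) (h' : HasDifferential τ' L')
    (F : U →ₗ[ℂ] U') (hF : ∀ g u, F (τ g u) = τ' g (F u)) (X : lieAlg G) (u : U) :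
    F (L X u) = L' X (F u) := by
  rw [← sub_eq_zero, ← Module.forall_dual_apply_eq_zero_iff ℂ]
  intro l
  have h1 := h X u (l ∘ₗ F)
  have h2 := h' X (F u) l
  simp only [LinearMap.comp_apply, hF] at h1
  rw [map_sub, sub_eq_zero]
  exact h1.unique h2

/-- A linear map that commutes with the differentials is an intertwining map. -/
theorem HasDifferential.map_apply_of_lie [FiniteDimensional ℂ U] [FiniteDimensional ℂ U']
    (h : HasDifferential τ L) (h' : HasDifferential τ' L') (hτ : IsAlgebraicRep τ)
    (hτ' : IsAlgebraicRep τ') (F : U →ₗ[ℂ] U') (hF : ∀ X u, F (L X u) = L' X (F u)) (g : G)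
    (u : U) : F (τ g u) = τ' g (F u) := by
  -- Commuting with operators means that the graph is stable under them, and stability passes from
  -- the Lie algebra to G.
  have h1 := (h.prod h').apply_mem (hτ.prod hτ') F.graph (fun X w hw => by
    rw [LinearMap.mem_graph_iff] at hw ⊢
    rw [prodLie_apply, hw, hF]) g (w := (u, F u)) (by rw [LinearMap.mem_graph_iff])
  rw [LinearMap.mem_graph_iff] at h1
  exact h1.symm

theorem HasDifferential.isIrreducibleLie [FiniteDimensional ℂ U] (h : HasDifferential τ L)
    (hτ : IsAlgebraicRep τ) (hirr : τ.IsIrreducible) : IsIrreducibleLie L :=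
  fun W hW => eq_bot_or_eq_top_of_isIrreducible hirr W fun g _ hw => h.apply_mem hτ W hW g hw

theorem HasDifferential.apply_eq_smul (h : HasDifferential τ L) {X : lieAlg G} {u : U} {c : ℂ}
    (hc : ∀ t : ℂ, τ (expG (t • X)) u = Complex.exp (t * c) • u) : L X u = c • u := by
  rw [← sub_eq_zero, ← Module.forall_dual_apply_eq_zero_iff ℂ]
  intro l
  have h1 := h X u l
  simp only [hc, map_smul, smul_eq_mul] at h1
  have h2 : HasDerivAt (fun t : ℂ => Complex.exp (t * c) * l u) (c * l u) 0 := by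
    have := (((hasDerivAt_id (0 : ℂ)).mul_const c).cexp).mul_const (l u)
    refine this.congr_deriv ?_
    simp
  rw [map_sub, sub_eq_zero, map_smul, smul_eq_mul]
  exact h1.unique h2

variable {H : LieSubalgebra ℂ (lieAlg G)} [H.IsCartanSubalgebra] {b : (rootSystem H).Base}

theorem IsHighestWeight.exists_isHighestWeightVector {μ : Module.Dual ℂ H}
    (h : HasDifferential τ L) (hμ : IsHighestWeight b τ μ) :
    ∃ u, IsHighestWeightVector b L μ u := by
  obtain ⟨u, hu, hH, he⟩ := hμ
  refine ⟨u, hu, fun x => h.apply_eq_smul fun t => ?_, fun i hi e hie => ?_⟩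
  · rw [hH (t • x) (expG (t • (x : lieAlg G))) (by rw [coe_expG]; rfl), map_smul, smul_eq_mul]
  · have h1 : L e u = (0 : ℂ) • u := h.apply_eq_smul fun t => by
      rw [mul_zero, Complex.exp_zero, one_smul]
      exact he i hi (t • e) (Submodule.smul_mem _ t hie) _ (by rw [coe_expG])
    rw [h1, zero_smul]

end Transfer

/-! ### The circle -/

section CircleAction

variable {N : ℕ} {G : Subgroup (Matrix.GeneralLinearGroup (Fin N) ℂ)}

theorem differentiable_eval_mvPolynomial {ι : Type*} {f : ι → ℝ → ℝ}
    (hf : ∀ i, Differentiable ℝ (f i)) (p : MvPolynomial ι ℝ) :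
    Differentiable ℝ fun t => MvPolynomial.eval (fun i => f i t) p := by
  induction p using MvPolynomial.induction_on with
  | C a => simp
  | add p q hp hq => simpa only [map_add] using hp.fun_add hq
  | mul_X p i hp => simpa only [map_mul, MvPolynomial.eval_X] using hp.fun_mul (hf i)

/-- The one-parameter group of matrices `φ(e^{2πit})`. -/
def circleMatrix (φ : Circle →* G) (t : ℝ) : Matrix (Fin N) (Fin N) ℂ :=
  ((φ (Circle.exp (2 * Real.pi * t)) : Matrix.GeneralLinearGroup (Fin N) ℂ) :
    Matrix (Fin N) (Fin N) ℂ)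

theorem circleMatrix_zero (φ : Circle →* G) : circleMatrix φ 0 = 1 := by
  simp [circleMatrix]

theorem circleMatrix_add (φ : Circle →* G) (s t : ℝ) :
    circleMatrix φ (s + t) = circleMatrix φ s * circleMatrix φ t := by
  simp [circleMatrix, mul_add, Circle.exp_add]

theorem IsAlgebraicCircle.differentiable {φ : Circle →* G} (hφ : IsAlgebraicCircle φ)
    (i j : Fin N) : Differentiable ℝ fun t => circleMatrix φ t i j := by
  obtain ⟨p, hp⟩ := hφ i j
  have h1 : Differentiable ℝ fun t : ℝ => MvPolynomial.eval
      (fun k : Fin 2 => (![fun t : ℝ => Real.cos (2 * Real.pi * t),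
        fun t : ℝ => Real.sin (2 * Real.pi * t)] : Fin 2 → ℝ → ℝ) k t) p := by
    refine differentiable_eval_mvPolynomial (fun k => ?_) p
    fin_cases k
    · exact Real.differentiable_cos.comp (differentiable_id.const_mul _)
    · exact Real.differentiable_sin.comp (differentiable_id.const_mul _)
  have h2 : (fun t => circleMatrix φ t i j) = fun t : ℝ => ((MvPolynomial.eval
      (fun k : Fin 2 => (![fun t : ℝ => Real.cos (2 * Real.pi * t),
        fun t : ℝ => Real.sin (2 * Real.pi * t)] : Fin 2 → ℝ → ℝ) k t) p : ℝ) : ℂ) := by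
    funext t
    refine (hp _).trans ?_
    congr 2
    congr 1
    funext k
    fin_cases k
    · simp [Circle.coe_exp, Complex.exp_ofReal_mul_I_re, -Complex.ofReal_mul]
    · simp [Circle.coe_exp, Complex.exp_ofReal_mul_I_im, -Complex.ofReal_mul]
  rw [h2]
  exact fun t => (h1 t).hasDerivAt.ofReal_comp.differentiableAt

theorem gradingMatrix_smul (φ : Circle →* G) (i j : Fin N) :
    ((4 * (Real.pi : ℂ) * Complex.I) • gradingMatrix φ) i j =
      deriv (fun t => circleMatrix φ t i j) 0 := by
  rw [gradingMatrix, smul_smul, mul_inv_cancel₀ (by simp [Real.pi_ne_zero]), one_smul]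
  rfl

theorem IsAlgebraicCircle.hasDerivAt {φ : Circle →* G} (hφ : IsAlgebraicCircle φ)
    (t : ℝ) (i j : Fin N) : HasDerivAt (fun s => circleMatrix φ s i j)
      ((((4 * (Real.pi : ℂ) * Complex.I) • gradingMatrix φ) * circleMatrix φ t) i j) t := by
  have h1 : ∀ k, HasDerivAt (fun s => circleMatrix φ (s - t) i k)
      (((4 * (Real.pi : ℂ) * Complex.I) • gradingMatrix φ) i k) t := by
    intro k
    rw [gradingMatrix_smul]
    have h2 := (hφ.differentiable i k 0).hasDerivAt
    rw [← sub_self t] at h2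
    simpa using h2.comp_sub_const t t
  have h3 := HasDerivAt.fun_sum (u := Finset.univ) fun k _ =>
    (h1 k).mul_const (circleMatrix φ t k j)
  refine (h3.congr_deriv ?_).congr_of_eventuallyEq (Filter.Eventually.of_forall fun s => ?_)
  · rw [Matrix.mul_apply]
  · beta_reduce
    rw [← Matrix.mul_apply, ← circleMatrix_add, sub_add_cancel]

/-- Both sides solve the same linear differential equation: exp(-tX) φ(e^{2πit}) has derivative
zero. -/
theorem IsAlgebraicCircle.circleMatrix_eq_exp {φ : Circle →* G} (hφ : IsAlgebraicCircle φ)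
    (t : ℝ) : circleMatrix φ t =
      NormedSpace.exp ((t : ℂ) • ((4 * (Real.pi : ℂ) * Complex.I) • gradingMatrix φ)) := by
  set X := (4 * (Real.pi : ℂ) * Complex.I) • gradingMatrix φ with hX
  have hconst : NormedSpace.exp ((t : ℂ) • -X) * circleMatrix φ t = 1 := by
    ext i j
    have hd : ∀ s : ℝ, HasDerivAt
        (fun s : ℝ => (NormedSpace.exp ((s : ℂ) • -X) * circleMatrix φ s) i j) 0 s := by
      intro s
      have h1 : ∀ k, HasDerivAt (fun s : ℝ => NormedSpace.exp ((s : ℂ) • -X) i k)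
          ((NormedSpace.exp ((s : ℂ) • -X) * -X) i k) s := fun k => by
        have := (exp_entries_hasDerivAt 1 (-X) (s : ℂ) i k).comp_ofReal
        simpa only [one_mul] using this
      have h2 := HasDerivAt.fun_sum (u := Finset.univ) fun k _ =>
        (h1 k).fun_mul (hφ.hasDerivAt s k j)
      refine (h2.congr_deriv ?_).congr_of_eventuallyEq (Filter.Eventually.of_forall fun s => ?_)
      · rw [Finset.sum_add_distrib, ← Matrix.mul_apply, ← Matrix.mul_apply, ← Matrix.add_apply,
          ← hX, mul_neg, neg_mul, mul_assoc, neg_add_cancel, Matrix.zero_apply]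
      · exact Matrix.mul_apply
    have := is_const_of_deriv_eq_zero (fun s => (hd s).differentiableAt)
      (fun s => (hd s).deriv) t 0
    rw [this]
    simp [circleMatrix_zero]
  have h2 : NormedSpace.exp ((t : ℂ) • X) * NormedSpace.exp ((t : ℂ) • -X) = 1 := by
    rw [smul_neg, ← Matrix.exp_add_of_commute _ _ (Commute.refl ((t : ℂ) • X)).neg_right, add_neg_cancel,
      NormedSpace.exp_zero]
  calc circleMatrix φ t = (NormedSpace.exp ((t : ℂ) • X) * NormedSpace.exp ((t : ℂ) • -X)) *
        circleMatrix φ t := by rw [h2, one_mul]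
    _ = _ := by rw [mul_assoc, hconst, mul_one]

variable [IsSemisimpleOverQ G] {U : Type*} [AddCommGroup U] [Module ℂ U]
  {τ : Representation ℂ G U} {L : lieAlg G →ₗ⁅ℂ⁆ Module.End ℂ U}

theorem IsAlgebraicCircle.apply_exp {φ : Circle →* G} (hφ : IsAlgebraicCircle φ) {T : lieAlg G}
    (hT : (T : Matrix (Fin N) (Fin N) ℂ) = gradingMatrix φ) (t : ℝ) :
    φ (Circle.exp (2 * Real.pi * t)) = expG ((t * (4 * (Real.pi : ℂ) * Complex.I)) • T) := by
  apply eq_of_coe_eq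
  rw [coe_expG_smul, hT, mul_smul]
  exact hφ.circleMatrix_eq_exp t

theorem HasDifferential.apply_exp_of_eigenvector (h : HasDifferential τ L) {X : lieAlg G} {v : U}
    {c : ℂ} (hv : L X v = c • v) (t : ℂ) : τ (expG (t • X)) v = Complex.exp (t * c) • v := by
  have h0 : Complex.exp (-(t * c)) • τ (expG (t • X)) v = v := by
    rw [← sub_eq_zero, ← Module.forall_dual_apply_eq_zero_iff ℂ]
    intro l
    have hd : ∀ s : ℂ, HasDerivAt
        (fun s : ℂ => Complex.exp (-(s * c)) * l (τ (expG (s • X)) v)) 0 s := by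
      intro s
      have h1 := (((hasDerivAt_id s).mul_const c).fun_neg.cexp).fun_mul (h.hasDerivAt X v l s)
      refine h1.congr_deriv ?_
      rw [hv]
      simp
      ring
    have := is_const_of_deriv_eq_zero (fun s => (hd s).differentiableAt)
      (fun s => (hd s).deriv) t 0
    rw [map_sub, map_smul, smul_eq_mul, this]
    simp [expG_zero]
  rw [← h0, smul_smul, ← Complex.exp_add, h0]
  simp

theorem circle_exp_pi : Circle.exp Real.pi = -1 := by
  ext
  simp [Circle.coe_exp]

theorem circle_exists_exp (z : Circle) : ∃ t : ℝ, z = Circle.exp (2 * Real.pi * t) := by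
  refine ⟨Complex.arg z / (2 * Real.pi), ?_⟩
  rw [mul_div_cancel₀ _ (by simp [Real.pi_ne_zero]), Circle.exp_arg]

theorem circle_exp_zpow (t : ℝ) (k : ℤ) : ((Circle.exp (2 * Real.pi * t) : Circle) : ℂ) ^ k =
    Complex.exp (t * (4 * (Real.pi : ℂ) * Complex.I) * (k / 2)) := by
  rw [Circle.coe_exp, ← Complex.exp_int_mul]
  congr 1
  push_cast
  ring

/-- The vectors on which the circle acts by `z ^ k` are the eigenvectors of the grading element
for the eigenvalue `k / 2`. -/
theorem HasDifferential.circle_apply_iff (h : HasDifferential τ L) {φ : Circle →* G}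
    (hφ : IsAlgebraicCircle φ) {T : lieAlg G}
    (hT : (T : Matrix (Fin N) (Fin N) ℂ) = gradingMatrix φ) (k : ℤ) (v : U) :
    (∀ z : Circle, τ (φ z) v = ((z : ℂ) ^ k) • v) ↔ L T v = ((k : ℂ) / 2) • v := by
  constructor
  · intro hv
    have hpi : (4 * (Real.pi : ℂ) * Complex.I) ≠ 0 := by simp [Real.pi_ne_zero]
    rw [← sub_eq_zero, ← Module.forall_dual_apply_eq_zero_iff ℂ]
    intro l
    have h1 := h ((4 * (Real.pi : ℂ) * Complex.I) • T) v l
    have h2 := HasDerivAt.comp_ofReal (z := (0 : ℝ)) (by simpa using h1)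
    have h3 : HasDerivAt (fun t : ℂ =>
        Complex.exp (t * (4 * (Real.pi : ℂ) * Complex.I) * (k / 2)) * l v)
        ((4 * (Real.pi : ℂ) * Complex.I) * (k / 2) * l v) 0 := by
      have := (((hasDerivAt_id (0 : ℂ)).mul_const
        (4 * (Real.pi : ℂ) * Complex.I)).mul_const ((k : ℂ) / 2)).cexp.mul_const (l v)
      refine this.congr_deriv ?_
      simp
    have h4 := HasDerivAt.comp_ofReal (z := (0 : ℝ)) (by simpa using h3)
    -- For real t the exponential is a point of the circle, so `hv` makes the coefficient explicit.
    -- Comparing derivatives at 0 gives the eigenvalue.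
    have h5 : (fun t : ℝ => l (τ (expG ((t : ℂ) • (4 * (Real.pi : ℂ) * Complex.I) • T)) v)) =
        fun t : ℝ => Complex.exp (t * (4 * (Real.pi : ℂ) * Complex.I) * (k / 2)) * l v := by
      funext t
      rw [smul_smul, ← hφ.apply_exp hT, hv, map_smul, smul_eq_mul, circle_exp_zpow]
    rw [h5] at h2
    have h6 := h2.unique h4
    have h7 : l (L T v) = k / 2 * l v :=
      mul_left_cancel₀ hpi (h6.trans (mul_assoc _ ((k : ℂ) / 2) (l v)))
    rw [map_sub, map_smul, smul_eq_mul, h7, sub_self]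
  · intro hv z
    obtain ⟨t, rfl⟩ := circle_exists_exp z
    rw [hφ.apply_exp hT, h.apply_exp_of_eigenvector hv, circle_exp_zpow]

/-- The point -1 is reached at t = 1/2. As φ(-1) acts by a sign in the applications, this yields the
integrality of differences of eigenvalues of T. -/
theorem HasDifferential.circle_neg_one_apply (h : HasDifferential τ L) {φ : Circle →* G}
    (hφ : IsAlgebraicCircle φ) {T : lieAlg G}
    (hT : (T : Matrix (Fin N) (Fin N) ℂ) = gradingMatrix φ) {c : ℂ} {v : U}
    (hv : L T v = c • v) : τ (φ (-1)) v = Complex.exp (2 * Real.pi * Complex.I * c) • v := by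
  have h1 : (-1 : Circle) = Circle.exp (2 * Real.pi * (1 / 2 : ℝ)) := by
    rw [show 2 * Real.pi * (1 / 2 : ℝ) = Real.pi by ring]
    exact circle_exp_pi.symm
  rw [h1, hφ.apply_exp hT, h.apply_exp_of_eigenvector hv]
  congr 2
  push_cast
  ring

end CircleAction

/-! ### Real structures and invariant forms -/

section Conjugation

variable {V : Type*} [AddCommGroup V] [Module ℚ V]

theorem conj_tmul (z : ℂ) (v : V) : conj V (z ⊗ₜ v) = (starRingEnd ℂ z) ⊗ₜ v := rfl

theorem conj_smul (z : ℂ) (x : ℂ ⊗[ℚ] V) : conj V (z • x) = starRingEnd ℂ z • conj V x := by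
  induction x using TensorProduct.induction_on with
  | zero => simp
  | tmul w v => rw [TensorProduct.smul_tmul', conj_tmul, conj_tmul, TensorProduct.smul_tmul']; simp
  | add x y hx hy => rw [smul_add, map_add, hx, hy, map_add, smul_add]

theorem conj_conj (x : ℂ ⊗[ℚ] V) : conj V (conj V x) = x := by
  induction x using TensorProduct.induction_on with
  | zero => simp
  | tmul w v => rw [conj_tmul, conj_tmul, Complex.conj_conj]
  | add x y hx hy => rw [map_add, map_add, hx, hy]

theorem extend_tmul (l : Module.Dual ℚ V) (z : ℂ) (v : V) :
    extend l (z ⊗ₜ v) = l v * z := by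
  simp [extend, Algebra.smul_def]

theorem extend_conj (l : Module.Dual ℚ V) (x : ℂ ⊗[ℚ] V) :
    extend l (conj V x) = starRingEnd ℂ (extend l x) := by
  induction x using TensorProduct.induction_on with
  | zero => simp
  | tmul w v => rw [conj_tmul, extend_tmul, extend_tmul]; simp
  | add x y hx hy => rw [map_add, map_add, hx, hy, map_add, map_add]

theorem baseChange_conj (Q : LinearMap.BilinForm ℚ V) (x y : ℂ ⊗[ℚ] V) :
    LinearMap.BilinForm.baseChange ℂ Q (conj V x) (conj V y) =
      starRingEnd ℂ (LinearMap.BilinForm.baseChange ℂ Q x y) := by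
  induction x using TensorProduct.induction_on with
  | zero => simp
  | add x x' hx hx' => simp only [map_add, LinearMap.add_apply, hx, hx']
  | tmul w v =>
    induction y using TensorProduct.induction_on with
    | zero => simp
    | add y y' hy hy' => simp only [map_add, hy, hy']
    | tmul w' v' =>
      simp [conj_tmul, Algebra.smul_def]

theorem baseChange_parity {Q : LinearMap.BilinForm ℚ V} {n : ℤ}
    (hQ : ∀ u v, Q u v = (-1 : ℚ) ^ n * Q v u) (x y : ℂ ⊗[ℚ] V) :
    LinearMap.BilinForm.baseChange ℂ Q x y =
      (-1 : ℂ) ^ n * LinearMap.BilinForm.baseChange ℂ Q y x := by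
  induction x using TensorProduct.induction_on with
  | zero => simp
  | add x x' hx hx' => simp only [map_add, LinearMap.add_apply, hx, hx', mul_add]
  | tmul w v =>
    induction y using TensorProduct.induction_on with
    | zero => simp
    | add y y' hy hy' => simp only [map_add, LinearMap.add_apply, hy, hy', mul_add]
    | tmul w' v' =>
      simp only [LinearMap.BilinForm.baseChange_tmul, Algebra.smul_def]
      rw [hQ v v']
      push_cast
      simp
      ring

theorem conj_eq_of_mem_realPoints {x : ℂ ⊗[ℚ] V} (hx : x ∈ realPoints V) : conj V x = x := by
  induction hx using Submodule.span_induction with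
  | mem x h => obtain ⟨v, rfl⟩ := h; rw [conj_tmul, map_one]
  | zero => simp
  | add x y _ _ hx hy => rw [map_add, hx, hy]
  | smul a x _ hx =>
    have : a • x = (a : ℂ) • x := (algebraMap_smul ℂ a x).symm
    rw [this, conj_smul, hx, Complex.conj_ofReal]

/-- The complex conjugate of a bilinear form. -/
def conjForm (B : LinearMap.BilinForm ℂ (ℂ ⊗[ℚ] V)) : LinearMap.BilinForm ℂ (ℂ ⊗[ℚ] V) :=
  LinearMap.mk₂ ℂ (fun x y => starRingEnd ℂ (B (conj V x) (conj V y)))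
    (fun x x' y => by simp only [map_add, LinearMap.add_apply])
    (fun c x y => by simp [conj_smul])
    (fun x y y' => by simp only [map_add])
    (fun c x y => by simp [conj_smul])

theorem conjForm_apply (B : LinearMap.BilinForm ℂ (ℂ ⊗[ℚ] V)) (x y : ℂ ⊗[ℚ] V) :
    conjForm B x y = starRingEnd ℂ (B (conj V x) (conj V y)) := rfl

variable {N : ℕ} {G : Subgroup (Matrix.GeneralLinearGroup (Fin N) ℂ)}
  {ρ : Representation ℂ G (ℂ ⊗[ℚ] V)} {φ : Circle →* G} {n : ℤ}
  {Q : LinearMap.BilinForm ℚ V}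

/-- By the second bilinear relation, a nonzero v is not orthogonal to C v̄. -/
theorem IsHodgeRepresentation.eq_zero_of_forall (h : IsHodgeRepresentation n Q ρ φ)
    {v : ℂ ⊗[ℚ] V} (hv : ∀ y, LinearMap.BilinForm.baseChange ℂ Q v y = 0) : v = 0 := by
  by_contra hne
  have := (h.isPolarization.second v hne).1
  rw [hv] at this
  simp at this

theorem IsAlgebraicCircle.isRealPoint (h : IsAlgebraicCircle φ) (z : Circle) :
    IsRealPoint (φ z) := by
  intro i j
  obtain ⟨p, hp⟩ := h i j
  rw [hp, Complex.ofReal_im]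

theorem circleI_mul_circleI : circleI * circleI = -1 := by
  rw [circleI, ← Circle.exp_add, add_halves, circle_exp_pi]

theorem repr_baseChange_apply {ι : Type*} (B : Module.Basis ι ℚ V) (x : ℂ ⊗[ℚ] V) (i : ι) :
    (B.baseChange ℂ).repr x i = extend (B.coord i) x := by
  have : (B.baseChange ℂ).coord i = extend (B.coord i) := by
    refine (B.baseChange ℂ).ext fun j => ?_
    simp [extend, Module.Basis.baseChange_apply]
  exact LinearMap.congr_fun this x

variable [FiniteDimensional ℚ V]

theorem eq_of_forall_extend_eq {x y : ℂ ⊗[ℚ] V} (h : ∀ l : Module.Dual ℚ V,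
    extend l x = extend l y) : x = y := by
  let B := Module.finBasis ℚ V
  refine (B.baseChange ℂ).ext_elem fun i => ?_
  rw [repr_baseChange_apply, repr_baseChange_apply, h]

theorem mem_realPoints_of_conj_eq {x : ℂ ⊗[ℚ] V} (hx : conj V x = x) : x ∈ realPoints V := by
  let B := Module.finBasis ℚ V
  have h1 : ∀ x : ℂ ⊗[ℚ] V, x = ∑ i, extend (B.coord i) x • ((1 : ℂ) ⊗ₜ B i) := by
    intro x
    refine (B.baseChange ℂ).ext_elem fun j => ?_
    simp [← Module.Basis.baseChange_apply, repr_baseChange_apply, Finsupp.single_apply]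
  rw [h1 x]
  refine Submodule.sum_mem _ fun i _ => ?_
  have h2 := extend_conj (B.coord i) x
  rw [hx] at h2
  obtain ⟨r, hr⟩ := Complex.conj_eq_iff_real.1 h2.symm
  rw [hr]
  have : (r : ℂ) • ((1 : ℂ) ⊗ₜ[ℚ] B i) = r • ((1 : ℂ) ⊗ₜ[ℚ] B i) := algebraMap_smul ℂ r _
  rw [this]
  exact Submodule.smul_mem _ _ (Submodule.subset_span ⟨_, rfl⟩)

theorem mem_realPoints_iff {x : ℂ ⊗[ℚ] V} : x ∈ realPoints V ↔ conj V x = x :=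
  ⟨conj_eq_of_mem_realPoints, mem_realPoints_of_conj_eq⟩

/-- The real points of `G` act by operators that commute with complex conjugation. -/
theorem IsDefinedOverQ.apply_conj (h : IsDefinedOverQ ρ)
    {g : G} (hg : IsRealPoint g) (x : ℂ ⊗[ℚ] V) : ρ g (conj V x) = conj V (ρ g x) := by
  have hent : ∀ ij, starRingEnd ℂ (entries (g : Matrix.GeneralLinearGroup (Fin N) ℂ) ij) =
      entries (g : Matrix.GeneralLinearGroup (Fin N) ℂ) ij :=
    fun ij => Complex.conj_eq_iff_im.2 (hg ij.1 ij.2)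
  have hdet : starRingEnd ℂ (Matrix.det ((g : Matrix.GeneralLinearGroup (Fin N) ℂ) :
      Matrix (Fin N) (Fin N) ℂ)) = Matrix.det ((g : Matrix.GeneralLinearGroup (Fin N) ℂ) :
      Matrix (Fin N) (Fin N) ℂ) := by
    rw [RingHom.map_det]
    congr 1
    ext i j
    exact hent (i, j)
  have hpol : ∀ p : MvPolynomial (Fin N × Fin N) ℚ, starRingEnd ℂ (MvPolynomial.aeval
      (entries (g : Matrix.GeneralLinearGroup (Fin N) ℂ)) p) = MvPolynomial.aeval
      (entries (g : Matrix.GeneralLinearGroup (Fin N) ℂ)) p := by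
    intro p
    induction p using MvPolynomial.induction_on with
    | C a => simp
    | add p q hp hq => rw [map_add, map_add, hp, hq]
    | mul_X p ij hp => rw [map_mul, map_mul, hp, MvPolynomial.aeval_X, hent]
  -- The rational coefficients of ρ take real values at a real point.
  have hone : ∀ v : V, conj V (ρ g (1 ⊗ₜ v)) = ρ g (1 ⊗ₜ v) := by
    intro v
    refine eq_of_forall_extend_eq fun l => ?_
    rw [extend_conj]
    obtain ⟨p, k, hp⟩ := h v l
    have h1 := hp g
    refine mul_right_cancel₀ (pow_ne_zero k (det_coe_ne_zero g)) ?_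
    rw [h1, ← hpol, ← h1, map_mul, map_pow, hdet]
  induction x using TensorProduct.induction_on with
  | zero => simp
  | tmul z v =>
    have : ∀ z : ℂ, z ⊗ₜ[ℚ] v = z • ((1 : ℂ) ⊗ₜ[ℚ] v) := fun z => by
      rw [TensorProduct.smul_tmul', smul_eq_mul, mul_one]
    rw [conj_tmul, this, map_smul, this z, map_smul, conj_smul, hone]
  | add x y hx hy => rw [map_add, map_add, hx, hy, map_add, map_add]

/-- The values of an invariant real form on `(v, C v̄)`, for the Weil operator `C`, are real. -/
theorem IsHodgeRepresentation.conj_apply_weil (h : IsHodgeRepresentation n Q ρ φ)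
    (B : LinearMap.BilinForm ℂ (ℂ ⊗[ℚ] V))
    (hinv : ∀ g, IsRealPoint g → ∀ x y, B (ρ g x) (ρ g y) = B x y)
    (hpar : ∀ x y, B x y = (-1 : ℂ) ^ n * B y x)
    (hreal : ∀ x y, B (conj V x) (conj V y) = starRingEnd ℂ (B x y)) (v : ℂ ⊗[ℚ] V) :
    starRingEnd ℂ (B v (ρ (φ circleI) (conj V v))) = B v (ρ (φ circleI) (conj V v)) := by
  have hC := fun x => h.isDefinedOverQ.apply_conj (h.isAlgebraicCircle.isRealPoint circleI) x
  have hCC : ∀ x, ρ (φ circleI) (ρ (φ circleI) x) = ((-1 : ℂ) ^ n) • x := by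
    intro x
    rw [← Module.End.mul_apply, ← map_mul, ← map_mul, circleI_mul_circleI]
    exact h.isHodgeStructure.weight x
  -- The sign in C² = (-1)^n and the sign from the symmetry of B cancel.
  rw [← hreal, hC, conj_conj, ← hinv _ (h.isAlgebraicCircle.isRealPoint circleI) (conj V v), hCC, map_smul, smul_eq_mul,
    hpar v, ← hC]

/-- The pair is an eigenvalue and an eigenvector of the endomorphism Q'⁻¹ B. -/
theorem exists_apply_eq_mul {Q' B : LinearMap.BilinForm ℂ (ℂ ⊗[ℚ] V)} [Nontrivial V]
    (hQ : ∀ v, (∀ y, Q' v y = 0) → v = 0) :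
    ∃ (c : ℂ) (v : ℂ ⊗[ℚ] V), v ≠ 0 ∧ ∀ y, B v y = c * Q' v y := by
  have hinj : Function.Injective Q' := by
    rw [← LinearMap.ker_eq_bot, LinearMap.ker_eq_bot']
    exact fun v hv => hQ v fun y => by rw [hv]; rfl
  let e := LinearEquiv.ofInjectiveOfFinrankEq Q' hinj (Subspace.dual_finrank_eq).symm
  obtain ⟨c, hc⟩ := Module.End.exists_eigenvalue (e.symm.toLinearMap ∘ₗ B)
  obtain ⟨v, hv⟩ := hc.exists_hasEigenvector
  refine ⟨c, v, hv.2, fun y => ?_⟩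
  have h1 : B v = e (c • v) := by
    rw [← hv.apply_eq_smul]; simp
  rw [h1, map_smul, LinearMap.smul_apply, smul_eq_mul]
  rfl

/-- An invariant real form with the symmetry of the polarization is a multiple of it. -/
theorem IsHodgeRepresentation.eq_mul_of_real (h : IsHodgeRepresentation n Q ρ φ)
    (hirr : IsRealIrreducible ρ)
    (B : LinearMap.BilinForm ℂ (ℂ ⊗[ℚ] V))
    (hinv : ∀ g, IsRealPoint g → ∀ x y, B (ρ g x) (ρ g y) = B x y)
    (hpar : ∀ x y, B x y = (-1 : ℂ) ^ n * B y x)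
    (hreal : ∀ x y, B (conj V x) (conj V y) = starRingEnd ℂ (B x y)) :
    ∃ c : ℂ, ∀ x y, B x y = c * LinearMap.BilinForm.baseChange ℂ Q x y := by
  have := hirr.1
  set Q' := LinearMap.BilinForm.baseChange ℂ Q with hQ'
  obtain ⟨c, v, hv0, hv⟩ := exists_apply_eq_mul (B := B) (Q' := Q')
    fun v hv => h.eq_zero_of_forall hv
  refine ⟨c, ?_⟩
  -- B(v, C v̄) and Q(v, C v̄) are both real, and the latter is nonzero by positivity.
  have hcr : starRingEnd ℂ c = c := by
    have h1 := h.conj_apply_weil B hinv hpar hreal v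
    have h2 := h.conj_apply_weil Q' (fun g _ => h.preserves g)
      (baseChange_parity h.isPolarization.parity)
      (baseChange_conj Q) v
    have h3 : Q' v (ρ (φ circleI) (conj V v)) ≠ 0 := by
      intro h0
      have := (h.isPolarization.second v hv0).1
      have h0' : (LinearMap.BilinForm.baseChange ℂ Q v
        (inducedCircle ρ φ circleI (conj V v))) = 0 := h0
      rw [h0'] at this
      simp at this
    rw [hv, map_mul, h2] at h1
    exact mul_right_cancel₀ h3 h1
  -- The real vectors on which B agrees with c Q form a G(ℝ)-stable subspace, so irreducibility
  -- makes it everything once it is nonzero.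
  let W : Submodule ℝ (ℂ ⊗[ℚ] V) :=
    { carrier := {x | x ∈ realPoints V ∧ ∀ y, B x y = c * Q' x y}
      zero_mem' := ⟨Submodule.zero_mem _, by simp⟩
      add_mem' := fun hx hy => ⟨Submodule.add_mem _ hx.1 hy.1, fun y => by
        rw [map_add, map_add, LinearMap.add_apply, LinearMap.add_apply, hx.2, hy.2, mul_add]⟩
      smul_mem' := fun a x hx => ⟨Submodule.smul_mem _ _ hx.1, fun y => by
        have h1 : a • x = (a : ℂ) • x := (algebraMap_smul ℂ a x).symm
        rw [h1, map_smul, map_smul, LinearMap.smul_apply, LinearMap.smul_apply, hx.2, smul_eq_mul,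
          smul_eq_mul]
        ring⟩ }
  have hconj : ∀ y, B (conj V v) y = c * Q' (conj V v) y := by
    intro y
    rw [← conj_conj y, hreal, hv, map_mul, hcr, hQ', baseChange_conj]
  have hmem : ∀ a : ℂ, a • v + conj V (a • v) ∈ W := by
    intro a
    refine ⟨mem_realPoints_of_conj_eq (by rw [map_add, conj_conj, add_comm]), fun y => ?_⟩
    rw [conj_smul]
    simp only [map_add, map_smul, LinearMap.add_apply, LinearMap.smul_apply, hv, hconj, smul_eq_mul]
    ring
  have hW : W = realPoints V := by
    refine (hirr.2 W (fun x hx => hx.1) ?_).resolve_left fun hbot => ?_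
    · intro g hg w hw
      refine ⟨?_, fun y => ?_⟩
      · rw [mem_realPoints_iff, ← h.isDefinedOverQ.apply_conj hg, conj_eq_of_mem_realPoints hw.1]
      · have hy : y = ρ g (ρ g⁻¹ y) := by simp
        rw [hy, hinv g hg, hQ', h.preserves, hw.2]
    -- If v + v̄ and i(v - v̄) both vanished, so would v.
    · have h1 := hmem 1
      have h2 := hmem Complex.I
      rw [hbot, Submodule.mem_bot, conj_smul] at h1 h2
      rw [map_one, one_smul, one_smul] at h1
      rw [Complex.conj_I, neg_smul, ← sub_eq_add_neg, ← smul_sub, smul_eq_zero,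
        or_iff_right Complex.I_ne_zero, sub_eq_zero] at h2
      rw [← h2, ← two_smul ℂ, smul_eq_zero, or_iff_right two_ne_zero] at h1
      exact hv0 h1
  intro x y
  induction x using TensorProduct.induction_on with
  | zero => simp
  | tmul z w =>
    have h1 : (1 : ℂ) ⊗ₜ[ℚ] w ∈ W := hW ▸ Submodule.subset_span ⟨w, rfl⟩
    have h2 : z ⊗ₜ[ℚ] w = z • ((1 : ℂ) ⊗ₜ[ℚ] w) := by
      rw [TensorProduct.smul_tmul', smul_eq_mul, mul_one]
    rw [h2, map_smul, map_smul, LinearMap.smul_apply, LinearMap.smul_apply, h1.2, smul_eq_mul,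
      smul_eq_mul]
    ring
  | add x x' hx hx' =>
    rw [map_add, map_add, LinearMap.add_apply, LinearMap.add_apply, hx, hx', mul_add]

/-- A degenerate invariant form with the symmetry of the polarization is zero. -/
theorem IsHodgeRepresentation.eq_zero_of_degenerate (h : IsHodgeRepresentation n Q ρ φ)
    (hirr : IsRealIrreducible ρ)
    (B : LinearMap.BilinForm ℂ (ℂ ⊗[ℚ] V))
    (hinv : ∀ g, IsRealPoint g → ∀ x y, B (ρ g x) (ρ g y) = B x y)
    (hpar : ∀ x y, B x y = (-1 : ℂ) ^ n * B y x) {v : ℂ ⊗[ℚ] V} (hv : v ≠ 0)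
    (hBv : ∀ y, B v y = 0) : B = 0 := by
  have hneg : ∀ z : ℂ, starRingEnd ℂ ((-1 : ℂ) ^ n * z) = (-1 : ℂ) ^ n * starRingEnd ℂ z := by
    intro z
    rw [map_mul, map_zpow₀, map_neg, map_one]
  have hcinv : ∀ g, IsRealPoint g → ∀ x y, conjForm B (ρ g x) (ρ g y) = conjForm B x y := by
    intro g hg x y
    rw [conjForm_apply, conjForm_apply, ← h.isDefinedOverQ.apply_conj hg,
      ← h.isDefinedOverQ.apply_conj hg, hinv g hg]
  have hcpar : ∀ x y, conjForm B x y = (-1 : ℂ) ^ n * conjForm B y x := by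
    intro x y
    rw [conjForm_apply, conjForm_apply, hpar, hneg]
  -- B is recovered from the real forms B + B̄ and i(B - B̄). Both are multiples of Q, so B is one
  -- too, with a complex factor that the degenerate vector forces to be zero.
  obtain ⟨c, hc⟩ := h.eq_mul_of_real hirr (B + conjForm B)
    (fun g hg x y => by
      simp only [LinearMap.add_apply, hinv g hg, hcinv g hg])
    (fun x y => by
      simp only [LinearMap.add_apply]
      rw [hpar, hcpar]
      ring)
    (fun x y => by
      simp only [LinearMap.add_apply, conjForm_apply, conj_conj, map_add, Complex.conj_conj]
      ring)
  obtain ⟨d, hd⟩ := h.eq_mul_of_real hirr (Complex.I • (B - conjForm B))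
    (fun g hg x y => by
      simp only [LinearMap.smul_apply, LinearMap.sub_apply, hinv g hg, hcinv g hg])
    (fun x y => by
      simp only [LinearMap.smul_apply, LinearMap.sub_apply, smul_eq_mul]
      rw [hpar, hcpar]
      ring)
    (fun x y => by
      simp only [LinearMap.smul_apply, LinearMap.sub_apply, smul_eq_mul, conjForm_apply, conj_conj,
        map_sub, map_mul, Complex.conj_conj, Complex.conj_I]
      ring)
  have hB : ∀ x y, 2 * B x y =
      (c - Complex.I * d) * LinearMap.BilinForm.baseChange ℂ Q x y := by
    intro x y
    have h1 := hc x y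
    have h2 := hd x y
    simp only [LinearMap.smul_apply, LinearMap.sub_apply, smul_eq_mul, LinearMap.add_apply] at h1 h2
    linear_combination h1 - Complex.I * h2 + (B x y - conjForm B x y) * Complex.I_mul_I
  have hcd : c - Complex.I * d = 0 := by
    by_contra hne
    refine hv (h.eq_zero_of_forall fun y => ?_)
    have h1 := hB v y
    rw [hBv, mul_zero] at h1
    exact (mul_eq_zero.1 h1.symm).resolve_left hne
  refine LinearMap.ext₂ fun x y => ?_
  have h1 := hB x y
  rw [hcd, zero_mul] at h1
  exact (mul_eq_zero.1 h1).resolve_left two_ne_zero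

end Conjugation

/-! ### The parity of the associated representation -/

section Types

open LieAlgebra LieAlgebra.IsKilling

variable {N : ℕ} {G : Subgroup (Matrix.GeneralLinearGroup (Fin N) ℂ)}
  {U U' : Type*} [AddCommGroup U] [Module ℂ U] [AddCommGroup U'] [Module ℂ U']
  {τ : Representation ℂ G U} {τ' : Representation ℂ G U'}

theorem nonempty_equiv_iff : Nonempty (τ.Equiv τ') ↔
    ∃ F : U ≃ₗ[ℂ] U', ∀ g u, F (τ g u) = τ' g (F u) :=
  ⟨fun ⟨e⟩ => ⟨e.toLinearEquiv, fun g u => LinearMap.congr_fun (e.isIntertwining' g) u⟩,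
    fun ⟨F, hF⟩ => ⟨Representation.Equiv.mk F fun g => LinearMap.ext (hF g)⟩⟩

theorem dual_apply_apply (g : G) (ξ : Module.Dual ℂ U) (u : U) :
    τ.dual g ξ u = ξ (τ g⁻¹ u) := rfl

theorem apply_inv_apply (g : G) (u : U) : τ g (τ g⁻¹ u) = u := by
  rw [← Module.End.mul_apply, ← map_mul, mul_inv_cancel, map_one, Module.End.one_apply]

theorem map_dual_iff (F : U →ₗ[ℂ] Module.Dual ℂ U) :
    (∀ g u, F (τ g u) = τ.dual g (F u)) ↔ ∀ g u v, F (τ g u) (τ g v) = F u v := by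
  constructor
  · intro h g u v
    rw [h, dual_apply_apply, ← Module.End.mul_apply, ← map_mul, inv_mul_cancel, map_one,
      Module.End.one_apply]
  · intro h g u
    ext v
    rw [dual_apply_apply, ← h g u, apply_inv_apply]

/-- A nonzero invariant bilinear form on an irreducible representation is nondegenerate. -/
theorem injective_of_isIrreducible (h : τ.IsIrreducible) {F : U →ₗ[ℂ] Module.Dual ℂ U}
    (hF : ∀ g u v, F (τ g u) (τ g v) = F u v) (hne : F ≠ 0) : Function.Injective F := by
  rw [← LinearMap.ker_eq_bot]
  refine (eq_bot_or_eq_top_of_isIrreducible h _ fun g u hu => ?_).resolve_right fun htop =>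
    hne (LinearMap.ker_eq_top.1 htop)
  rw [LinearMap.mem_ker] at hu ⊢
  rw [(map_dual_iff F).2 hF, hu, map_zero]

/-- A selfdual irreducible representation has a symmetric or an alternating form. -/
theorem exists_form_of_isIrreducible (h : τ.IsIrreducible) {F : U →ₗ[ℂ] Module.Dual ℂ U}
    (hF : ∀ g u v, F (τ g u) (τ g v) = F u v) (hne : F ≠ 0) :
    ∃ (B : U →ₗ[ℂ] Module.Dual ℂ U) (ε : ℂ), (ε = 1 ∨ ε = -1) ∧
      (∀ g u v, B (τ g u) (τ g v) = B u v) ∧ Function.Injective B ∧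
      ∀ u v, B u v = ε * B v u := by
  -- Either F is alternating, or its symmetrization is a nonzero invariant form, which is
  -- nondegenerate by irreducibility.
  by_cases h0 : F + F.flip = 0
  · refine ⟨F, -1, Or.inr rfl, hF, injective_of_isIrreducible h hF hne, fun u v => ?_⟩
    have := LinearMap.congr_fun (LinearMap.congr_fun h0 u) v
    rw [LinearMap.add_apply, LinearMap.add_apply, LinearMap.flip_apply] at this
    rw [neg_one_mul]
    exact eq_neg_of_add_eq_zero_left this
  · have hinv : ∀ g u v, (F + F.flip) (τ g u) (τ g v) = (F + F.flip) u v := by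
      intro g u v
      simp only [LinearMap.add_apply, LinearMap.flip_apply, hF]
    refine ⟨F + F.flip, 1, Or.inl rfl, hinv, injective_of_isIrreducible h hinv h0, fun u v => ?_⟩
    simp only [LinearMap.add_apply, LinearMap.flip_apply]
    ring

variable {V : Type*} [AddCommGroup V] [Module ℚ V] {ρ : Representation ℂ G (ℂ ⊗[ℚ] V)}
  {φ : Circle →* G} {n : ℤ} {Q : LinearMap.BilinForm ℚ V}

/-- U is a direct summand of V_ℂ in both cases, which transfers algebraicity and the action of φ(-1)
without a case distinction. -/
theorem IsAssociated.exists_retract (h : IsAssociated ρ τ) :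
    ∃ (j : U →ₗ[ℂ] ℂ ⊗[ℚ] V) (r : (ℂ ⊗[ℚ] V) →ₗ[ℂ] U), (∀ g u, τ g u = r (ρ g (j u))) ∧
      ∀ u, r (j u) = u := by
  rcases h.2 with h | h
  · obtain ⟨F, hF⟩ := nonempty_equiv_iff.1 h
    exact ⟨F.symm, F, fun g u => by simp [hF], fun u => by simp⟩
  · obtain ⟨F, hF⟩ := nonempty_equiv_iff.1 h
    refine ⟨F.symm.toLinearMap ∘ₗ LinearMap.inl ℂ U (Module.Dual ℂ U),
      LinearMap.fst ℂ U (Module.Dual ℂ U) ∘ₗ F.toLinearMap, fun g u => ?_, fun u => by simp⟩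
    simp only [LinearMap.comp_apply, LinearEquiv.coe_coe, hF, LinearEquiv.apply_symm_apply]
    rfl

theorem IsAssociated.circle_neg_one_apply (h : IsAssociated ρ τ)
    (hH : IsHodgeRepresentation n Q ρ φ) (u : U) : τ (φ (-1)) u = ((-1 : ℂ) ^ n) • u := by
  obtain ⟨j, r, hjr, hrj⟩ := h.exists_retract
  have h1 : ρ (φ (-1)) (j u) = ((-1 : ℂ) ^ n) • j u := hH.isHodgeStructure.weight (j u)
  rw [hjr, h1, map_smul, hrj]

theorem dual_circle_neg_one_apply (h : ∀ u, τ (φ (-1)) u = ((-1 : ℂ) ^ n) • u)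
    (ξ : Module.Dual ℂ U) : τ.dual (φ (-1)) ξ = ((-1 : ℂ) ^ n) • ξ := by
  have h1 : (φ (-1))⁻¹ = φ (-1) := by
    rw [← map_inv]
    congr 1
    ext
    simp
  ext u
  rw [dual_apply_apply, h1, h, map_smul, LinearMap.smul_apply]

/-- A real representation carries an invariant form with the symmetry of the polarization. -/
theorem IsHodgeRepresentation.exists_form_of_isRealType (hH : IsHodgeRepresentation n Q ρ φ)
    (h : IsRealType ρ τ) : ∃ F : U →ₗ[ℂ] Module.Dual ℂ U,
      (∀ g u v, F (τ g u) (τ g v) = F u v) ∧ Function.Injective F ∧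
      ∀ u v, F u v = (-1 : ℂ) ^ n * F v u := by
  obtain ⟨e, he⟩ := nonempty_equiv_iff.1 h
  have hsymm : ∀ g u, e.symm (τ g u) = ρ g (e.symm u) := fun g u => by
    rw [LinearEquiv.symm_apply_eq, he, LinearEquiv.apply_symm_apply]
  refine ⟨(LinearMap.BilinForm.baseChange ℂ Q).compl₁₂ e.symm.toLinearMap e.symm.toLinearMap,
    fun g u v => ?_, ?_, fun u v => baseChange_parity hH.isPolarization.parity _ _⟩
  · simp only [LinearMap.compl₁₂_apply, LinearEquiv.coe_coe, hsymm, hH.preserves]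
  · rw [← LinearMap.ker_eq_bot, LinearMap.ker_eq_bot']
    intro u hu
    rw [← e.symm.map_eq_zero_iff]
    refine hH.eq_zero_of_forall fun y => ?_
    have := LinearMap.congr_fun hu (e y)
    rwa [LinearMap.compl₁₂_apply, LinearEquiv.coe_coe,
      LinearEquiv.symm_apply_apply, LinearMap.zero_apply] at this

/-- If `V_ℂ ≃ U ⊕ U*`, then `U` has no invariant form with the symmetry of the polarization. -/
theorem IsHodgeRepresentation.form_eq_zero [FiniteDimensional ℚ V] [FiniteDimensional ℂ U]
    (hH : IsHodgeRepresentation n Q ρ φ) (hirr : IsRealIrreducible ρ) (h : IsSumWithDual ρ τ)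
    [Nontrivial U] (F : U →ₗ[ℂ] Module.Dual ℂ U) (hF : ∀ g u v, F (τ g u) (τ g v) = F u v)
    (hpar : ∀ u v, F u v = (-1 : ℂ) ^ n * F v u) : F = 0 := by
  obtain ⟨e, he⟩ := nonempty_equiv_iff.1 h
  -- The pullback of F along this projection has the nonzero summand U* in its radical.
  let p : (ℂ ⊗[ℚ] V) →ₗ[ℂ] U := LinearMap.fst ℂ U (Module.Dual ℂ U) ∘ₗ e.toLinearMap
  have hp : ∀ g x, p (ρ g x) = τ g (p x) := fun g x => by
    simp only [p, LinearMap.comp_apply, LinearEquiv.coe_coe, he]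
    rfl
  obtain ⟨ξ, hξ⟩ := exists_ne (0 : Module.Dual ℂ U)
  have hpξ : p (e.symm (0, ξ)) = 0 := by simp [p]
  have hB := hH.eq_zero_of_degenerate hirr (F.compl₁₂ p p)
    (fun g _ x y => by simp only [LinearMap.compl₁₂_apply, hp, hF])
    (fun x y => hpar _ _) (v := e.symm (0, ξ))
    (by rw [ne_eq, LinearEquiv.map_eq_zero_iff, Prod.mk_eq_zero, not_and]; exact fun _ => hξ)
    (fun y => by rw [LinearMap.compl₁₂_apply, hpξ, map_zero, LinearMap.zero_apply])
  refine LinearMap.ext₂ fun u v => ?_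
  have := LinearMap.congr_fun (LinearMap.congr_fun hB (e.symm (u, 0))) (e.symm (v, 0))
  simpa [p] using this

end Types

/-! ### Half-integrality and comparison of signs -/

section Parity

open LieAlgebra LieAlgebra.IsKilling

theorem exists_int_of_exp_eq {c d : ℂ} (h : Complex.exp (2 * Real.pi * Complex.I * c) =
    Complex.exp (2 * Real.pi * Complex.I * d)) : ∃ k : ℤ, c - d = k := by
  obtain ⟨k, hk⟩ := Complex.exp_eq_exp_iff_exists_int.1 h
  refine ⟨k, mul_left_cancel₀ Complex.two_pi_I_ne_zero ?_⟩
  linear_combination hk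

/-- A sign is its own inverse, so c and -c have the same exponential and 2c is an integer. -/
theorem exists_half_int_of_exp_eq {c : ℂ} {n : ℤ}
    (h : Complex.exp (2 * Real.pi * Complex.I * c) = (-1) ^ n) : ∃ k : ℤ, c = k / 2 := by
  obtain ⟨k, hk⟩ := exists_int_of_exp_eq (c := c) (d := -c) (by
    rw [mul_neg, Complex.exp_neg, h]
    rcases Int.even_or_odd n with hn | hn
    · simp [hn.neg_one_zpow]
    · simp [hn.neg_one_zpow])
  exact ⟨k, by rw [← hk]; ring⟩

-- Here x is a half-integer. Modulo ℤ, x - n x is x for n even and 0 for n odd; for non-integral n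
-- the hypothesis gives x = 0.
open Classical in
theorem exists_sub_mul_eq_ite_add {x : ℂ} {k : ℕ} (hk : 2 * x = k) {n : ℝ}
    (hn : (∃ z : ℤ, n = z) ∨ x = 0) :
    ∃ z : ℤ, x - n * x = (if ∃ k : ℤ, n = 2 * k then x else 0) + z := by
  rcases hn with ⟨z, rfl⟩ | rfl
  · rcases Int.even_or_odd' z with ⟨j, rfl | rfl⟩
    · rw [if_pos ⟨j, by push_cast; ring⟩]
      refine ⟨-(j * k), ?_⟩
      push_cast
      linear_combination -(j : ℂ) * hk
    · rw [if_neg]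
      · refine ⟨-(j * k), ?_⟩
        push_cast
        linear_combination -(j : ℂ) * hk
      · rintro ⟨m, hm⟩
        have : 2 * j + 1 = 2 * m := by exact_mod_cast hm
        omega
  · exact ⟨0, by simp⟩

variable {N : ℕ} {G : Subgroup (Matrix.GeneralLinearGroup (Fin N) ℂ)} [IsSemisimpleOverQ G]
  {H : LieSubalgebra ℂ (lieAlg G)} [H.IsCartanSubalgebra] {b : (rootSystem H).Base}

theorem root_sum_smul_dualBasis (c : b.support → ℂ) (i : b.support) :
    (rootSystem H).root i (∑ j, c j • dualBasis b j) = c i := by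
  rw [map_sum, Finset.sum_eq_single i]
  · rw [map_smul, root_dualBasis, if_pos rfl, smul_eq_mul, mul_one]
  · intro j _ hj
    rw [map_smul, root_dualBasis, if_neg hj.symm, smul_zero]
  · exact fun h => absurd (Finset.mem_univ i) h

theorem rootSum_apply_dualBasis (k : b.support → ℕ) (i : b.support) :
    rootSum b k (dualBasis b i) = k i := by
  rw [rootSum_apply, Finset.sum_eq_single i]
  · rw [root_dualBasis, if_pos rfl, mul_one]
  · intro j _ hj
    rw [root_dualBasis, if_neg hj, mul_zero]
  · exact fun h => absurd (Finset.mem_univ i) h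

/-- The sum of the `μ(T_i)` with `n_i` even measures the difference of two parities. -/
theorem exists_sub_eq_evenSum_add {μ : Module.Dual ℂ H} {n : b.support → ℝ} {k : b.support → ℕ}
    (hμ : (2 : ℂ) • μ = rootSum b k)
    (hn : ∀ i, (∃ z : ℤ, n i = z) ∨ μ (dualBasis b i) = 0) :
    ∃ z : ℤ, μ (∑ i, dualBasis b i) - μ (∑ i, (n i : ℂ) • dualBasis b i) =
      evenSum b n μ + z := by
  have hk : ∀ i, 2 * μ (dualBasis b i) = k i := by
    intro i
    rw [← rootSum_apply_dualBasis, ← hμ, LinearMap.smul_apply, smul_eq_mul]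
  choose z hz using fun i => exists_sub_mul_eq_ite_add (hk i) (hn i)
  refine ⟨∑ i, z i, ?_⟩
  simp only [map_sum, map_smul, smul_eq_mul]
  rw [← Finset.sum_sub_distrib, Finset.sum_congr rfl fun i _ => hz i, Finset.sum_add_distrib,
    Int.cast_sum]
  rfl

/-- The signs are e^{2πi μ(P)} and e^{2πi μ(T)}, so they agree exactly when μ(P) - μ(T) is an
integer. -/
theorem parity_eq_iff {μ : Module.Dual ℂ H} {n : b.support → ℝ} {k : b.support → ℕ}
    (hμ : (2 : ℂ) • μ = rootSum b k)
    (hn : ∀ i, (∃ z : ℤ, n i = z) ∨ μ (dualBasis b i) = 0) {w : ℤ}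
    (hw : Complex.exp (2 * Real.pi * Complex.I * μ (∑ i, (n i : ℂ) • dualBasis b i)) = (-1) ^ w)
    {M : ℕ} (hM : 2 * μ (∑ i, dualBasis b i) = M) :
    (-1 : ℂ) ^ M = (-1) ^ w ↔ ∃ z : ℤ, evenSum b n μ = z := by
  obtain ⟨z, hz⟩ := exists_sub_eq_evenSum_add hμ hn
  have hM' : Complex.exp (2 * Real.pi * Complex.I * μ (∑ i, dualBasis b i)) = (-1) ^ M := by
    rw [← Complex.exp_pi_mul_I, ← Complex.exp_nat_mul, ← hM]
    congr 1
    ring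
  rw [← hw, ← hM']
  constructor
  · intro h
    obtain ⟨z', hz'⟩ := exists_int_of_exp_eq h
    exact ⟨z' - z, by push_cast; rw [← hz', hz]; ring⟩
  · rintro ⟨z', hz'⟩
    rw [Complex.exp_eq_exp_iff_exists_int]
    refine ⟨z' + z, ?_⟩
    rw [hz'] at hz
    push_cast
    linear_combination (2 * Real.pi * Complex.I) * hz

end Parity

/-! ### Extreme eigenvalues of the grading element -/

section Eigenvalues

open LieAlgebra LieAlgebra.IsKilling

variable {𝔤 : Type*} [LieRing 𝔤] [LieAlgebra ℂ 𝔤] [FiniteDimensional ℂ 𝔤] [IsKilling ℂ 𝔤]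
  {H : LieSubalgebra ℂ 𝔤} [H.IsCartanSubalgebra] {b : (rootSystem H).Base}
  {U : Type*} [AddCommGroup U] [Module ℂ U] {L : 𝔤 →ₗ⁅ℂ⁆ Module.End ℂ U}
  {T : H} {n : b.support → ℝ} {μ : Module.Dual ℂ H} {u : U} {w : (rootSystem H).weylGroup}

theorem re_rootSum_nonneg (hn : ∀ i, 0 ≤ n i)
    (hT : ∀ i : b.support, (rootSystem H).root i T = n i) (m : b.support → ℕ) :
    0 ≤ (rootSum b m T).re := by
  rw [rootSum_apply_real b m hT, Complex.ofReal_re]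
  exact Finset.sum_nonneg fun i _ => mul_nonneg (Nat.cast_nonneg _) (hn i)

/-- The largest eigenvalue of a grading element is the value of the highest weight. -/
theorem re_eigenvalue_le (hu : IsHighestWeightVector b L μ u) (htop : wordSpan b L u = ⊤)
    (hn : ∀ i, 0 ≤ n i) (hT : ∀ i : b.support, (rootSystem H).root i T = n i)
    {c : ℂ} (hc : (L T).HasEigenvalue c) : c.re ≤ (μ T).re := by
  obtain ⟨v, hv⟩ := hc.exists_hasEigenvector
  obtain ⟨m, -, -, -, hm⟩ := exists_word_of_eigenvector hu.hasWeight htop hv.2 hv.apply_eq_smul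
  rw [← hm, LinearMap.sub_apply, Complex.sub_re, sub_le_self_iff]
  exact re_rootSum_nonneg hn hT m

variable [FiniteDimensional ℂ U]

/-- An eigenform of eigenvalue c pairs nontrivially with a vector of eigenvalue -c, whose weight is
wμ plus simple roots. -/
theorem re_eigenvalue_dual_le (hu : IsHighestWeightVector b L μ u) (htop : wordSpan b L u = ⊤)
    (hw : ∀ i, b.IsPos i → ¬ b.IsPos (w • i))
    (hn : ∀ i, 0 ≤ n i) (hT : ∀ i : b.support, (rootSystem H).root i T = n i)
    {c : ℂ} (hc : (dualLie L T).HasEigenvalue c) : c.re ≤ ((-(w • μ)) T).re := by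
  obtain ⟨ξ, hξ⟩ := hc.exists_hasEigenvector
  obtain ⟨m, v, hv, hne⟩ := exists_word_apply_ne_zero htop hξ.2
  have h1 := hv.apply_eq_neg hu.hasWeight hne hξ.apply_eq_smul
  obtain ⟨m', hm'⟩ := exists_eq_add_rootSum_of_longest hu.hasWeight htop hw
    (fun h => hne (by rw [h, map_zero])) (hv.hasWeight hu.hasWeight)
  rw [hm'] at h1
  have h2 := congrArg Complex.re h1
  have h3 := re_rootSum_nonneg hn hT m'
  rw [LinearMap.add_apply, Complex.add_re, Complex.neg_re] at h2
  rw [LinearMap.neg_apply, Complex.neg_re]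
  have h4 : ∀ x y r : ℝ, x + r = -y → 0 ≤ r → y ≤ -x := fun x y r h h' => by linarith
  exact h4 _ _ _ h2 h3

theorem exists_smul_eq_sub_rootSum (hu : IsHighestWeightVector b L μ u)
    (htop : wordSpan b L u = ⊤) (w : (rootSystem H).weylGroup) :
    ∃ k, w • μ = μ - rootSum b k := by
  obtain ⟨v, hv, hvw⟩ := exists_hasWeight_weylGroup w hu.ne_zero hu.hasWeight
  obtain ⟨k, -, hk⟩ := exists_eq_sub_rootSum hu.hasWeight htop hv hvw
  exact ⟨k, hk⟩

/-- μ - wμ is a sum of simple roots. Hence the larger of μ(T) and μ*(T) is nonnegative, as required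
of the index m. -/
theorem re_neg_smul_add_nonneg (hu : IsHighestWeightVector b L μ u)
    (htop : wordSpan b L u = ⊤) (w : (rootSystem H).weylGroup) (hn : ∀ i, 0 ≤ n i)
    (hT : ∀ i : b.support, (rootSystem H).root i T = n i) :
    0 ≤ ((-(w • μ)) T).re + (μ T).re := by
  obtain ⟨k, hk⟩ := exists_smul_eq_sub_rootSum hu htop w
  have h1 : (-(w • μ)) T + μ T = rootSum b k T := by
    rw [hk, LinearMap.neg_apply, LinearMap.sub_apply]
    ring
  rw [← Complex.add_re, h1]
  exact re_rootSum_nonneg hn hT k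

end Eigenvalues

/-! ### Highest weights of the associated representation -/

section Associated

open LieAlgebra LieAlgebra.IsKilling

variable {N : ℕ} {G : Subgroup (Matrix.GeneralLinearGroup (Fin N) ℂ)} [IsSemisimpleOverQ G]
  {V : Type*} [AddCommGroup V] [Module ℚ V]
  {ρ : Representation ℂ G (ℂ ⊗[ℚ] V)} {φ : Circle →* G} {d : ℤ} {Q : LinearMap.BilinForm ℚ V}
  {U : Type*} [AddCommGroup U] [Module ℂ U]
  {τ : Representation ℂ G U} {L : lieAlg G →ₗ⁅ℂ⁆ Module.End ℂ U}
  {H : LieSubalgebra ℂ (lieAlg G)} [H.IsCartanSubalgebra] {b : (rootSystem H).Base}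
  {T : H} {n : b.support → ℝ} {μ : Module.Dual ℂ H} {u : U} {w : (rootSystem H).weylGroup}

theorem HasDifferential.exp_eigenvalue (h : HasDifferential τ L) (hφ : IsAlgebraicCircle φ)
    {T : lieAlg G} (hT : (T : Matrix (Fin N) (Fin N) ℂ) = gradingMatrix φ)
    (hneg : ∀ u, τ (φ (-1)) u = ((-1 : ℂ) ^ d) • u) {c : ℂ} {v : U} (hv0 : v ≠ 0)
    (hv : L T v = c • v) : Complex.exp (2 * Real.pi * Complex.I * c) = (-1) ^ d :=
  smul_left_injective ℂ hv0 ((h.circle_neg_one_apply hφ hT hv).symm.trans (hneg v))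

variable [FiniteDimensional ℂ U]

theorem IsHighestWeight.exists_differential [FiniteDimensional ℚ V] (hρ : IsDefinedOverQ ρ)
    (hU : IsAssociated ρ τ) (hμ : IsHighestWeight b τ μ) :
    ∃ (L : lieAlg G →ₗ⁅ℂ⁆ Module.End ℂ U) (u : U), HasDifferential τ L ∧ IsAlgebraicRep τ ∧
      IsHighestWeightVector b L μ u ∧ wordSpan b L u = ⊤ := by
  refine hU.exists_retract.elim fun j ⟨r, hjr, _⟩ => ?_
  have hτ := hρ.isAlgebraicRep.of_retract j r hjr
  refine (HodgeCY.exists_differential hτ).elim fun L hL => ?_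
  refine (hμ.exists_isHighestWeightVector hL).elim fun u hu => ?_
  exact ⟨L, u, hL, hτ, hu, hu.wordSpan_eq_top (hL.isIrreducibleLie hτ hU.1)⟩

theorem eq_neg_smul_of_form (hL : HasDifferential τ L) (hu : IsHighestWeightVector b L μ u)
    (htop : wordSpan b L u = ⊤) (hw : IsLongest b w) {F : U →ₗ[ℂ] Module.Dual ℂ U}
    (hF : ∀ g u v, F (τ g u) (τ g v) = F u v) (hinj : Function.Injective F) : μ = -(w • μ) :=
  eq_neg_smul_of_injective_dual hu htop hw F
    (hL.map_apply hL.dual F ((map_dual_iff F).2 hF)) hinj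

/-- U and U* then have the same highest weight and dimension, so they are isomorphic. -/
theorem exists_form_of_eq_neg_smul (hL : HasDifferential τ L) (hτ : IsAlgebraicRep τ)
    (hirr : IsIrreducibleLie L) (hu : IsHighestWeightVector b L μ u) (hw : IsLongest b w)
    (hμ : μ = -(w • μ)) : ∃ F : U →ₗ[ℂ] Module.Dual ℂ U,
      (∀ g u v, F (τ g u) (τ g v) = F u v) ∧ F ≠ 0 := by
  obtain ⟨ξ, hξ⟩ := exists_isHighestWeightVector_dual hu (hu.wordSpan_eq_top hirr) hw
  rw [← hμ] at hξ
  obtain ⟨F, hF⟩ := exists_equiv_of_highestWeight hirr hu hξ Subspace.dual_finrank_eq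
  refine ⟨F.toLinearMap, (map_dual_iff _).1 (hL.map_apply_of_lie hL.dual hτ hτ.dual _ hF), ?_⟩
  intro h0
  have : F u = 0 := LinearMap.congr_fun h0 u
  exact hu.ne_zero ((LinearEquiv.map_eq_zero_iff F).1 this)

theorem root_apply_sum_dualBasis (i : b.support) :
    (rootSystem H).root i (∑ j, dualBasis b j) = 1 := by
  have := root_sum_smul_dualBasis (fun _ => 1) i
  simpa only [one_smul] using this

/-- Selfduality gives 2μ = μ - wμ, a sum of simple roots, so the μ(T_i) are half-integers. The
scalar action of φ(-1) gives either n_i ∈ ℤ or μ(T_i) = 0. -/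
theorem parity_iff_of_eq_neg_smul (hL : HasDifferential τ L) (hφ : IsAlgebraicCircle φ)
    (hneg : ∀ u, τ (φ (-1)) u = ((-1 : ℂ) ^ d) • u)
    (hu : IsHighestWeightVector b L μ u) (htop : wordSpan b L u = ⊤)
    (hT : ((T : lieAlg G) : Matrix (Fin N) (Fin N) ℂ) = gradingMatrix φ)
    (hTn : T = ∑ i, (n i : ℂ) • dualBasis b i) (hμ : μ = -(w • μ))
    {M : ℕ} (hM : 2 * μ (∑ i, dualBasis b i) = M) :
    (-1 : ℂ) ^ M = (-1) ^ d ↔ ∃ z : ℤ, evenSum b n μ = z := by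
  obtain ⟨k, hk⟩ := exists_smul_eq_sub_rootSum hu htop w
  have h2 : (2 : ℂ) • μ = rootSum b k := by
    rw [eq_sub_iff_add_eq', ← eq_sub_iff_add_eq] at hk
    rw [hk, two_smul]
    nth_rewrite 2 [hμ]
    rw [sub_eq_add_neg]
  refine parity_eq_iff h2 (fun i => ?_) ?_ hM
  · have h3 := integral_or_apply_eq_zero hu htop (T := T) (fun c c' hc hc' => ?_) i
      (S := dualBasis b i) (fun j hj => by rw [root_dualBasis, if_neg hj])
    · refine h3.imp (fun ⟨z, hz⟩ => ⟨z, ?_⟩) id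
      rw [hTn, root_sum_smul_dualBasis] at hz
      exact_mod_cast hz
    · obtain ⟨v, hv⟩ := hc.exists_hasEigenvector
      obtain ⟨v', hv'⟩ := hc'.exists_hasEigenvector
      refine exists_int_of_exp_eq ?_
      rw [hL.exp_eigenvalue hφ hT hneg hv.2 hv.apply_eq_smul,
        hL.exp_eigenvalue hφ hT hneg hv'.2 hv'.apply_eq_smul]
  · rw [← hTn]
    exact hL.exp_eigenvalue hφ hT hneg hu.ne_zero (hu.hasWeight T)

theorem IsRealType.eq_neg_smul (h : IsRealType ρ τ) (hH : IsHodgeRepresentation d Q ρ φ)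
    (hL : HasDifferential τ L) (hu : IsHighestWeightVector b L μ u)
    (htop : wordSpan b L u = ⊤) (hw : IsLongest b w) : μ = -(w • μ) := by
  obtain ⟨F, hF, hinj, -⟩ := hH.exists_form_of_isRealType h
  exact eq_neg_smul_of_form hL hu htop hw hF hinj

/-- For real U, the form coming from Q has sign (-1)^d, which must equal the sign given by the
principal sl₂. Conversely, a selfdual U whose form has sign (-1)^d cannot occur in V_ℂ = U ⊕ U*, by
`IsHodgeRepresentation.form_eq_zero`. -/
theorem isRealType_iff [FiniteDimensional ℚ V] (hH : IsHodgeRepresentation d Q ρ φ) (hirr : IsRealIrreducible ρ)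
    (hU : IsAssociated ρ τ) (hL : HasDifferential τ L) (hτ : IsAlgebraicRep τ)
    (hu : IsHighestWeightVector b L μ u) (hw : IsLongest b w)
    (hT : ((T : lieAlg G) : Matrix (Fin N) (Fin N) ℂ) = gradingMatrix φ)
    (hTn : T = ∑ i, (n i : ℂ) • dualBasis b i) :
    IsRealType ρ τ ↔ μ = -(w • μ) ∧ ∃ k : ℤ, evenSum b n μ = k := by
  have hirrL := hL.isIrreducibleLie hτ hU.1
  have htop := hu.wordSpan_eq_top hirrL
  have hneg := hU.circle_neg_one_apply hH
  have hφ := hH.isAlgebraicCircle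
  constructor
  · intro h
    have hμ := h.eq_neg_smul hH hL hu htop hw
    refine ⟨hμ, ?_⟩
    obtain ⟨F, hF, hinj, hpar⟩ := hH.exists_form_of_isRealType h
    obtain ⟨M, hM, hε⟩ := sign_of_invariant_form hu htop root_apply_sum_dualBasis F
      (hL.map_apply hL.dual F ((map_dual_iff F).2 hF)) hinj hpar
    exact (parity_iff_of_eq_neg_smul hL hφ hneg hu htop hT hTn hμ hM).1 hε.symm
  · rintro ⟨hμ, hsum⟩
    refine hU.2.resolve_right fun hsd => ?_
    obtain ⟨F₀, hF₀, hne⟩ := exists_form_of_eq_neg_smul hL hτ hirrL hu hw hμ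
    obtain ⟨F, ε, -, hF, hinj, hpar⟩ := exists_form_of_isIrreducible hU.1 hF₀ hne
    obtain ⟨M, hM, hε⟩ := sign_of_invariant_form hu htop root_apply_sum_dualBasis F
      (hL.map_apply hL.dual F ((map_dual_iff F).2 hF)) hinj hpar
    rw [hε, (parity_iff_of_eq_neg_smul hL hφ hneg hu htop hT hTn hμ hM).2 hsum] at hpar
    have := nontrivial_of_isIrreducible hU.1
    have h0 := hH.form_eq_zero hirr hsd F hF hpar
    exact hu.ne_zero (hinj (by rw [h0]; rfl))

/-- A real or a selfdual U carries a nondegenerate invariant form, which forces μ = -wμ. -/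
theorem isComplexType_of_ne (hH : IsHodgeRepresentation d Q ρ φ)
    (hU : IsAssociated ρ τ) (hL : HasDifferential τ L)
    (hu : IsHighestWeightVector b L μ u) (htop : wordSpan b L u = ⊤) (hw : IsLongest b w)
    (hne : μ ≠ -(w • μ)) : IsComplexType ρ τ := by
  refine ⟨hU.2.resolve_left fun h => hne (h.eq_neg_smul hH hL hu htop hw), ⟨fun e => hne ?_⟩⟩
  obtain ⟨F, hF⟩ := nonempty_equiv_iff.1 ⟨e⟩
  exact eq_neg_smul_of_form hL hu htop hw (F := F.toLinearMap)
    ((map_dual_iff _).1 hF) F.injective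

end Associated

/-! ### Dimensions of the Hodge pieces -/

section Dimension

open LieAlgebra LieAlgebra.IsKilling

variable {N : ℕ} {G : Subgroup (Matrix.GeneralLinearGroup (Fin N) ℂ)} [IsSemisimpleOverQ G]
  {V : Type*} [AddCommGroup V] [Module ℚ V]
  {ρ : Representation ℂ G (ℂ ⊗[ℚ] V)} {φ : Circle →* G}
  {U : Type*} [AddCommGroup U] [Module ℂ U]
  {τ : Representation ℂ G U} {L : lieAlg G →ₗ⁅ℂ⁆ Module.End ℂ U}

theorem finrank_circleWeightSpace (hL : HasDifferential τ L) (hφ : IsAlgebraicCircle φ)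
    {T : lieAlg G} (hT : (T : Matrix (Fin N) (Fin N) ℂ) = gradingMatrix φ)
    (F : (ℂ ⊗[ℚ] V) ≃ₗ[ℂ] U) (hF : ∀ g x, F (ρ g x) = τ g (F x)) (k : ℤ) :
    Module.finrank ℂ (circleWeightSpace (inducedCircle ρ φ) k) =
      Module.finrank ℂ ((L T).eigenspace ((k : ℂ) / 2)) := by
  have h : ((L T).eigenspace ((k : ℂ) / 2)).comap F.toLinearMap =
      circleWeightSpace (inducedCircle ρ φ) k := by
    ext x
    rw [Submodule.mem_comap, Module.End.mem_eigenspace_iff, LinearEquiv.coe_coe,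
      ← hL.circle_apply_iff hφ hT]
    refine forall_congr' fun z => ?_
    rw [← hF, ← map_smul, F.injective.eq_iff]
    rfl
  rw [← h]
  exact (LinearEquiv.submoduleMap F _).finrank_eq.trans (by
    rw [Submodule.map_comap_eq_of_surjective F.surjective])

theorem finrank_eigenspace_prodMap {U' : Type*} [AddCommGroup U'] [Module ℂ U']
    [FiniteDimensional ℂ U] [FiniteDimensional ℂ U'] (A : Module.End ℂ U) (A' : Module.End ℂ U')
    (c : ℂ) : Module.finrank ℂ (Module.End.eigenspace (A.prodMap A') c) =
      Module.finrank ℂ (A.eigenspace c) + Module.finrank ℂ (A'.eigenspace c) := by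
  have h : Module.End.eigenspace (A.prodMap A') c = (A.eigenspace c).prod (A'.eigenspace c) := by
    ext ⟨x, y⟩
    simp [Prod.ext_iff]
  let e : (A.eigenspace c).prod (A'.eigenspace c) ≃ₗ[ℂ] A.eigenspace c × A'.eigenspace c :=
    { toFun := fun x => (⟨x.1.1, x.2.1⟩, ⟨x.1.2, x.2.2⟩)
      map_add' := fun _ _ => rfl
      map_smul' := fun _ _ => rfl
      invFun := fun x => ⟨(x.1.1, x.2.1), x.1.2, x.2.2⟩
      left_inv := fun _ => rfl
      right_inv := fun _ => rfl }
  rw [h, e.finrank_eq, Module.finrank_prod]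

theorem isCalabiYau_iff [FiniteDimensional ℚ V] {ψ : Representation ℂ Circle (ℂ ⊗[ℚ] V)} {a : ℤ}
    (ha : 0 ≤ a) (h : ∀ k, a < k → Module.finrank ℂ (circleWeightSpace ψ k) = 0)
    (h0 : Module.finrank ℂ (circleWeightSpace ψ a) ≠ 0) :
    IsCalabiYau ψ ↔ Module.finrank ℂ (circleWeightSpace ψ a) = 1 := by
  lift a to ℕ using ha
  constructor
  · rintro ⟨m, hm, hm1⟩
    rcases lt_trichotomy (m : ℤ) a with hlt | heq | hgt
    · exact absurd (Submodule.finrank_eq_zero.2 (hm _ hlt)) h0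
    · rwa [← heq]
    · rw [h _ hgt] at hm1
      exact absurd hm1 zero_ne_one
  · exact fun h1 => ⟨a, fun k hk => Submodule.finrank_eq_zero.1 (h k hk), h1⟩

variable [FiniteDimensional ℂ U]

theorem finrank_eigenspace_eq_zero_iff {A : Module.End ℂ U} {c : ℂ} :
    Module.finrank ℂ (A.eigenspace c) = 0 ↔ ¬ A.HasEigenvalue c := by
  rw [Submodule.finrank_eq_zero, Module.End.hasEigenvalue_iff, not_not]

/-- The extreme eigenvalues are half-integers a/2 ≥ a'/2 with a ≥ 0, so a is the top circle weight,
and its multiplicity is read off on U or on U ⊕ U*. -/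
theorem isCalabiYau_inducedCircle_iff [FiniteDimensional ℚ V] {d : ℤ} {Q : LinearMap.BilinForm ℚ V}
    (hH : IsHodgeRepresentation d Q ρ φ) (hU : IsAssociated ρ τ) (hL : HasDifferential τ L)
    {T : lieAlg G} (hT : (T : Matrix (Fin N) (Fin N) ℂ) = gradingMatrix φ) {c c' : ℂ}
    (hev : (L T).HasEigenvalue c) (hev' : (dualLie L T).HasEigenvalue c')
    (hmax : ∀ x, (L T).HasEigenvalue x → x.re ≤ c.re)
    (hmax' : ∀ x, (dualLie L T).HasEigenvalue x → x.re ≤ c'.re)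
    (hle : c'.re ≤ c.re) (h0 : 0 ≤ c'.re + c.re) :
    IsCalabiYau (inducedCircle ρ φ) ↔
      Module.finrank ℂ ((L T).eigenspace c) = 1 ∧ (IsRealType ρ τ ∨ c ≠ c') := by
  have hφ := hH.isAlgebraicCircle
  have hneg := hU.circle_neg_one_apply hH
  obtain ⟨v, hv⟩ := hev.exists_hasEigenvector
  obtain ⟨ξ, hξ⟩ := hev'.exists_hasEigenvector
  obtain ⟨a, rfl⟩ := exists_half_int_of_exp_eq
    (hL.exp_eigenvalue hφ hT hneg hv.2 hv.apply_eq_smul)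
  obtain ⟨a', rfl⟩ := exists_half_int_of_exp_eq
    (hL.dual.exp_eigenvalue hφ hT (dual_circle_neg_one_apply hneg) hξ.2 hξ.apply_eq_smul)
  have hre : ∀ k : ℤ, ((k : ℂ) / 2).re = k / 2 := fun k => by
    rw [← Complex.ofReal_intCast, ← Complex.ofReal_ofNat, ← Complex.ofReal_div, Complex.ofReal_re]
  rw [hre] at hmax hle hmax' h0
  rw [hre] at hle h0
  have haa : a' ≤ a := by
    have : (a' : ℝ) ≤ a := by linarith
    exact_mod_cast this
  have ha0' : 0 ≤ a := by
    have : (0 : ℝ) ≤ a := by linarith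
    exact_mod_cast this
  have hzero : ∀ k : ℤ, a < k → Module.finrank ℂ ((L T).eigenspace ((k : ℂ) / 2)) = 0 := by
    intro k hk
    rw [finrank_eigenspace_eq_zero_iff]
    intro h
    have h1 := hmax _ h
    rw [hre] at h1
    have h2 : (a : ℝ) < k := by exact_mod_cast hk
    linarith
  have hzero' : ∀ k : ℤ, a' < k →
      Module.finrank ℂ ((dualLie L T).eigenspace ((k : ℂ) / 2)) = 0 := by
    intro k hk
    rw [finrank_eigenspace_eq_zero_iff]
    intro h
    have h1 := hmax' _ h
    rw [hre] at h1
    have h2 : (a' : ℝ) < k := by exact_mod_cast hk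
    linarith
  have hnz : Module.finrank ℂ ((L T).eigenspace ((a : ℂ) / 2)) ≠ 0 := fun h =>
    finrank_eigenspace_eq_zero_iff.1 h hev
  have hnz' : Module.finrank ℂ ((dualLie L T).eigenspace ((a' : ℂ) / 2)) ≠ 0 := fun h =>
    finrank_eigenspace_eq_zero_iff.1 h hev'
  by_cases hreal : IsRealType ρ τ
  · obtain ⟨F, hF⟩ := nonempty_equiv_iff.1 hreal
    have hd := finrank_circleWeightSpace hL hφ hT F hF
    rw [isCalabiYau_iff ha0' (fun k hk => (hd k).trans (hzero k hk)) (by rwa [hd]), hd]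
    exact (and_iff_left (Or.inl hreal)).symm
  · obtain ⟨F, hF⟩ := nonempty_equiv_iff.1 (hU.2.resolve_left hreal)
    have hd : ∀ k : ℤ, Module.finrank ℂ (circleWeightSpace (inducedCircle ρ φ) k) =
        Module.finrank ℂ ((L T).eigenspace ((k : ℂ) / 2)) +
          Module.finrank ℂ ((dualLie L T).eigenspace ((k : ℂ) / 2)) := fun k =>
      (finrank_circleWeightSpace (hL.prod hL.dual) hφ hT F hF k).trans
        (finrank_eigenspace_prodMap _ _ _)
    rw [isCalabiYau_iff ha0'
      (fun k hk => by rw [hd, hzero k hk, hzero' k (haa.trans_lt hk)]) (by rw [hd]; omega), hd]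
    -- U* contributes to the top piece only if the two largest eigenvalues agree, and then the
    -- dimension is at least two.
    rcases haa.lt_or_eq with hlt | rfl
    · rw [hzero' a hlt, add_zero]
      refine (and_iff_left (Or.inr fun h => hlt.ne' ?_)).symm
      have h1 : (a : ℂ) = a' := by linear_combination 2 * h
      exact_mod_cast h1
    · refine iff_of_false (by omega) ?_
      rintro ⟨-, h | h⟩
      · exact hreal h
      · exact h rfl

/-- The Calabi-Yau condition in terms of the highest weight. -/
theorem isCalabiYau_iff_highestWeight [FiniteDimensional ℚ V] {d : ℤ}
    {Q : LinearMap.BilinForm ℚ V} {H : LieSubalgebra ℂ (lieAlg G)} [H.IsCartanSubalgebra]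
    {b : (rootSystem H).Base} {T : H} {n : b.support → ℝ} {μ : Module.Dual ℂ H} {u : U}
    {w : (rootSystem H).weylGroup}
    (hH : IsHodgeRepresentation d Q ρ φ) (hU : IsAssociated ρ τ) (hL : HasDifferential τ L)
    (hu : IsHighestWeightVector b L μ u) (htop : wordSpan b L u = ⊤) (hw : IsLongest b w)
    (hT : ((T : lieAlg G) : Matrix (Fin N) (Fin N) ℂ) = gradingMatrix φ) (hn : ∀ i, 0 ≤ n i)
    (hroot : ∀ i : b.support, (rootSystem H).root i T = n i)
    (hle : ((-(w • μ)) T).re ≤ (μ T).re) :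
    IsCalabiYau (inducedCircle ρ φ) ↔
      (∀ i : b.support, n i = 0 → μ ((rootSystem H).coroot i) = 0) ∧
        (IsRealType ρ τ ∨ μ T ≠ (-(w • μ)) T) := by
  refine (exists_isHighestWeightVector_dual hu htop hw).elim fun ξ hξ => ?_
  rw [isCalabiYau_inducedCircle_iff hH hU hL hT
    (Module.End.hasEigenvalue_of_hasEigenvector
      ⟨Module.End.mem_eigenspace_iff.2 (hu.hasWeight T), hu.ne_zero⟩)
    (Module.End.hasEigenvalue_of_hasEigenvector
      ⟨Module.End.mem_eigenspace_iff.2 (hξ.hasWeight T), hξ.ne_zero⟩)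
    (fun _ hc => re_eigenvalue_le hu htop hn hroot hc)
    (fun _ hc => re_eigenvalue_dual_le hu htop hw hn hroot hc)
    hle (re_neg_smul_add_nonneg hu htop w hn hroot),
    finrank_eigenspace_eq_one_iff hu htop hn hroot]

end Dimension

end

end HodgeCY

/-! ### The proposition on Hodge representations of Calabi-Yau type -/

theorem propositionP
    {N : ℕ} (G : Subgroup (Matrix.GeneralLinearGroup (Fin N) ℂ)) [HodgeCY.IsSemisimpleOverQ G]
    {V : Type*} [AddCommGroup V] [Module ℚ V] [FiniteDimensional ℚ V]
    (wt : ℤ) (Q : LinearMap.BilinForm ℚ V)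
    (ρ : Representation ℂ G (TensorProduct ℚ ℂ V)) (φ : Circle →* G)
    (hHodge : HodgeCY.IsHodgeRepresentation wt Q ρ φ)
    (hirr : HodgeCY.IsRealIrreducible ρ)
    -- a Cartan subalgebra `H` that contains the grading element `T` of `φ`, and a base of simple
    -- roots for which the coefficients `n i` of `T` are nonnegative
    (H : LieSubalgebra ℂ (HodgeCY.lieAlg G)) [H.IsCartanSubalgebra]
    (b : (LieAlgebra.IsKilling.rootSystem H).Base)
    (T : H)
    (hT : ((T : HodgeCY.lieAlg G) : Matrix (Fin N) (Fin N) ℂ) = HodgeCY.gradingMatrix φ)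
    (n : b.support → ℝ) (hn : ∀ i, 0 ≤ n i)
    (hTn : T = ∑ i, (n i : ℂ) • HodgeCY.dualBasis b i)
    -- the associated complex representation `U`, its highest weight `μ`, and `μ* = -w₀ μ`
    {U : Type*} [AddCommGroup U] [Module ℂ U] [FiniteDimensional ℂ U]
    (τ : Representation ℂ G U) (hU : HodgeCY.IsAssociated ρ τ)
    (μ : Module.Dual ℂ H) (hμ : HodgeCY.IsHighestWeight b τ μ)
    (w₀ : (LieAlgebra.IsKilling.rootSystem H).weylGroup) (hw₀ : HodgeCY.IsLongest b w₀)
    (μs : Module.Dual ℂ H) (hμs : μs = -(w₀ • μ)) :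
    -- of the two representations `U`, `U*`, take the one with the larger value on `T`
    ((μs T).re ≤ (μ T).re →
      (HodgeCY.IsCalabiYau (HodgeCY.inducedCircle ρ φ) ↔
        (∀ i : b.support, n i = 0 → μ ((LieAlgebra.IsKilling.rootSystem H).coroot i) = 0) ∧
          (HodgeCY.IsRealType ρ τ ∨ μ T ≠ μs T))) ∧
    (HodgeCY.IsRealType ρ τ ↔ μ = μs ∧ ∃ k : ℤ, HodgeCY.evenSum b n μ = k) ∧
    (μ T ≠ μs T → HodgeCY.IsComplexType ρ τ) := by
  subst hμs
  refine (hμ.exists_differential hHodge.isDefinedOverQ hU).elim fun L h => h.elim fun u h => ?_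
  have hroot : ∀ i : b.support, (LieAlgebra.IsKilling.rootSystem H).root i T = n i := fun i => by
    rw [hTn, HodgeCY.root_sum_smul_dualBasis]
  refine ⟨fun hle => ?_, ?_, fun hne => ?_⟩
  · exact HodgeCY.isCalabiYau_iff_highestWeight hHodge hU h.1 h.2.2.1 h.2.2.2 hw₀
      hT hn hroot hle
  · exact HodgeCY.isRealType_iff hHodge hirr hU h.1 h.2.1 h.2.2.1 hw₀ hT hTn
  · exact HodgeCY.isComplexType_of_ne hHodge hU h.1 h.2.2.1 h.2.2.2 hw₀ fun he =>
      hne (LinearMap.congr_fun he T)
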